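/- **Proposition A.5.** A partition word of length $2k$ is a word with $k$ distinct letters, each occurring exactly twice, such that the first occurrences of the letters are in alphabetic order (for $k=0$ it is the empty word). The height $h(w)$ of a partition word $w$ is the number of its encapsulated partition subwords, that is, of substrings of the form $x w_1 x$ of $w$, where $x$ is a single letter and $w_1$ is a partition word or the empty word. There is exactly one symmetric probability measure $\gamma_M$ on $\mathbb{R}$ that has finite even moments given by $$\int x^{2k}\,\gamma_M(dx)=\sum_{w:\,|w|=2k}2^{h(w)},\qquad k=0,1,2,\dots,$$ where the sum runs over all partition words $w$ of length $2k$, and it is the free convolution $$\gamma_M=\gamma_0\boxplus\gamma_1$$ of the semicircle law $\gamma_0(dx)=\frac{1}{2\pi}\sqrt{4-x^2}\,\mathbf 1_{|x|\le 2}\,dx$ and the standard normal law $\gamma_1(dx)=\frac{1}{\sqrt{2\pi}}e^{-x^2/2}\,dx$. Here, for probability measures $\mu,\nu$ on $\mathbb{R}$, the free convolution $\mu\boxplus\nu$ is the unique probability measure with $\varphi_{\mu\boxplus\nu}=\varphi_\mu+\varphi_\nu$ on some truncated cone $\Gamma_{\alpha,\beta}=\{x+iy: y>\beta,\ |x|<\alpha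 y\}$, $\alpha,\beta>0$, where $\varphi_\mu(z)=F_\mu^{-1}(z)-z$ is the Voiculescu transform, $F_\mu(z)=\bigl(\int (z-x)^{-1}\mu(dx)\bigr)^{-1}$, and $F_\mu^{-1}$ is the holomorphic right inverse of $F_\mu$ on the cone with values in the upper half-plane and $F_\mu^{-1}(z)=z+o(|z|)$ as $z\to\infty$ in the cone. -/

import Mathlib

open MeasureTheory ProbabilityTheory Filter Topology

/-! ### Partition words -/

namespace PartitionWord

/-- Given a word `w` of length `n` with letters in the ordered alphabet `Fin k`, the letters of `w`
at the positions in `I` form a partition word (possibly the empty one): every letter that occurs in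
`I` occurs there exactly twice, and the first occurrences of the letters are in alphabetic order,
that is, every occurrence of a letter is preceded by an occurrence of each smaller letter that is
used in `I`. -/
def IsPartitionOn {n k : ℕ} (w : Fin n → Fin k) (I : Finset (Fin n)) : Prop :=
  (∀ l ∈ I, (I.filter fun m => w m = w l).card = 2) ∧
    ∀ l ∈ I, ∀ m ∈ I, w l < w m → ∃ l' ∈ I, l' < m ∧ w l' = w l

instance {n k : ℕ} (w : Fin n → Fin k) (I : Finset (Fin n)) : Decidable (IsPartitionOn w I) := by
  unfold IsPartitionOn
  infer_instance

/-- The partition words of length `2 * k`, with letters in `Fin k`. As each letter that is used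
occurs exactly twice, each of the `k` letters is used. -/
def words (k : ℕ) : Finset (Fin (2 * k) → Fin k) :=
  Finset.univ.filter fun w => IsPartitionOn w Finset.univ

/-- The height of `w`: the number of encapsulated partition subwords, that is, of substrings
`x w₁ x` of `w` (counted by the positions `i < j` of their two end letters `x`), with `x` a letter
and `w₁` a partition word or the empty word. -/
def height {n k : ℕ} (w : Fin n → Fin k) : ℕ :=
  (Finset.univ.filter fun p : Fin n × Fin n =>
    p.1 < p.2 ∧ w p.1 = w p.2 ∧ IsPartitionOn w (Finset.Ioo p.1 p.2)).card

end PartitionWord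

/-! ### Free convolution of probability measures on the line -/

namespace FreeConv

/-- The Cauchy transform `G_μ(z) = ∫ (z - x)⁻¹ μ(dx)`. -/
noncomputable def cauchyTransform (μ : Measure ℝ) (z : ℂ) : ℂ :=
  ∫ x : ℝ, (z - (x : ℂ))⁻¹ ∂μ

/-- The reciprocal Cauchy transform `F_μ = 1 / G_μ`. -/
noncomputable def reciprocalCauchyTransform (μ : Measure ℝ) (z : ℂ) : ℂ :=
  (cauchyTransform μ z)⁻¹

/-- The truncated cone `Γ_{α,β} = {x + i y : y > β, |x| < α y}`. -/
def cone (α β : ℝ) : Set ℂ :=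
  {z | β < z.im ∧ |z.re| < α * z.im}

/-- `φ` is the Voiculescu transform of `μ` on `Γ_{α,β}`: `φ(z) = F_μ⁻¹(z) - z`, where `F_μ⁻¹` is
the right inverse of `F_μ` with values in the upper half-plane that is holomorphic on the cone and
satisfies `F_μ⁻¹(z) = z + o(|z|)` as `z → ∞` in the cone. -/
structure IsVoiculescuTransform (μ : Measure ℝ) (α β : ℝ) (φ : ℂ → ℂ) : Prop where
  differentiableOn : DifferentiableOn ℂ φ (cone α β)
  im_pos : ∀ z ∈ cone α β, 0 < (z + φ z).im
  right_inverse : ∀ z ∈ cone α β, reciprocalCauchyTransform μ (z + φ z) = z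
  tendsto : Tendsto (fun z => φ z / z) (Bornology.cobounded ℂ ⊓ 𝓟 (cone α β)) (𝓝 0)

/-- `ρ` is the free convolution `μ ⊞ ν`: the Voiculescu transforms satisfy `φ_ρ = φ_μ + φ_ν` on a
truncated cone on which they are all defined. -/
def IsFreeConvolution (μ ν ρ : Measure ℝ) : Prop :=
  ∃ α β : ℝ, 0 < α ∧ 0 < β ∧ ∃ φμ φν : ℂ → ℂ,
    IsVoiculescuTransform μ α β φμ ∧ IsVoiculescuTransform ν α β φν ∧
      IsVoiculescuTransform ρ α β (fun z => φμ z + φν z)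

/-- The standard semicircle law, with density `√(4 - x²) / (2π)` on `[-2, 2]`. -/
noncomputable def semicircle : Measure ℝ :=
  (volume.restrict (Set.Icc (-2 : ℝ) 2)).withDensity fun x =>
    ENNReal.ofReal (Real.sqrt (4 - x ^ 2) / (2 * Real.pi))

/-- `ρ` is symmetric: invariant under `x ↦ -x`. -/
def IsSymmetric (ρ : Measure ℝ) : Prop :=
  ρ.map (fun x => -x) = ρ

/-- The even moments of `ρ` exist and `m_{2k}(ρ) = ∑_{|w| = 2k} 2 ^ h(w)` for all `k`, where `w`
runs over the partition words and `h` is the height. -/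
def HasHeightMoments (ρ : Measure ℝ) : Prop :=
  ∀ k : ℕ, Integrable (fun x : ℝ => x ^ (2 * k)) ρ ∧
    ∫ x : ℝ, x ^ (2 * k) ∂ρ = ∑ w ∈ PartitionWord.words k, (2 : ℝ) ^ PartitionWord.height w

end FreeConv

/-! Everything is compared with one object, the solution of the Pastur equation `G(z) = G_ν (z -
G(z))` with `ν` the standard normal law.

Analytic side. The semicircle law satisfies `F⁻¹(z) = z + 1/z`, so its Voiculescu transform is
`1/z`. With `v = z + 1/z + φ_ν(z)`, the relation `φ_ρ = 1/z + φ_ν` says that `G_ρ(v) = 1/z = G_ν (v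
- 1/z)`, which is the Pastur equation at `v`. On `Im z > 1` the map `u ↦ G_ν (z - u)` is a
contraction, which gives uniqueness and convergence of the iterates. Each iterate is a Cauchy
transform: for finitely supported laws `1 / (z - a - G_μ(z))` is the corner entry of the resolvent
of a bordered diagonal matrix, hence a convex combination of simple fractions by the spectral
theorem, and the general case follows by tightness
(`exists_cauchyTransform_eq_cauchyTransform_sub`). Thus `exists_cauchyTransform_eq_self_sub` yields
`γ`. Its equivalence with free convolution uses that `F_ν - id` is bounded and `1/2`-Lipschitz high
in the half-plane, so that `F_ν` has a right inverse there, and the identity theorem for the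
converse.

Moments. Put `w = z - G(z)` and `D_b = ∫ x^b / (w - x) dν`, so `D_0 = G`. From `w D_b = m_b +
D_{b+1}` comes `D_b = z⁻¹ (m_b + D_{b+1} + D_0 D_b)`, where `m_b` are the normal moments. This
determines the expansions of all `D_b` in `1/z` to every order, and by the Hamburger–Nevanlinna
argument the coefficients for `b = 0` are the moments of `γ`.

Combinatorial side. Partition words correspond to pairings of their positions, and encapsulated
subwords to isolated chords, those that no other chord crosses. Let `count b n` count pairings of `b
+ n` points with a factor `2` for each isolated chord starting among the last `n`. Writing the
factor of the first weighted point as `1 + 1`, one term forgets its weight; the other splits the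
pairing along an isolated chord into an inside and an outside. This (`count_succ`) is the recursion
for the coefficients of `D_b`, and `count b 0`, the number of pairings of `b` points, is `m_b`.

Determinacy. A pairing of `n` points has weight at most `2 ^ n`, so the moments grow slowly enough
for the characteristic function of a symmetric law to be the sum of its moment series. -/

namespace FreeConv

/-! ### Cauchy transforms: elementary estimates -/

lemma sub_ofReal_ne_zero {z : ℂ} (hz : 0 < z.im) (x : ℝ) : z - x ≠ 0 := fun h => by
  have := congrArg Complex.im h
  simp at this
  exact hz.ne' this

lemma im_le_norm_sub_ofReal (z : ℂ) (x : ℝ) : z.im ≤ ‖z - x‖ := by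
  simpa using (le_abs_self _).trans (Complex.abs_im_le_norm (z - x))

lemma norm_inv_sub_ofReal_le {z : ℂ} (hz : 0 < z.im) (x : ℝ) : ‖(z - x)⁻¹‖ ≤ z.im⁻¹ := by
  rw [norm_inv]
  exact inv_anti₀ hz (im_le_norm_sub_ofReal z x)

lemma continuous_inv_sub_ofReal {z : ℂ} (hz : 0 < z.im) :
    Continuous fun x : ℝ => (z - (x : ℂ))⁻¹ :=
  (by fun_prop : Continuous fun x : ℝ => z - (x : ℂ)).inv₀ (sub_ofReal_ne_zero hz)

lemma integrable_inv_sub_ofReal (μ : Measure ℝ) [IsFiniteMeasure μ] {z : ℂ} (hz : 0 < z.im) :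
    Integrable (fun x : ℝ => (z - (x : ℂ))⁻¹) μ :=
  Integrable.of_bound (continuous_inv_sub_ofReal hz).aestronglyMeasurable z.im⁻¹
    (.of_forall (norm_inv_sub_ofReal_le hz))

lemma norm_cauchyTransform_le (μ : Measure ℝ) [IsProbabilityMeasure μ] {z : ℂ} (hz : 0 < z.im) :
    ‖cauchyTransform μ z‖ ≤ z.im⁻¹ := by
  simpa [cauchyTransform] using norm_integral_le_of_norm_le_const (μ := μ) (.of_forall (norm_inv_sub_ofReal_le hz))

lemma cauchyTransform_im_nonpos (μ : Measure ℝ) [IsFiniteMeasure μ] {z : ℂ} (hz : 0 < z.im) :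
    (cauchyTransform μ z).im ≤ 0 := by
  have h : (cauchyTransform μ z).im = ∫ x : ℝ, ((z - (x : ℂ))⁻¹).im ∂μ :=
    (integral_im (integrable_inv_sub_ofReal μ hz)).symm
  rw [h]
  refine integral_nonpos fun x => ?_
  simp only [Complex.inv_im, Complex.sub_im, Complex.ofReal_im, sub_zero, Pi.zero_apply]
  exact div_nonpos_of_nonpos_of_nonneg (by linarith) (Complex.normSq_nonneg _)

/-- Subtracting a Cauchy transform never lowers the imaginary part, so `z - G(z)` is again an
admissible argument, as high as `z`. -/
lemma im_le_im_sub_cauchyTransform (μ : Measure ℝ) [IsFiniteMeasure μ] {z : ℂ} (hz : 0 < z.im) :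
    z.im ≤ (z - cauchyTransform μ z).im := by
  have := cauchyTransform_im_nonpos μ hz
  simp only [Complex.sub_im]
  linarith

/-- The resolvent identity, integrated. -/
lemma cauchyTransform_sub_eq (μ : Measure ℝ) [IsFiniteMeasure μ] {z w : ℂ} (hz : 0 < z.im)
    (hw : 0 < w.im) : cauchyTransform μ z - cauchyTransform μ w =
      (w - z) * ∫ x : ℝ, (z - (x : ℂ))⁻¹ * (w - (x : ℂ))⁻¹ ∂μ := by
  rw [cauchyTransform, cauchyTransform, ← integral_sub (integrable_inv_sub_ofReal μ hz)
    (integrable_inv_sub_ofReal μ hw), ← integral_const_mul]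
  refine integral_congr_ae (.of_forall fun x => ?_)
  have h1 := sub_ofReal_ne_zero hz x
  have h2 := sub_ofReal_ne_zero hw x
  simp only
  field_simp
  ring

/-- On `{Im > 1}` this makes the Cauchy transform strictly distance-decreasing, which drives
existence and uniqueness for the Pastur equation. -/
lemma norm_cauchyTransform_sub_le (μ : Measure ℝ) [IsProbabilityMeasure μ] {z w : ℂ}
    (hz : 0 < z.im) (hw : 0 < w.im) :
    ‖cauchyTransform μ z - cauchyTransform μ w‖ ≤ ‖z - w‖ * (z.im⁻¹ * w.im⁻¹) := by
  rw [cauchyTransform_sub_eq μ hz hw, norm_mul, norm_sub_rev w z]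
  gcongr
  have h : ∀ x : ℝ, ‖(z - (x : ℂ))⁻¹ * (w - (x : ℂ))⁻¹‖ ≤ z.im⁻¹ * w.im⁻¹ := fun x => by
    rw [norm_mul]
    exact mul_le_mul (norm_inv_sub_ofReal_le hz x) (norm_inv_sub_ofReal_le hw x) (norm_nonneg _)
      (inv_pos.2 hz).le
  simpa using norm_integral_le_of_norm_le_const (μ := μ) (.of_forall h)

lemma differentiableOn_cauchyTransform (μ : Measure ℝ) [IsProbabilityMeasure μ] :
    DifferentiableOn ℂ (cauchyTransform μ) {z | 0 < z.im} := by
  intro z hz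
  have hz : 0 < z.im := hz
  apply DifferentiableAt.differentiableWithinAt
  -- Above half the height of `z` the derivative of the integrand has a bound independent of `x`.
  have hO : IsOpen {w : ℂ | z.im / 2 < w.im} := isOpen_lt continuous_const Complex.continuous_im
  have hm : {w : ℂ | z.im / 2 < w.im} ∈ 𝓝 z := hO.mem_nhds (by simp; linarith)
  refine (hasDerivAt_integral_of_dominated_loc_of_deriv_le (μ := μ)
    (F := fun w x => (w - (x : ℂ))⁻¹) (F' := fun w x => -1 / (w - (x : ℂ)) ^ 2)
    (bound := fun _ => ((z.im / 2) ^ 2)⁻¹) hm ?_ (integrable_inv_sub_ofReal μ hz) ?_ ?_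
    (integrable_const _) ?_).2.differentiableAt
  · filter_upwards [hm] with w hw
    exact (continuous_inv_sub_ofReal (lt_trans (by positivity) hw)).aestronglyMeasurable
  · refine Continuous.aestronglyMeasurable ?_
    refine continuous_const.div (by fun_prop) fun x => pow_ne_zero 2 (sub_ofReal_ne_zero hz x)
  · refine .of_forall fun x w hw => ?_
    have hw : z.im / 2 < w.im := hw
    rw [norm_div, norm_neg, norm_one, norm_pow, one_div]
    have := im_le_norm_sub_ofReal w x
    gcongr
    linarith
  · refine .of_forall fun x w hw => ?_
    have hw' : 0 < w.im := lt_trans (by positivity) hw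
    exact ((hasDerivAt_id w).sub_const (x : ℂ)).inv (sub_ofReal_ne_zero hw' x)

/-- Solutions of `u = G (v - u)` with `v - u` in `{Im > 1}` are unique. -/
lemma eq_of_eq_cauchyTransform_sub (μ : Measure ℝ) [IsProbabilityMeasure μ] {v u u' : ℂ}
    (h : u = cauchyTransform μ (v - u)) (h' : u' = cauchyTransform μ (v - u'))
    (hu : 1 < (v - u).im) (hu' : 1 < (v - u').im) : u = u' := by
  by_contra hne
  have h1 := norm_cauchyTransform_sub_le μ (z := v - u) (w := v - u') (by linarith) (by linarith)
  rw [← h, ← h', sub_sub_sub_cancel_left, norm_sub_rev u' u] at h1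
  have h2 : (v - u).im⁻¹ * (v - u').im⁻¹ < 1 :=
    mul_lt_one_of_nonneg_of_lt_one_left (by positivity) (inv_lt_one_of_one_lt₀ hu)
      (inv_lt_one_of_one_lt₀ hu').le
  have h3 : 0 < ‖u - u'‖ := norm_pos_iff.2 (sub_ne_zero.2 hne)
  nlinarith

/-- `z G (z - u) → 1` as `z → ∞` along the imaginary axis, for bounded `u` with `Im u ≤ 0`. -/
lemma tendsto_mul_cauchyTransform_sub (μ : Measure ℝ) [IsProbabilityMeasure μ] (u : ℝ → ℂ)
    (hu : ∀ y > 1, ‖u y‖ ≤ 1 ∧ (u y).im ≤ 0) :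
    Tendsto (fun y : ℝ => (y * Complex.I) * cauchyTransform μ (y * Complex.I - u y)) atTop
      (𝓝 1) := by
  have hw : ∀ y > 1, y ≤ (y * Complex.I - u y).im := fun y hy => by
    have := (hu y hy).2
    simp; linarith
  have hinv : ∀ y > 1, ∀ x : ℝ, ‖(y * Complex.I - u y - x)⁻¹‖ ≤ y⁻¹ := fun y hy x =>
    (norm_inv_sub_ofReal_le (by linarith [hw y hy]) x).trans
      (inv_anti₀ (by linarith) (hw y hy))
  simp only [cauchyTransform, ← integral_const_mul]
  have h1 : (1 : ℂ) = ∫ _ : ℝ, (1 : ℂ) ∂μ := by simp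
  rw [h1]
  refine tendsto_integral_filter_of_dominated_convergence (fun _ => 1) ?_ ?_
    (integrable_const _) (.of_forall fun x => ?_)
  · filter_upwards [eventually_gt_atTop 1] with y hy
    exact ((continuous_inv_sub_ofReal (by linarith [hw y hy])).const_smul
      (y * Complex.I)).aestronglyMeasurable
  · filter_upwards [eventually_gt_atTop 1] with y hy
    refine .of_forall fun x => ?_
    rw [norm_mul, norm_mul, Complex.norm_I, mul_one, Complex.norm_real, Real.norm_of_nonneg
      (by linarith)]
    calc y * _ ≤ y * y⁻¹ := by gcongr; exact hinv y hy x
      _ = 1 := mul_inv_cancel₀ (by linarith)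
  · rw [tendsto_iff_norm_sub_tendsto_zero]
    have h2 : Tendsto (fun y : ℝ => (1 + |x|) * y⁻¹) atTop (𝓝 0) := by
      simpa using tendsto_inv_atTop_zero.const_mul (1 + |x|)
    refine squeeze_zero' (.of_forall fun _ => norm_nonneg _) ?_ h2
    filter_upwards [eventually_gt_atTop 1] with y hy
    have h0 := sub_ofReal_ne_zero (z := y * Complex.I - u y) (by linarith [hw y hy]) x
    have h3 : y * Complex.I * (y * Complex.I - u y - x)⁻¹ - 1 =
        (u y + x) * (y * Complex.I - u y - x)⁻¹ := by
      field_simp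
      ring
    rw [h3, norm_mul]
    refine mul_le_mul ((norm_add_le _ _).trans ?_) (hinv y hy x) (norm_nonneg _) (by positivity)
    simpa using (hu y hy).1

/-! ### Stieltjes inversion and uniqueness -/

/-- The function `t ↦ -Im (t + iy - x)⁻¹` is `π` times the Poisson kernel at height `y`; the
substitution `t = x + y s` and Fubini do the rest. The form on the left keeps a fixed weight `(1 +
s²)⁻¹`, which suits the limit `y → 0`. -/
lemma integral_poisson_eq_integral_cauchyTransform (μ : Measure ℝ) [IsProbabilityMeasure μ]
    (f : BoundedContinuousFunction ℝ ℝ) {y : ℝ} (hy : 0 < y) :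
    ∫ x, (∫ s : ℝ, f (x + y * s) * (1 + s ^ 2)⁻¹) ∂μ =
      ∫ t : ℝ, -f t * (cauchyTransform μ (t + y * Complex.I)).im := by
  have him : ∀ t : ℝ, 0 < ((t : ℂ) + y * Complex.I).im := fun t => by simpa using hy
  have hker : ∀ t x : ℝ, -((t + y * Complex.I - (x : ℂ))⁻¹).im =
      y⁻¹ * (1 + ((t - x) / y) ^ 2)⁻¹ := fun t x => by
    simp [Complex.inv_im, Complex.normSq_apply]
    field_simp
    ring
  have hsub : ∀ x : ℝ, ∀ h : ℝ → ℝ, ∫ s : ℝ, h (x + y * s) * (1 + s ^ 2)⁻¹ =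
      ∫ t : ℝ, h t * (y⁻¹ * (1 + ((t - x) / y) ^ 2)⁻¹) := fun x h => by
    have h1 := Measure.integral_comp_mul_left
      (fun t : ℝ => h (x + t) * (1 + (t / y) ^ 2)⁻¹) y
    have h2 := integral_add_right_eq_self (μ := volume)
      (fun t : ℝ => h t * (1 + ((t - x) / y) ^ 2)⁻¹) x
    simp only [mul_div_cancel_left₀ _ hy.ne', smul_eq_mul] at h1
    rw [h1, abs_of_pos (inv_pos.2 hy), ← integral_const_mul]
    simp only [add_sub_cancel_right] at h2
    rw [← integral_add_right_eq_self (μ := volume)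
      (fun t : ℝ => h t * (y⁻¹ * (1 + ((t - x) / y) ^ 2)⁻¹)) x]
    refine integral_congr_ae (.of_forall fun t => ?_)
    simp only [add_sub_cancel_right, add_comm x t]
    ring
  have hKint : ∀ x : ℝ, Integrable fun t : ℝ => y⁻¹ * (1 + ((t - x) / y) ^ 2)⁻¹ := fun x =>
    ((integrable_inv_one_add_sq.comp_div hy.ne').comp_sub_right x).const_mul _
  have hpos : ∀ t : ℝ, 0 < 1 + t ^ 2 := fun t => by positivity
  have hmeas : Continuous (Function.uncurry fun x t : ℝ =>
      f t * (y⁻¹ * (1 + ((t - x) / y) ^ 2)⁻¹)) := by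
    refine (f.continuous.comp continuous_snd).mul (continuous_const.mul
      (Continuous.inv₀ (by fun_prop) fun p => (hpos _).ne'))
  have hint : Integrable (Function.uncurry fun x t : ℝ =>
      f t * (y⁻¹ * (1 + ((t - x) / y) ^ 2)⁻¹)) (μ.prod volume) := by
    rw [integrable_prod_iff hmeas.aestronglyMeasurable]
    refine ⟨.of_forall fun x => (hKint x).bdd_mul f.continuous.aestronglyMeasurable
      (.of_forall f.norm_coe_le_norm), ?_⟩
    refine Integrable.of_bound hmeas.norm.aestronglyMeasurable.integral_prod_right'
      (‖f‖ * Real.pi) (.of_forall fun x => ?_)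
    have h1 : ∀ t : ℝ, ‖Function.uncurry (fun x t : ℝ =>
        f t * (y⁻¹ * (1 + ((t - x) / y) ^ 2)⁻¹)) (x, t)‖ =
        ‖f t‖ * (y⁻¹ * (1 + ((t - x) / y) ^ 2)⁻¹) := fun t => by
      simp only [Function.uncurry_apply_pair, norm_mul]
      congr 1
      rw [← norm_mul, Real.norm_of_nonneg]
      have := hpos ((t - x) / y)
      positivity
    simp only [h1]
    rw [← hsub x fun t => ‖f t‖, Real.norm_of_nonneg (integral_nonneg fun s =>
      mul_nonneg (norm_nonneg _) (inv_nonneg.2 (hpos s).le)), ← integral_univ_inv_one_add_sq,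
      ← integral_const_mul]
    refine integral_mono_of_nonneg (.of_forall fun s =>
      mul_nonneg (norm_nonneg _) (inv_nonneg.2 (hpos s).le))
      (integrable_inv_one_add_sq.const_mul _) (.of_forall fun s => ?_)
    exact mul_le_mul_of_nonneg_right (f.norm_coe_le_norm _) (inv_nonneg.2 (hpos s).le)
  rw [integral_congr_ae (.of_forall fun x => hsub x f), integral_integral_swap hint]
  refine integral_congr_ae (.of_forall fun t => ?_)
  have him' : (cauchyTransform μ (t + y * Complex.I)).im =
      ∫ x : ℝ, ((t + y * Complex.I - (x : ℂ))⁻¹).im ∂μ :=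
    (integral_im (integrable_inv_sub_ofReal μ (him t))).symm
  simp only [him', neg_mul, ← mul_neg, integral_const_mul, ← integral_neg, hker]

/-- A probability measure is determined by its Cauchy transform on the upper half-plane. -/
theorem ext_of_cauchyTransform {μ ν : Measure ℝ} [IsProbabilityMeasure μ] [IsProbabilityMeasure ν]
    (h : ∀ z : ℂ, 0 < z.im → cauchyTransform μ z = cauchyTransform ν z) : μ = ν := by
  -- As `y → 0` the inner integral tends to `f x` times the total weight `π`; dominated convergence
  -- applies twice.
  have key : ∀ (μ : Measure ℝ) [IsProbabilityMeasure μ] (f : BoundedContinuousFunction ℝ ℝ),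
      Tendsto (fun y : ℝ => ∫ x, (∫ s : ℝ, f (x + y * s) * (1 + s ^ 2)⁻¹) ∂μ) (𝓝[>] 0)
        (𝓝 (∫ x, f x * Real.pi ∂μ)) := by
    intro μ _ f
    have hb : ∀ x y s : ℝ, ‖f (x + y * s) * (1 + s ^ 2)⁻¹‖ ≤ ‖f‖ * (1 + s ^ 2)⁻¹ := fun x y s => by
      rw [norm_mul, Real.norm_of_nonneg (by positivity : 0 ≤ (1 + s ^ 2)⁻¹)]
      gcongr
      exact f.norm_coe_le_norm _
    have hc : ∀ y : ℝ, Continuous (Function.uncurry fun x s : ℝ =>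
        f (x + y * s) * (1 + s ^ 2)⁻¹) := fun y => by
      refine (f.continuous.comp (by fun_prop)).mul (Continuous.inv₀ (by fun_prop) fun p => ?_)
      have : 0 < 1 + p.2 ^ 2 := by positivity
      exact this.ne'
    refine tendsto_integral_filter_of_dominated_convergence (μ := μ) (fun _ => ‖f‖ * Real.pi)
      (.of_forall fun y => (hc y).aestronglyMeasurable.integral_prod_right')
      (.of_forall fun y => .of_forall fun x => ?_) (integrable_const _) (.of_forall fun x => ?_)
    · rw [← integral_univ_inv_one_add_sq, ← integral_const_mul]
      exact norm_integral_le_of_norm_le (integrable_inv_one_add_sq.const_mul _)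
        (.of_forall (hb x y))
    · rw [← integral_univ_inv_one_add_sq, ← integral_const_mul]
      refine tendsto_integral_filter_of_dominated_convergence (fun s => ‖f‖ * (1 + s ^ 2)⁻¹)
        (.of_forall fun y => ((hc y).comp (Continuous.prodMk_right x)).aestronglyMeasurable)
        (.of_forall fun y => .of_forall (hb x y)) (integrable_inv_one_add_sq.const_mul _)
        (.of_forall fun s => ?_)
      refine Tendsto.mul_const _ ?_
      have h1 : Tendsto (fun y : ℝ => f (x + y * s)) (𝓝 0) (𝓝 (f (x + 0 * s))) :=
        (f.continuous.comp (by fun_prop : Continuous fun y : ℝ => x + y * s)).tendsto 0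
      simpa using h1.mono_left nhdsWithin_le_nhds
  refine ext_of_forall_integral_eq_of_IsFiniteMeasure fun f => ?_
  have h1 := key μ f
  have h2 := (key ν f).congr' (f₂ := fun y : ℝ => ∫ x, (∫ s : ℝ, f (x + y * s) * (1 + s ^ 2)⁻¹) ∂μ)
    (by
      filter_upwards [self_mem_nhdsWithin] with y hy
      have hy : 0 < y := hy
      rw [integral_poisson_eq_integral_cauchyTransform μ f hy,
        integral_poisson_eq_integral_cauchyTransform ν f hy]
      refine integral_congr_ae (.of_forall fun t => ?_)
      simp only
      rw [h _ (by simpa using hy)])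
  have h3 := tendsto_nhds_unique h1 h2
  rw [integral_mul_const, integral_mul_const] at h3
  exact mul_right_cancel₀ Real.pi_ne_zero h3

/-- Probability measures are equal as soon as their Cauchy transforms agree on a set that
accumulates in the upper half-plane. -/
theorem ext_of_frequently_cauchyTransform_eq {μ ν : Measure ℝ} [IsProbabilityMeasure μ]
    [IsProbabilityMeasure ν] {z₀ : ℂ} (hz₀ : 0 < z₀.im)
    (h : ∃ᶠ z in 𝓝[≠] z₀, cauchyTransform μ z = cauchyTransform ν z) : μ = ν := by
  have hO : IsOpen {z : ℂ | 0 < z.im} := isOpen_lt continuous_const Complex.continuous_im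
  have hconv : Convex ℝ {z : ℂ | 0 < z.im} := convex_halfSpace_im_gt 0
  exact ext_of_cauchyTransform fun z hz =>
    ((differentiableOn_cauchyTransform μ).analyticOnNhd hO).eqOn_of_preconnected_of_frequently_eq
      ((differentiableOn_cauchyTransform ν).analyticOnNhd hO) hconv.isPreconnected hz₀ h hz

/-! ### Tightness and limits of Cauchy transforms -/

lemma re_mul_I_mul_inv_sub {y : ℝ} (hy : 0 < y) (x : ℝ) :
    (y * Complex.I * (y * Complex.I - (x : ℂ))⁻¹).re = y ^ 2 / (x ^ 2 + y ^ 2) := by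
  simp [Complex.inv_im, Complex.inv_re, Complex.normSq_apply]
  field_simp

lemma re_mul_cauchyTransform (μ : Measure ℝ) [IsProbabilityMeasure μ] {y : ℝ} (hy : 0 < y) :
    (y * Complex.I * cauchyTransform μ (y * Complex.I)).re = ∫ x, y ^ 2 / (x ^ 2 + y ^ 2) ∂μ := by
  rw [cauchyTransform, ← integral_const_mul]
  have h : (∫ x : ℝ, y * Complex.I * (y * Complex.I - (x : ℂ))⁻¹ ∂μ).re =
      ∫ x : ℝ, (y * Complex.I * (y * Complex.I - (x : ℂ))⁻¹).re ∂μ :=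
    (integral_re ((integrable_inv_sub_ofReal μ (by simpa using hy)).const_mul _)).symm
  rw [h]
  simp only [re_mul_I_mul_inv_sub hy]

/-- Markov's inequality: `1 - y² / (x² + y²)` is nonnegative, and at least `1/2` where `|x| > y`.
The mass far out is thus controlled by the Cauchy transform on the imaginary axis. -/
lemma measure_norm_gt_le (μ : Measure ℝ) [IsProbabilityMeasure μ] {y : ℝ} (hy : 0 < y) :
    μ {x | y < ‖x‖} ≤
      ENNReal.ofReal (2 * (1 - (y * Complex.I * cauchyTransform μ (y * Complex.I)).re)) := by
  rw [re_mul_cauchyTransform μ hy]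
  have hpos : ∀ x : ℝ, 0 < x ^ 2 + y ^ 2 := fun x => by positivity
  have hint : Integrable (fun x : ℝ => y ^ 2 / (x ^ 2 + y ^ 2)) μ := by
    refine Integrable.of_bound (continuous_const.div (by fun_prop)
      fun x => (hpos x).ne').aestronglyMeasurable 1 (.of_forall fun x => ?_)
    rw [Real.norm_of_nonneg (by have := hpos x; positivity), div_le_one (hpos x)]
    linarith [sq_nonneg x]
  have h1 : 1 - ∫ x, y ^ 2 / (x ^ 2 + y ^ 2) ∂μ = ∫ x, (1 - y ^ 2 / (x ^ 2 + y ^ 2)) ∂μ := by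
    rw [integral_sub (integrable_const _) hint]
    simp
  have h0 : ∀ x : ℝ, 0 ≤ 1 - y ^ 2 / (x ^ 2 + y ^ 2) := fun x => by
    rw [sub_nonneg, div_le_one (hpos x)]
    linarith [sq_nonneg x]
  have h2 := mul_meas_ge_le_integral_of_nonneg (μ := μ) (.of_forall h0)
    ((integrable_const _).sub hint) (1 / 2)
  have h3 : μ {x | y < ‖x‖} ≤ μ {x | 1 / 2 ≤ 1 - y ^ 2 / (x ^ 2 + y ^ 2)} := by
    refine measure_mono fun x hx => ?_
    have hx : y < |x| := hx
    have hx2 : y ^ 2 < x ^ 2 := by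
      rw [← sq_abs x]
      gcongr
    have : y ^ 2 / (x ^ 2 + y ^ 2) ≤ 1 / 2 := by
      rw [div_le_iff₀ (hpos x)]
      linarith
    simp only [Set.mem_ofPred_eq]
    linarith
  refine h3.trans ?_
  rw [h1, ← ofReal_measureReal]
  exact ENNReal.ofReal_le_ofReal (by linarith)

/-- Pointwise limits of Cauchy transforms of probability measures are Cauchy transforms of
probability measures, if no mass escapes. -/
theorem exists_cauchyTransform_eq_of_tendsto {μ : ℕ → Measure ℝ}
    [hμ : ∀ n, IsProbabilityMeasure (μ n)] {Φ : ℂ → ℂ}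
    (h : ∀ z : ℂ, 1 < z.im → Tendsto (fun n => cauchyTransform (μ n) z) atTop (𝓝 (Φ z)))
    (hΦ : Tendsto (fun y : ℝ => y * Complex.I * Φ (y * Complex.I)) atTop (𝓝 1)) :
    ∃ ρ : Measure ℝ, IsProbabilityMeasure ρ ∧ ∀ z : ℂ, 1 < z.im → cauchyTransform ρ z = Φ z := by
  have htight : IsTightMeasureSet (Set.range μ) := by
    refine isTightMeasureSet_range_of_tendsto_limsup_measure_norm_gt ?_
    have h1 : Tendsto (fun y : ℝ =>
        ENNReal.ofReal (2 * (1 - (y * Complex.I * Φ (y * Complex.I)).re))) atTop (𝓝 0) := by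
      have h2 := (Complex.continuous_re.tendsto 1).comp hΦ
      have h3 := ENNReal.tendsto_ofReal ((h2.const_sub 1).const_mul 2)
      simpa using h3
    refine tendsto_of_tendsto_of_tendsto_of_le_of_le' tendsto_const_nhds h1
      (.of_forall fun _ => zero_le) ?_
    filter_upwards [eventually_gt_atTop 1] with y hy
    have hlim : Tendsto (fun n => ENNReal.ofReal
        (2 * (1 - (y * Complex.I * cauchyTransform (μ n) (y * Complex.I)).re))) atTop
        (𝓝 (ENNReal.ofReal (2 * (1 - (y * Complex.I * Φ (y * Complex.I)).re)))) := by
      refine ENNReal.tendsto_ofReal (((Tendsto.const_sub 1 ?_)).const_mul 2)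
      exact (Complex.continuous_re.tendsto _).comp
        ((h (y * Complex.I) (by simpa using hy)).const_mul (y * Complex.I))
    rw [← hlim.limsup_eq]
    exact limsup_le_limsup (.of_forall fun n => measure_norm_gt_le (μ n) (by linarith))
  let P : ℕ → ProbabilityMeasure ℝ := fun n => ⟨μ n, hμ n⟩
  have hcpt : IsCompact (closure (Set.range P)) := by
    refine isCompact_closure_of_isTightMeasureSet ?_
    convert htight
    ext ν
    exact ⟨fun ⟨_, ⟨n, hn⟩, h⟩ => ⟨n, by rw [← h, ← hn]; rfl⟩,
      fun ⟨n, hn⟩ => ⟨P n, ⟨n, rfl⟩, hn⟩⟩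
  -- Convergence along an ultrafilter finer than `atTop` takes the place of a convergent
  -- subsequence.
  obtain ⟨ρ, -, hρ : Tendsto _ _ _⟩ := hcpt.ultrafilter_le_nhds ((hyperfilter ℕ).map P)
    (.trans (by simp) (monotone_principal subset_closure))
  rw [ProbabilityMeasure.tendsto_iff_forall_integral_rclike_tendsto ℂ] at hρ
  refine ⟨ρ, inferInstance, fun z hz => ?_⟩
  have hz0 : 0 < z.im := by linarith
  have h1 := hρ (BoundedContinuousFunction.ofNormedAddCommGroup _
    (continuous_inv_sub_ofReal hz0) z.im⁻¹ (norm_inv_sub_ofReal_le hz0))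
  refine tendsto_nhds_unique h1 ?_
  exact (h z hz).mono_left (Nat.hyperfilter_le_atTop)

/-! ### Composition `G_ν (z - G_μ z)` through finite matrices -/

lemma im_sum_div_sub_nonpos {ι : Type*} [Fintype ι] {p : ι → ℝ} (hp : ∀ i, 0 ≤ p i) (x : ι → ℝ)
    {z : ℂ} (hz : 0 < z.im) : (∑ i, (p i : ℂ) / (z - x i)).im ≤ 0 := by
  rw [Complex.im_sum]
  refine Finset.sum_nonpos fun i _ => ?_
  rw [div_eq_mul_inv, Complex.im_ofReal_mul, Complex.inv_im]
  refine mul_nonpos_of_nonneg_of_nonpos (hp i) (div_nonpos_of_nonpos_of_nonneg ?_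
    (Complex.normSq_nonneg _))
  simpa using hz.le

/-- The resolvent of the Hermitian matrix `[[a, √p], [√p, diag x]]`, evaluated at its first
basis vector. -/
lemma exists_inv_sub_sub_sum_eq {ι : Type*} [Fintype ι] [DecidableEq ι] {p : ι → ℝ}
    (hp : ∀ i, 0 ≤ p i) (x : ι → ℝ) (a : ℝ) :
    ∃ (w d : Fin (Fintype.card (Option ι)) → ℝ), (∀ k, 0 ≤ w k) ∧ ∑ k, w k = 1 ∧
      ∀ z : ℂ, 0 < z.im →
        (z - a - ∑ i, (p i : ℂ) / (z - x i))⁻¹ = ∑ k, (w k : ℂ) / (z - d k) := by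
  let M : Matrix (Option ι) (Option ι) ℂ := Matrix.of fun i j =>
    match i, j with
    | none, none => (a : ℂ)
    | none, some j => (√(p j) : ℂ)
    | some i, none => (√(p i) : ℂ)
    | some i, some j => if i = j then (x i : ℂ) else 0
  have hM : M.IsHermitian := by
    ext i j
    rcases i with _ | i <;> rcases j with _ | j <;> simp [M, Matrix.conjTranspose_apply]
    by_cases h : i = j
    · subst h; simp
    · simp [h, Ne.symm h]
  have hT := (Matrix.isSymmetric_toEuclideanLin_iff).2 hM
  have hn : Module.finrank ℂ (EuclideanSpace ℂ (Option ι)) = Fintype.card (Option ι) :=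
    finrank_euclideanSpace
  set e := hT.eigenvectorBasis hn
  set d := hT.eigenvalues hn
  let e₀ : EuclideanSpace ℂ (Option ι) := EuclideanSpace.single none 1
  refine ⟨fun k => ‖inner ℂ (e k) e₀‖ ^ 2, d, fun k => by positivity, ?_, fun z hz => ?_⟩
  · rw [e.sum_sq_norm_inner_right]
    simp [e₀]
  have hzx : ∀ i, z - x i ≠ 0 := fun i => sub_ofReal_ne_zero hz (x i)
  have hs : z - a - ∑ i, (p i : ℂ) / (z - x i) ≠ 0 := fun h => by
    have h1 := congrArg Complex.im h
    have h2 := im_sum_div_sub_nonpos hp x hz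
    simp only [Complex.sub_im, Complex.ofReal_im, Complex.zero_im] at h1
    linarith
  set s := (z - a - ∑ i, (p i : ℂ) / (z - x i))⁻¹ with hsdef
  -- The solution of `(z - M) v = e₀`, found by eliminating the diagonal block; its first entry is
  -- the inverse Schur complement `s`.
  let v : EuclideanSpace ℂ (Option ι) := WithLp.toLp 2 fun j =>
    match j with
    | none => s
    | some i => (√(p i) : ℂ) * s / (z - x i)
  have hsq : ∀ i, (√(p i) : ℂ) * √(p i) = p i := fun i => by
    rw [← Complex.ofReal_mul, Real.mul_self_sqrt (hp i)]
  have hTv : Matrix.toEuclideanLin M v = z • v - e₀ := by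
    ext j
    rcases j with _ | j
    · have h1 : (z - a - ∑ i, (p i : ℂ) / (z - x i)) * s = 1 := mul_inv_cancel₀ hs
      have h2 : ∑ i, (√(p i) : ℂ) * (√(p i) * s / (z - x i)) = (∑ i, (p i : ℂ) / (z - x i)) * s := by
        rw [Finset.sum_mul]
        refine Finset.sum_congr rfl fun i _ => ?_
        rw [← hsq]
        ring
      simp [Matrix.mulVec, dotProduct, M, v, e₀, h2]
      linear_combination -h1
    · simp [Matrix.mulVec, dotProduct, M, v, e₀]
      have := hzx j
      field_simp
      ring
  -- In the eigenbasis the equation `(z - M) v = e₀` decouples; Parseval then turns `⟨e₀, v⟩` into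
  -- the required sum.
  have hk : ∀ k, inner ℂ (e k) v = inner ℂ (e k) e₀ / (z - d k) := fun k => by
    have h1 : inner ℂ (e k) (Matrix.toEuclideanLin M v) = d k * inner ℂ (e k) v := by
      rw [← hT, hT.apply_eigenvectorBasis hn k, inner_smul_left]
      simp [d, e]
    rw [hTv, inner_sub_right, inner_smul_right] at h1
    rw [eq_div_iff (sub_ofReal_ne_zero hz (d k))]
    linear_combination h1
  have hv : s = inner ℂ e₀ v := by
    rw [EuclideanSpace.inner_single_left]
    simp [v]
  rw [hv, ← e.sum_inner_mul_inner]
  refine Finset.sum_congr rfl fun k _ => ?_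
  rw [hk, ← inner_conj_symm e₀ (e k), ← mul_div_assoc, ← Complex.normSq_eq_conj_mul_self,
    Complex.normSq_eq_norm_sq]

/-- A convex combination of simple fractions is a Cauchy transform. -/
lemma exists_cauchyTransform_eq_sum {κ : Type*} [Fintype κ] {w : κ → ℝ} (hw : ∀ k, 0 ≤ w k)
    (hw1 : ∑ k, w k = 1) (d : κ → ℝ) :
    ∃ ρ : Measure ℝ, IsProbabilityMeasure ρ ∧
      ∀ z : ℂ, 0 < z.im → cauchyTransform ρ z = ∑ k, (w k : ℂ) / (z - d k) := by
  refine ⟨∑ k, ENNReal.ofReal (w k) • Measure.dirac (d k), ⟨?_⟩, fun z hz => ?_⟩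
  · simp [Measure.finsetSum_apply, ← ENNReal.ofReal_sum_of_nonneg fun k _ => hw k, hw1]
  · have hint : ∀ k, Integrable (fun x : ℝ => (z - (x : ℂ))⁻¹)
        (ENNReal.ofReal (w k) • Measure.dirac (d k)) := fun k =>
      (integrable_inv_sub_ofReal _ hz).smul_measure ENNReal.ofReal_ne_top
    rw [cauchyTransform, integral_finsetSum_measure fun k _ => hint k]
    refine Finset.sum_congr rfl fun k _ => ?_
    rw [integral_smul_measure, integral_dirac, ENNReal.toReal_ofReal (hw k), Complex.real_smul,
      div_eq_mul_inv]

lemma sum_measureReal_preimage_simpleFunc (μ : Measure ℝ) [IsProbabilityMeasure μ]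
    (s : SimpleFunc ℝ ℝ) : ∑ b : s.range, μ.real (s ⁻¹' {(b : ℝ)}) = 1 := by
  rw [Finset.sum_coe_sort s.range fun b => μ.real (s ⁻¹' {b}),
    sum_measureReal_preimage_singleton _ fun b _ => s.measurableSet_fiber b, SimpleFunc.coe_range,
    Set.preimage_range]
  simp

lemma cauchyTransform_map_simpleFunc (μ : Measure ℝ) [IsProbabilityMeasure μ] (s : SimpleFunc ℝ ℝ)
    (z : ℂ) : cauchyTransform (μ.map s) z =
      ∑ b : s.range, ((μ.real (s ⁻¹' {(b : ℝ)}) : ℝ) : ℂ) / (z - (b : ℝ)) := by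
  have h1 : cauchyTransform (μ.map s) z = ∫ x, (s.map fun b : ℝ => (z - (b : ℂ))⁻¹) x ∂μ := by
    rw [cauchyTransform, integral_map s.measurable.aemeasurable]
    · rfl
    · exact (by fun_prop : Measurable fun x : ℝ => (z - (x : ℂ))⁻¹).aestronglyMeasurable
  have h2 : ∀ x, (s.map fun b : ℝ => (z - (b : ℂ))⁻¹) x =
      ∑ b ∈ s.range, (s ⁻¹' {b}).indicator (fun _ => (z - (b : ℂ))⁻¹) x := fun x => by
    rw [Finset.sum_eq_single (s x)]
    · simp
    · intro b _ hb
      exact Set.indicator_of_notMem (fun h => hb h.symm) _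
    · exact fun h => absurd (s.mem_range_self x) h
  rw [h1, integral_congr_ae (.of_forall h2), integral_finsetSum _ fun b _ =>
    (integrable_const _).indicator (s.measurableSet_fiber b),
    Finset.sum_coe_sort s.range fun b => ((μ.real (s ⁻¹' {b}) : ℝ) : ℂ) / (z - b)]
  refine Finset.sum_congr rfl fun b _ => ?_
  rw [integral_indicator_const _ (s.measurableSet_fiber b), Complex.real_smul, div_eq_mul_inv]

/-- For a discretised `ν` the right side is a convex combination of terms `1 / (z - b - G(z))`, and
each of these is itself a convex combination of simple fractions; the weights multiply. -/
lemma exists_cauchyTransform_sub_of_simpleFunc (μ ν : Measure ℝ) [IsProbabilityMeasure μ]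
    [IsProbabilityMeasure ν] (s : SimpleFunc ℝ ℝ) :
    ∃ ρ : Measure ℝ, IsProbabilityMeasure ρ ∧ ∀ z : ℂ, 0 < z.im → cauchyTransform ρ z =
      cauchyTransform (ν.map s) (z - cauchyTransform (μ.map s) z) := by
  classical
  choose w d hw hw1 hG using exists_inv_sub_sub_sum_eq
    (p := fun b : s.range => μ.real (s ⁻¹' {(b : ℝ)})) (fun _ => measureReal_nonneg)
    (fun b : s.range => (b : ℝ))
  obtain ⟨ρ, hρ, h⟩ := exists_cauchyTransform_eq_sum
    (κ := s.range × Fin (Fintype.card (Option s.range)))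
    (w := fun k => ν.real (s ⁻¹' {(k.1 : ℝ)}) * w k.1 k.2)
    (fun k => mul_nonneg measureReal_nonneg (hw _ _)) (by
      rw [Fintype.sum_prod_type]
      simp only [← Finset.mul_sum, hw1, mul_one]
      exact sum_measureReal_preimage_simpleFunc ν s) (fun k => d k.1 k.2)
  refine ⟨ρ, hρ, fun z hz => ?_⟩
  rw [h z hz, cauchyTransform_map_simpleFunc, cauchyTransform_map_simpleFunc,
    Fintype.sum_prod_type]
  refine Finset.sum_congr rfl fun b _ => ?_
  rw [sub_right_comm, div_eq_mul_inv, hG b z hz, Finset.mul_sum]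
  refine Finset.sum_congr rfl fun k _ => ?_
  push_cast
  ring

/-- If `G_μ` and `G_ν` are the Cauchy transforms of `μ` and `ν` then so is
`z ↦ G_ν (z - G_μ z)`. -/
theorem exists_cauchyTransform_eq_cauchyTransform_sub (μ ν : Measure ℝ) [IsProbabilityMeasure μ]
    [IsProbabilityMeasure ν] :
    ∃ ρ : Measure ℝ, IsProbabilityMeasure ρ ∧ ∀ z : ℂ, 1 < z.im → cauchyTransform ρ z =
      cauchyTransform ν (z - cauchyTransform μ z) := by
  let s : ℕ → SimpleFunc ℝ ℝ := (stronglyMeasurable_id (α := ℝ)).approx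
  have hs : ∀ x, Tendsto (fun n => s n x) atTop (𝓝 x) :=
    (stronglyMeasurable_id (α := ℝ)).tendsto_approx
  have hprob : ∀ (μ : Measure ℝ) [IsProbabilityMeasure μ] n, IsProbabilityMeasure (μ.map (s n)) :=
    fun μ _ n => Measure.isProbabilityMeasure_map (s n).measurable.aemeasurable
  have hlim : ∀ (μ : Measure ℝ) [IsProbabilityMeasure μ] (z : ℂ), 0 < z.im →
      Tendsto (fun n => cauchyTransform (μ.map (s n)) z) atTop (𝓝 (cauchyTransform μ z)) := by
    intro μ _ z hz
    have h1 : ∀ n, cauchyTransform (μ.map (s n)) z = ∫ x, (z - (s n x : ℂ))⁻¹ ∂μ := fun n => by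
      rw [cauchyTransform, integral_map (s n).measurable.aemeasurable]
      exact (continuous_inv_sub_ofReal hz).aestronglyMeasurable
    simp only [h1]
    refine tendsto_integral_of_dominated_convergence (fun _ => z.im⁻¹) (fun n => ?_)
      (integrable_const _) (fun n => .of_forall fun x => norm_inv_sub_ofReal_le hz _)
      (.of_forall fun x => ?_)
    · exact ((continuous_inv_sub_ofReal hz).measurable.comp (s n).measurable).aestronglyMeasurable
    · exact ((continuous_inv_sub_ofReal hz).tendsto x).comp (hs x)
  choose ρ hρ h using fun n => exists_cauchyTransform_sub_of_simpleFunc μ ν (s n)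
  refine exists_cauchyTransform_eq_of_tendsto (μ := ρ)
    (Φ := fun z => cauchyTransform ν (z - cauchyTransform μ z)) (fun z hz => ?_)
    (tendsto_mul_cauchyTransform_sub ν (fun y : ℝ => cauchyTransform μ (y * Complex.I))
      fun y hy => ?_)
  · have hz0 : 0 < z.im := by linarith
    have hw := im_le_im_sub_cauchyTransform μ hz0
    have h1 := hlim ν (z - cauchyTransform μ z) (by linarith)
    -- The argument `z - G(z)` also moves with `n`; the Lipschitz bound, uniform in the measure,
    -- absorbs this.
    refine h1.congr_dist ?_
    have h2 := tendsto_iff_norm_sub_tendsto_zero.1 (hlim μ z hz0)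
    refine squeeze_zero (fun _ => dist_nonneg) (fun n => ?_) h2
    have := hprob μ n
    have := hprob ν n
    have hwn := im_le_im_sub_cauchyTransform (μ.map (s n)) hz0
    rw [dist_eq_norm, h n z hz0]
    refine (norm_cauchyTransform_sub_le _ (by linarith) (by linarith)).trans ?_
    rw [sub_sub_sub_cancel_left]
    refine mul_le_of_le_one_right (norm_nonneg _) (mul_le_one₀ (inv_le_one_of_one_le₀ ?_)
      (inv_nonneg.2 ?_) (inv_le_one_of_one_le₀ ?_)) <;> linarith
  · have hy0 : 0 < (y * Complex.I).im := by simp; linarith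
    refine ⟨(norm_cauchyTransform_le μ hy0).trans (inv_le_one_of_one_le₀ ?_),
      cauchyTransform_im_nonpos μ hy0⟩
    simpa using hy.le

/-! ### The Pastur equation: existence, uniqueness, symmetry -/

/-- The Pastur equation `G(z) = G_ν (z - G(z))` is solved by the Cauchy transform of a probability
measure. -/
theorem exists_cauchyTransform_eq_self_sub (ν : Measure ℝ) [IsProbabilityMeasure ν] :
    ∃ ρ : Measure ℝ, IsProbabilityMeasure ρ ∧ ∀ z : ℂ, 1 < z.im →
      cauchyTransform ρ z = cauchyTransform ν (z - cauchyTransform ρ z) := by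
  have step : ∀ μ : ProbabilityMeasure ℝ, ∃ ρ : ProbabilityMeasure ℝ, ∀ z : ℂ, 1 < z.im →
      cauchyTransform ρ z = cauchyTransform ν (z - cauchyTransform μ z) := fun μ => by
    obtain ⟨ρ, hρ, h⟩ := exists_cauchyTransform_eq_cauchyTransform_sub (μ : Measure ℝ) ν
    exact ⟨⟨ρ, hρ⟩, h⟩
  choose T hT using step
  let P : ℕ → ProbabilityMeasure ℝ := fun n => T^[n] ⟨ν, inferInstance⟩
  have hP : ∀ n (z : ℂ), 1 < z.im → cauchyTransform (P (n + 1)) z =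
      cauchyTransform ν (z - cauchyTransform (P n) z) := fun n z hz => by
    rw [show P (n + 1) = T (P n) from Function.iterate_succ_apply' T n _]
    exact hT _ z hz
  have hw : ∀ n (z : ℂ), 1 < z.im → z.im ≤ (z - cauchyTransform (P n) z).im := fun n z hz =>
    im_le_im_sub_cauchyTransform _ (by linarith)
  -- Keeping only one of the two factors `1 / Im` leaves the contraction ratio `1 / Im z < 1`,
  -- independent of the step.
  have hlip : ∀ z w w' : ℂ, 1 < z.im → z.im ≤ w.im → z.im ≤ w'.im →
      ‖cauchyTransform ν w - cauchyTransform ν w'‖ ≤ ‖w - w'‖ * z.im⁻¹ := fun z w w' hz h h' => by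
    refine (norm_cauchyTransform_sub_le ν (by linarith) (by linarith)).trans ?_
    gcongr
    refine (mul_le_of_le_one_right (inv_nonneg.2 (by linarith))
      (inv_le_one_of_one_le₀ (by linarith))).trans (inv_anti₀ (by linarith) h)
  have hcauchy : ∀ z : ℂ, 1 < z.im → CauchySeq fun n => cauchyTransform (P n) z := fun z hz => by
    have hb : ∀ n, dist (cauchyTransform (P n) z) (cauchyTransform (P (n + 1)) z) ≤
        dist (cauchyTransform (P 0) z) (cauchyTransform (P 1) z) * z.im⁻¹ ^ n := fun n => by
      induction n with
      | zero => simp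
      | succ n ih =>
        have h1 := hlip z _ _ hz (hw n z hz) (hw (n + 1) z hz)
        rw [← hP n z hz, ← hP (n + 1) z hz, sub_sub_sub_cancel_left, norm_sub_rev, ← dist_eq_norm,
          ← dist_eq_norm] at h1
        calc _ ≤ dist (cauchyTransform (P n) z) (cauchyTransform (P (n + 1)) z) * z.im⁻¹ := by
              rw [dist_comm (cauchyTransform (P n) z)]
              exact (dist_comm _ _).trans_le h1
          _ ≤ _ := by
              rw [pow_succ, ← mul_assoc]
              exact mul_le_mul_of_nonneg_right ih (inv_nonneg.2 (by linarith))
    exact cauchySeq_of_le_geometric _ _ (inv_lt_one_of_one_lt₀ hz) hb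
  have hex : ∀ z : ℂ, ∃ l, 1 < z.im → Tendsto (fun n => cauchyTransform (P n) z) atTop (𝓝 l) :=
    fun z => by
      by_cases hz : 1 < z.im
      · obtain ⟨l, hl⟩ := cauchySeq_tendsto_of_complete (hcauchy z hz)
        exact ⟨l, fun _ => hl⟩
      · exact ⟨0, fun h => absurd h hz⟩
  choose Φ hΦ using hex
  have him : ∀ z : ℂ, 1 < z.im → (Φ z).im ≤ 0 := fun z hz =>
    le_of_tendsto' ((Complex.continuous_im.tendsto _).comp (hΦ z hz)) fun n =>
      cauchyTransform_im_nonpos _ (by linarith)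
  have hnorm : ∀ z : ℂ, 1 < z.im → ‖Φ z‖ ≤ 1 := fun z hz =>
    le_of_tendsto' (hΦ z hz).norm fun n => (norm_cauchyTransform_le _ (by linarith)).trans
      (inv_le_one_of_one_le₀ hz.le)
  have hfix : ∀ z : ℂ, 1 < z.im → Φ z = cauchyTransform ν (z - Φ z) := fun z hz => by
    have h1 := (hΦ z hz).comp (tendsto_add_atTop_nat 1)
    refine tendsto_nhds_unique h1 (tendsto_iff_norm_sub_tendsto_zero.2 ?_)
    have h2 := (tendsto_iff_norm_sub_tendsto_zero.1 (hΦ z hz)).mul_const z.im⁻¹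
    rw [zero_mul] at h2
    refine squeeze_zero (fun _ => norm_nonneg _) (fun n => ?_) h2
    have := him z hz
    simp only [Function.comp_apply, hP n z hz]
    refine (hlip z _ _ hz (hw n z hz) ?_).trans_eq ?_
    · simp only [Complex.sub_im]
      linarith
    · rw [sub_sub_sub_cancel_left, norm_sub_rev]
  obtain ⟨ρ, hρ, h⟩ := exists_cauchyTransform_eq_of_tendsto (μ := fun n => (P n : Measure ℝ)) hΦ
    ((tendsto_mul_cauchyTransform_sub ν (fun y : ℝ => Φ (y * Complex.I)) fun y hy =>
      ⟨hnorm _ (by simpa using hy), him _ (by simpa using hy)⟩).congr' (by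
        filter_upwards [eventually_gt_atTop 1] with y hy
        rw [← hfix _ (by simpa using hy)]))
  exact ⟨ρ, hρ, fun z hz => by rw [h z hz]; exact hfix z hz⟩

/-- Uniqueness in the Pastur equation. -/
theorem eq_of_frequently_cauchyTransform_eq_self_sub {ν ρ ρ' : Measure ℝ} [IsProbabilityMeasure ν]
    [IsProbabilityMeasure ρ] [IsProbabilityMeasure ρ']
    (h : ∀ z : ℂ, 1 < z.im → cauchyTransform ρ z = cauchyTransform ν (z - cauchyTransform ρ z))
    {z₀ : ℂ} (hz₀ : 1 < z₀.im)
    (h' : ∃ᶠ z in 𝓝[≠] z₀, cauchyTransform ρ' z = cauchyTransform ν (z - cauchyTransform ρ' z)) :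
    ρ' = ρ := by
  refine ext_of_frequently_cauchyTransform_eq (z₀ := z₀) (by linarith) ?_
  have hO : {z : ℂ | 1 < z.im} ∈ 𝓝[≠] z₀ := nhdsWithin_le_nhds
    ((isOpen_lt continuous_const Complex.continuous_im).mem_nhds hz₀)
  refine (h'.and_eventually hO).mono fun z hz => ?_
  have hz1 : 1 < z.im := hz.2
  have h1 := im_le_im_sub_cauchyTransform ρ (z := z) (by linarith)
  have h2 := im_le_im_sub_cauchyTransform ρ' (z := z) (by linarith)
  exact eq_of_eq_cauchyTransform_sub ν hz.1 (h z hz1) (by linarith) (by linarith)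

lemma cauchyTransform_map_neg (μ : Measure ℝ) (z : ℂ) :
    cauchyTransform (μ.map fun x => -x) z = -starRingEnd ℂ (cauchyTransform μ (-starRingEnd ℂ z)) := by
  rw [cauchyTransform, integral_map (by fun_prop)
    (by fun_prop : Measurable fun x : ℝ => (z - (x : ℂ))⁻¹).aestronglyMeasurable, cauchyTransform,
    ← integral_conj, ← integral_neg]
  refine integral_congr_ae (.of_forall fun x => ?_)
  simp only [map_inv₀, map_sub, map_neg, Complex.conj_conj, Complex.conj_ofReal]
  rw [← inv_neg]
  congr 1
  push_cast
  ring

/-- Reflection turns `G(z)` into `-conj (G (-conj z))`. As `ν` is symmetric, the reflected measure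
solves the same equation, and uniqueness identifies it with `ρ`. -/
theorem isSymmetric_of_cauchyTransform_eq_self_sub {ν ρ : Measure ℝ} [IsProbabilityMeasure ν]
    [IsProbabilityMeasure ρ] (hν : IsSymmetric ν)
    (h : ∀ z : ℂ, 1 < z.im → cauchyTransform ρ z = cauchyTransform ν (z - cauchyTransform ρ z)) :
    IsSymmetric ρ := by
  have : IsProbabilityMeasure (ρ.map fun x => -x) := Measure.isProbabilityMeasure_map (by fun_prop)
  have hO : {z : ℂ | 1 < z.im} ∈ 𝓝[≠] (2 * Complex.I) := nhdsWithin_le_nhds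
    ((isOpen_lt continuous_const Complex.continuous_im).mem_nhds (by simp))
  refine eq_of_frequently_cauchyTransform_eq_self_sub (ν := ν) (ρ' := ρ.map fun x => -x) h
    (z₀ := 2 * Complex.I) (by simp) ?_
  refine (Filter.Eventually.frequently (f := 𝓝[≠] (2 * Complex.I)) ?_)
  filter_upwards [hO] with z hz
  have hz : 1 < z.im := hz
  rw [cauchyTransform_map_neg]
  have hneg := cauchyTransform_map_neg ν
    (z - -starRingEnd ℂ (cauchyTransform ρ (-starRingEnd ℂ z)))
  rw [show ν.map (fun x => -x) = ν from hν] at hneg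
  rw [hneg]
  conv_lhs => rw [h _ (by simpa using hz)]
  simp [sub_eq_add_neg, add_comm]

/-! ### The Cauchy transform of the semicircle law -/

lemma integral_sin_mul_sin_succ (n : ℕ) :
    ∫ θ in (0 : ℝ)..Real.pi, Real.sin θ * Real.sin ((n + 1) * θ) =
      if n = 0 then Real.pi / 2 else 0 := by
  have hcos : ∀ c : ℝ, c ≠ 0 → Real.sin (c * Real.pi) = 0 →
      ∫ θ in (0 : ℝ)..Real.pi, Real.cos (c * θ) = 0 := fun c hc h => by
    rw [intervalIntegral.integral_comp_mul_left _ hc]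
    simp [h]
  have h1 : ∀ θ : ℝ, Real.sin θ * Real.sin ((n + 1) * θ) =
      (Real.cos (n * θ) - Real.cos ((n + 2) * θ)) / 2 := fun θ => by
    rw [show (n : ℝ) * θ = (n + 1) * θ - θ by ring, show ((n : ℝ) + 2) * θ = (n + 1) * θ + θ by ring,
      Real.cos_sub, Real.cos_add]
    ring
  have h2 := hcos (n + 2) (by positivity) (by exact_mod_cast Real.sin_nat_mul_pi (n + 2))
  simp only [h1]
  rw [intervalIntegral.integral_div, intervalIntegral.integral_sub
    (Continuous.intervalIntegrable (by fun_prop) _ _)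
    (Continuous.intervalIntegrable (by fun_prop) _ _), h2]
  split_ifs with hn
  · simp [hn]
  · rw [hcos n (by exact_mod_cast hn) (Real.sin_nat_mul_pi n)]
    simp

/-- The generating function of the Chebyshev polynomials of the second kind, times `sin θ`. As `r`
is complex, the two geometric series in `e^{iθ}` and `e^{-iθ}` are subtracted instead of taking an
imaginary part. -/
lemma hasSum_pow_mul_sin_succ {r : ℂ} (hr : ‖r‖ < 1) (θ : ℝ) :
    HasSum (fun n : ℕ => r ^ n * (Real.sin ((n + 1) * θ) : ℂ))
      ((Real.sin θ : ℂ) / (1 - 2 * r * Real.cos θ + r ^ 2)) := by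
  have hgeo : ∀ e : ℂ, ‖e‖ = 1 → HasSum (fun n : ℕ => r ^ n * e ^ (n + 1)) (e / (1 - r * e)) ∧
      1 - r * e ≠ 0 := fun e he => by
    have h1 : ‖r * e‖ < 1 := by rwa [norm_mul, he, mul_one]
    refine ⟨?_, fun h => ?_⟩
    · have hf : (fun n : ℕ => r ^ n * e ^ (n + 1)) = fun n => e * (r * e) ^ n :=
        funext fun n => by ring
      rw [hf, div_eq_mul_inv]
      exact (hasSum_geometric_of_norm_lt_one h1).mul_left e
    · rw [← sub_eq_zero.1 h] at h1
      simp at h1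
  set e := Complex.exp (θ * Complex.I) with he
  set e' := Complex.exp (-θ * Complex.I) with he'
  have hee : e * e' = 1 := by rw [he, he', ← Complex.exp_add]; simp
  obtain ⟨h1, h1'⟩ := hgeo e (Complex.norm_exp_ofReal_mul_I θ)
  obtain ⟨h2, h2'⟩ := hgeo e' (by
    rw [he']; exact_mod_cast Complex.norm_exp_ofReal_mul_I (-θ))
  have hsin : (Real.sin θ : ℂ) = (e' - e) * Complex.I / 2 := by
    rw [Complex.ofReal_sin, Complex.sin]
  have hcos : (Real.cos θ : ℂ) = (e + e') / 2 := by
    rw [Complex.ofReal_cos, Complex.cos]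
  have hden : 1 - 2 * r * Real.cos θ + r ^ 2 = (1 - r * e) * (1 - r * e') := by
    rw [hcos]
    linear_combination -r ^ 2 * hee
  have hval : (Real.sin θ : ℂ) / (1 - 2 * r * Real.cos θ + r ^ 2) =
      (e' / (1 - r * e') - e / (1 - r * e)) * (Complex.I / 2) := by
    rw [hden, hsin, div_sub_div _ _ h2' h1']
    field_simp
    ring
  have hsin' : ∀ n : ℕ, (Real.sin ((n + 1) * θ) : ℂ) = (e' ^ (n + 1) - e ^ (n + 1)) * Complex.I / 2 := fun n => by
    rw [he, he', ← Complex.exp_nat_mul, ← Complex.exp_nat_mul, Complex.ofReal_sin, Complex.sin]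
    push_cast
    ring_nf
  have hf : (fun n : ℕ => r ^ n * (Real.sin ((n + 1) * θ) : ℂ)) = fun n =>
      (r ^ n * e' ^ (n + 1) - r ^ n * e ^ (n + 1)) * (Complex.I / 2) := funext fun n => by
    rw [hsin']
    ring
  rw [hval, hf]
  exact (h2.sub h1).mul_right (Complex.I / 2)

/-- Expand in `sin ((n + 1) θ)`; orthogonality to `sin θ` leaves only `n = 0`. -/
lemma integral_sin_sq_div {r : ℂ} (hr : ‖r‖ < 1) :
    ∫ θ in (0 : ℝ)..Real.pi, (Real.sin θ : ℂ) ^ 2 / (1 - 2 * r * Real.cos θ + r ^ 2) =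
      (Real.pi / 2 : ℂ) := by
  have h1 := intervalIntegral.hasSum_integral_of_dominated_convergence (μ := volume)
    (a := 0) (b := Real.pi)
    (F := fun (n : ℕ) (θ : ℝ) => (Real.sin θ : ℂ) * (r ^ n * (Real.sin ((n + 1) * θ) : ℂ)))
    (f := fun θ => (Real.sin θ : ℂ) ^ 2 / (1 - 2 * r * Real.cos θ + r ^ 2))
    (fun n _ => ‖r‖ ^ n) (fun n => (by fun_prop : Continuous _).aestronglyMeasurable)
    (fun n => .of_forall fun θ _ => ?_)
    (.of_forall fun θ _ => summable_geometric_of_lt_one (norm_nonneg _) hr) (by simp)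
    (.of_forall fun θ _ => ?_)
  · have h2 : ∀ n : ℕ, ∫ θ in (0 : ℝ)..Real.pi,
        (Real.sin θ : ℂ) * (r ^ n * (Real.sin ((n + 1) * θ) : ℂ)) =
        if n = 0 then (Real.pi : ℂ) / 2 else 0 := fun n => by
      have h3 : ∀ θ : ℝ, (Real.sin θ : ℂ) * (r ^ n * (Real.sin ((n + 1) * θ) : ℂ)) =
          r ^ n * ((Real.sin θ * Real.sin ((n + 1) * θ) : ℝ) : ℂ) := fun θ => by
        push_cast
        ring
      simp only [h3]
      rw [intervalIntegral.integral_const_mul, intervalIntegral.integral_ofReal,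
        integral_sin_mul_sin_succ]
      split_ifs with hn
      · simp [hn]
      · simp
    simp only [h2] at h1
    exact h1.unique (hasSum_ite_eq 0 _)
  · rw [norm_mul, norm_mul, norm_pow, Complex.norm_real, Complex.norm_real]
    calc _ ≤ 1 * (‖r‖ ^ n * 1) := by
          gcongr
          · exact Real.abs_sin_le_one _
          · exact Real.abs_sin_le_one _
      _ = ‖r‖ ^ n := by ring
  · rw [pow_two, mul_div_assoc]
    exact (hasSum_pow_mul_sin_succ hr θ).mul_left _

/-- `Im (ζ + ζ⁻¹) = Im ζ · (1 - |ζ|⁻²)`, and the last factor is positive outside the unit disc. -/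
lemma im_pos_iff_im_add_inv_pos {ζ : ℂ} (h : 1 < ‖ζ‖) :
    0 < ζ.im ↔ 0 < (ζ + ζ⁻¹).im := by
  have h1 : 1 < Complex.normSq ζ := by
    rw [Complex.normSq_eq_norm_sq]
    nlinarith
  have h2 : (ζ + ζ⁻¹).im = ζ.im * (1 - (Complex.normSq ζ)⁻¹) := by
    rw [Complex.add_im, Complex.inv_im]
    ring
  rw [h2]
  have h3 : 0 < 1 - (Complex.normSq ζ)⁻¹ := sub_pos.2 (inv_lt_one_of_one_lt₀ h1)
  exact (mul_pos_iff_of_pos_right h3).symm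

/-- The substitution `x = 2 cos θ` gives `z - x = ζ (1 - 2 ζ⁻¹ cos θ + ζ⁻²)`, so the integral
reduces to `integral_sin_sq_div` with `r = ζ⁻¹`. -/
theorem cauchyTransform_semicircle {ζ : ℂ} (hζ : 1 < ‖ζ‖) (him : 0 < ζ.im) :
    cauchyTransform semicircle (ζ + ζ⁻¹) = ζ⁻¹ := by
  have hz : 0 < (ζ + ζ⁻¹).im := (im_pos_iff_im_add_inv_pos hζ).1 him
  have hζ0 : ζ ≠ 0 := by
    rintro rfl
    simp at him
  set z := ζ + ζ⁻¹ with hzdef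
  have hr : ‖ζ⁻¹‖ < 1 := by
    rw [norm_inv]
    exact inv_lt_one_of_one_lt₀ hζ
  let g : ℝ → ℂ := fun x => (√(4 - x ^ 2) / (2 * Real.pi)) • (z - (x : ℂ))⁻¹
  have hg : Continuous g :=
    (by fun_prop : Continuous fun x : ℝ => √(4 - x ^ 2) / (2 * Real.pi)).smul
      (continuous_inv_sub_ofReal hz)
  have h1 : cauchyTransform semicircle z = ∫ x in (-2 : ℝ)..2, g x := by
    rw [cauchyTransform, semicircle, integral_withDensity_eq_integral_toReal_smul (by fun_prop)
      (.of_forall fun _ => ENNReal.ofReal_lt_top), intervalIntegral.integral_of_le (by norm_num),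
      ← integral_Icc_eq_integral_Ioc]
    refine integral_congr_ae (.of_forall fun x => ?_)
    simp only [g]
    rw [ENNReal.toReal_ofReal (by positivity)]
  have h2 := intervalIntegral.integral_deriv_smul_comp (a := 0) (b := Real.pi)
    (f := fun θ => 2 * Real.cos θ) (f' := fun θ => 2 * -Real.sin θ) (g := g)
    (fun θ _ => (Real.hasDerivAt_cos θ).const_mul 2) (by fun_prop) hg
  simp only [Real.cos_zero, mul_one, Real.cos_pi, mul_neg] at h2
  rw [h1, intervalIntegral.integral_symm, ← h2, ← intervalIntegral.integral_neg]
  have h3 : ∀ θ ∈ Set.uIcc 0 Real.pi, -((-(2 * Real.sin θ)) • (g ∘ fun θ => 2 * Real.cos θ) θ) =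
      (2 * ζ⁻¹ / Real.pi) * ((Real.sin θ : ℂ) ^ 2 / (1 - 2 * ζ⁻¹ * Real.cos θ + ζ⁻¹ ^ 2)) := by
    intro θ hθ
    rw [Set.uIcc_of_le Real.pi_pos.le] at hθ
    have hs : √(4 - (2 * Real.cos θ) ^ 2) = 2 * Real.sin θ := by
      rw [show 4 - (2 * Real.cos θ) ^ 2 = (2 * Real.sin θ) ^ 2 by
        nlinarith [Real.sin_sq_add_cos_sq θ], Real.sqrt_sq]
      have := Real.sin_nonneg_of_mem_Icc hθ
      positivity
    have hne := sub_ofReal_ne_zero hz (2 * Real.cos θ)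
    have hden : 1 - 2 * ζ⁻¹ * Real.cos θ + ζ⁻¹ ^ 2 = ζ⁻¹ * (z - ((2 * Real.cos θ : ℝ) : ℂ)) := by
      rw [hzdef]
      push_cast
      field_simp
      ring
    have hpi : (Real.pi : ℂ) ≠ 0 := by exact_mod_cast Real.pi_ne_zero
    simp only [Function.comp_apply, g, hs, hden, Complex.real_smul]
    push_cast at hne ⊢
    field_simp
  rw [intervalIntegral.integral_congr h3, intervalIntegral.integral_const_mul,
    integral_sin_sq_div hr]
  have hpi : (Real.pi : ℂ) ≠ 0 := by exact_mod_cast Real.pi_ne_zero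
  field_simp

/-- The inverse of the Cauchy transform of the semicircle law is `G ↦ G⁻¹ + G`. -/
theorem eq_add_inv_of_cauchyTransform_semicircle {w z : ℂ} (hw : 0 < w.im)
    (h : cauchyTransform semicircle w = z⁻¹) : w = z + z⁻¹ := by
  -- A root of the discriminant of `ζ² - w ζ + 1`. The two solutions are mutually inverse and not on
  -- the unit circle, where `ζ + ζ⁻¹` is real, so one of them lies outside the disc.
  obtain ⟨s, hs⟩ := IsAlgClosed.exists_pow_nat_eq (w ^ 2 - 4) (n := 2) (by norm_num)
  have hex : ∃ ζ : ℂ, ζ ≠ 0 ∧ w = ζ + ζ⁻¹ := by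
    have hne : (w + s) / 2 ≠ 0 := fun h0 => by
      have : s = -w := by linear_combination 2 * h0
      rw [this] at hs
      have : (4 : ℂ) = 0 := by linear_combination hs
      norm_num at this
    have hq : ((w + s) / 2) ^ 2 - w * ((w + s) / 2) + 1 = 0 := by linear_combination hs / 4
    refine ⟨(w + s) / 2, hne, ?_⟩
    generalize (w + s) / 2 = ζ at hne hq
    field_simp
    linear_combination -hq
  have hex' : ∃ ζ : ℂ, 1 < ‖ζ‖ ∧ w = ζ + ζ⁻¹ := by
    obtain ⟨ζ, h0, hζ⟩ := hex
    rcases lt_trichotomy ‖ζ‖ 1 with h1 | h1 | h1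
    · refine ⟨ζ⁻¹, ?_, by rw [inv_inv, add_comm]; exact hζ⟩
      rw [norm_inv]
      exact (one_lt_inv₀ (norm_pos_iff.2 h0)).2 h1
    · exfalso
      rw [hζ, Complex.add_im, Complex.inv_im, Complex.normSq_eq_norm_sq, h1] at hw
      simp at hw
    · exact ⟨ζ, h1, hζ⟩
  obtain ⟨ζ, h1, hζ⟩ := hex'
  have him : 0 < ζ.im := (im_pos_iff_im_add_inv_pos h1).2 (hζ ▸ hw)
  rw [hζ, cauchyTransform_semicircle h1 him] at h
  rw [hζ, inv_injective h]

/-! ### The right inverse of `F` for second moment at most one -/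

section RightInverse

variable {μ : Measure ℝ} [IsProbabilityMeasure μ]

lemma norm_ofReal_mul_inv_sub_le {w : ℂ} (hw : 16 ≤ w.im) (x : ℝ) :
    ‖(x : ℂ) * (w - x)⁻¹‖ ≤ |x| / 16 := by
  rw [norm_mul, Complex.norm_real, Real.norm_eq_abs, div_eq_mul_inv]
  gcongr
  exact (norm_inv_sub_ofReal_le (by linarith) x).trans (inv_anti₀ (by norm_num) hw)

lemma mul_inv_sub_eq {w : ℂ} (hw : 16 ≤ w.im) (x : ℝ) : w * (w - x)⁻¹ = 1 + x * (w - x)⁻¹ := by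
  have := sub_ofReal_ne_zero (z := w) (by linarith) x
  field_simp
  ring

lemma integrable_abs_of_sq (h2 : Integrable (fun x : ℝ => x ^ 2) μ) :
    Integrable (fun x : ℝ => |x|) μ := by
  refine Integrable.mono' ((integrable_const 1).add h2) (by fun_prop) (.of_forall fun x => ?_)
  simp only [Real.norm_eq_abs, abs_abs, Pi.add_apply]
  nlinarith [sq_nonneg (|x| - 1), sq_abs x, abs_nonneg x]

lemma integral_abs_le_one (h2 : Integrable (fun x : ℝ => x ^ 2) μ) (h2' : ∫ x, x ^ 2 ∂μ ≤ 1) :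
    ∫ x, |x| ∂μ ≤ 1 := by
  have h : ∫ x, |x| ∂μ ≤ ∫ x, (1 / 2 + 1 / 2 * x ^ 2) ∂μ := by
    refine integral_mono (integrable_abs_of_sq h2) ((integrable_const _).add (h2.const_mul _))
      fun x => ?_
    simp only
    nlinarith [sq_nonneg (|x| - 1), sq_abs x]
  rw [integral_add (integrable_const _) (h2.const_mul _), integral_const_mul] at h
  simp at h
  linarith

/-- The difference is `∫ x / (w - x)`, at most `E|x| / 16`. -/
lemma norm_mul_cauchyTransform_sub_one_le (h2 : Integrable (fun x : ℝ => x ^ 2) μ)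
    (h2' : ∫ x, x ^ 2 ∂μ ≤ 1) {w : ℂ} (hw : 16 ≤ w.im) :
    ‖w * cauchyTransform μ w - 1‖ ≤ 1 / 16 := by
  have hw0 : 0 < w.im := by linarith
  have h1 : w * cauchyTransform μ w - 1 = ∫ x : ℝ, (x : ℂ) * (w - x)⁻¹ ∂μ := by
    have : (1 : ℂ) = ∫ _ : ℝ, (1 : ℂ) ∂μ := by simp
    rw [cauchyTransform, ← integral_const_mul, this,
      ← integral_sub ((integrable_inv_sub_ofReal μ hw0).const_mul w) (integrable_const _)]
    refine integral_congr_ae (.of_forall fun x => ?_)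
    simp [mul_inv_sub_eq hw]
  rw [h1]
  refine (norm_integral_le_of_norm_le ((integrable_abs_of_sq h2).div_const 16)
    (.of_forall (norm_ofReal_mul_inv_sub_le hw))).trans ?_
  rw [integral_div]
  linarith [integral_abs_le_one h2 h2']

/-- The quantity is `∫ x (1 + x / (w - x))`, at most `E|x| + E x² / 16 ≤ 1 + 1/16`. -/
lemma norm_mul_mul_cauchyTransform_sub_one_le (h2 : Integrable (fun x : ℝ => x ^ 2) μ)
    (h2' : ∫ x, x ^ 2 ∂μ ≤ 1) {w : ℂ} (hw : 16 ≤ w.im) :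
    ‖w * (w * cauchyTransform μ w - 1)‖ ≤ 17 / 16 := by
  have hw0 : 0 < w.im := by linarith
  have h1 : w * (w * cauchyTransform μ w - 1) = ∫ x : ℝ, (x : ℂ) * (w * (w - x)⁻¹) ∂μ := by
    have : (1 : ℂ) = ∫ _ : ℝ, (1 : ℂ) ∂μ := by simp
    rw [cauchyTransform, ← integral_const_mul, this,
      ← integral_sub ((integrable_inv_sub_ofReal μ hw0).const_mul w) (integrable_const _),
      ← integral_const_mul]
    refine integral_congr_ae (.of_forall fun x => ?_)
    simp only
    linear_combination w * mul_inv_sub_eq hw x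
  have hb : ∀ x : ℝ, ‖(x : ℂ) * (w * (w - x)⁻¹)‖ ≤ |x| + x ^ 2 / 16 := fun x => by
    rw [norm_mul, mul_inv_sub_eq hw, Complex.norm_real, Real.norm_eq_abs]
    have h3 := (norm_add_le (1 : ℂ) (x * (w - x)⁻¹)).trans
      (add_le_add le_rfl (norm_ofReal_mul_inv_sub_le hw x))
    rw [norm_one] at h3
    calc _ ≤ |x| * (1 + |x| / 16) := by gcongr
      _ = _ := by rw [← sq_abs x]; ring
  have hi := integrable_abs_of_sq h2
  rw [h1]
  refine (norm_integral_le_of_norm_le (hi.add (h2.div_const 16)) (.of_forall hb)).trans ?_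
  rw [integral_add' hi (h2.div_const 16), integral_div]
  linarith [integral_abs_le_one h2 h2']

/-- Multiply out `(1 + x/(w - x)) (1 + x/(w' - x))`; the bound is `1/8 + 1/256`. -/
lemma norm_mul_mul_integral_sub_one_le (h2 : Integrable (fun x : ℝ => x ^ 2) μ)
    (h2' : ∫ x, x ^ 2 ∂μ ≤ 1) {w w' : ℂ} (hw : 16 ≤ w.im) (hw' : 16 ≤ w'.im) :
    ‖w * w' * ∫ x : ℝ, (w - (x : ℂ))⁻¹ * (w' - (x : ℂ))⁻¹ ∂μ - 1‖ ≤ 33 / 256 := by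
  have hint : Integrable (fun x : ℝ => (w - (x : ℂ))⁻¹ * (w' - (x : ℂ))⁻¹) μ :=
    (integrable_inv_sub_ofReal μ (by linarith)).bdd_mul
      (continuous_inv_sub_ofReal (by linarith)).aestronglyMeasurable
      (.of_forall (norm_inv_sub_ofReal_le (by linarith)))
  have h1 : w * w' * ∫ x : ℝ, (w - (x : ℂ))⁻¹ * (w' - (x : ℂ))⁻¹ ∂μ - 1 =
      ∫ x : ℝ, (w * w' * ((w - (x : ℂ))⁻¹ * (w' - (x : ℂ))⁻¹) - 1) ∂μ := by
    rw [integral_sub (hint.const_mul _) (integrable_const _), integral_const_mul]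
    simp
  have hb : ∀ x : ℝ, ‖w * w' * ((w - (x : ℂ))⁻¹ * (w' - (x : ℂ))⁻¹) - 1‖ ≤
      |x| / 8 + x ^ 2 / 256 := fun x => by
    have h3 : w * w' * ((w - (x : ℂ))⁻¹ * (w' - (x : ℂ))⁻¹) - 1 =
        x * (w - x)⁻¹ + x * (w' - x)⁻¹ + (x * (w - x)⁻¹) * (x * (w' - x)⁻¹) := by
      rw [show w * w' * ((w - (x : ℂ))⁻¹ * (w' - (x : ℂ))⁻¹) =
        (w * (w - (x : ℂ))⁻¹) * (w' * (w' - (x : ℂ))⁻¹) by ring, mul_inv_sub_eq hw,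
        mul_inv_sub_eq hw']
      ring
    have hx := norm_ofReal_mul_inv_sub_le hw x
    have hx' := norm_ofReal_mul_inv_sub_le hw' x
    rw [h3]
    refine (norm_add_le _ _).trans ((add_le_add (norm_add_le _ _) le_rfl).trans ?_)
    rw [norm_mul (_ * _)]
    have := mul_le_mul hx hx' (norm_nonneg _) (by positivity)
    nlinarith [sq_abs x]
  have hi := integrable_abs_of_sq h2
  rw [h1]
  refine (norm_integral_le_of_norm_le ((hi.div_const 8).add (h2.div_const 256))
    (.of_forall hb)).trans ?_
  rw [integral_add' (hi.div_const 8) (h2.div_const 256), integral_div, integral_div]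
  linarith [integral_abs_le_one h2 h2']

lemma le_norm_mul_cauchyTransform (h2 : Integrable (fun x : ℝ => x ^ 2) μ)
    (h2' : ∫ x, x ^ 2 ∂μ ≤ 1) {w : ℂ} (hw : 16 ≤ w.im) :
    15 / 16 ≤ ‖w * cauchyTransform μ w‖ := by
  have h1 := norm_mul_cauchyTransform_sub_one_le h2 h2' hw
  have h3 := norm_sub_norm_le (1 : ℂ) (w * cauchyTransform μ w)
  rw [norm_sub_rev, norm_one] at h3
  linarith

lemma cauchyTransform_ne_zero_of_sq (h2 : Integrable (fun x : ℝ => x ^ 2) μ)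
    (h2' : ∫ x, x ^ 2 ∂μ ≤ 1) {w : ℂ} (hw : 16 ≤ w.im) : cauchyTransform μ w ≠ 0 := fun h => by
  have := le_norm_mul_cauchyTransform h2 h2' hw
  rw [h, mul_zero, norm_zero] at this
  norm_num at this

lemma norm_reciprocalCauchyTransform_sub_self_le (h2 : Integrable (fun x : ℝ => x ^ 2) μ)
    (h2' : ∫ x, x ^ 2 ∂μ ≤ 1) {w : ℂ} (hw : 16 ≤ w.im) :
    ‖reciprocalCauchyTransform μ w - w‖ ≤ 2 := by
  have hG := cauchyTransform_ne_zero_of_sq h2 h2' hw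
  have hw0 : w ≠ 0 := by
    rintro rfl
    norm_num at hw
  have h1 : reciprocalCauchyTransform μ w - w =
      -(w * (w * cauchyTransform μ w - 1)) / (w * cauchyTransform μ w) := by
    rw [reciprocalCauchyTransform]
    field_simp
    ring
  rw [h1, norm_div, norm_neg, div_le_iff₀ (norm_pos_iff.2 (mul_ne_zero hw0 hG))]
  linarith [norm_mul_mul_cauchyTransform_sub_one_le h2 h2' hw,
    le_norm_mul_cauchyTransform h2 h2' hw]

/-- By the resolvent identity the left side is `(w - w') (w w' J - w G · w' G') / (w G · w' G')`,
where `J` is the integral of the product of resolvents. All three products are near `1`: the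
numerator is at most `66/256`, the denominator at least `225/256`. -/
lemma norm_reciprocalCauchyTransform_sub_sub_le (h2 : Integrable (fun x : ℝ => x ^ 2) μ)
    (h2' : ∫ x, x ^ 2 ∂μ ≤ 1) {w w' : ℂ} (hw : 16 ≤ w.im) (hw' : 16 ≤ w'.im) :
    ‖(reciprocalCauchyTransform μ w - w) - (reciprocalCauchyTransform μ w' - w')‖ ≤
      1 / 2 * ‖w - w'‖ := by
  have hG := cauchyTransform_ne_zero_of_sq h2 h2' hw
  have hG' := cauchyTransform_ne_zero_of_sq h2 h2' hw'
  have hw0 : w ≠ 0 := by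
    rintro rfl
    norm_num at hw
  have hw0' : w' ≠ 0 := by
    rintro rfl
    norm_num at hw'
  have hd := cauchyTransform_sub_eq μ (z := w) (w := w') (by linarith) (by linarith)
  have hI := norm_mul_mul_integral_sub_one_le h2 h2' hw hw'
  set J := ∫ x : ℝ, (w - (x : ℂ))⁻¹ * (w' - (x : ℂ))⁻¹ ∂μ
  set g := cauchyTransform μ w with hgdef
  set g' := cauchyTransform μ w' with hgdef'
  have e1 := norm_mul_cauchyTransform_sub_one_le h2 h2' hw
  have e2 := norm_mul_cauchyTransform_sub_one_le h2 h2' hw'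
  have l1 := le_norm_mul_cauchyTransform h2 h2' hw
  have l2 := le_norm_mul_cauchyTransform h2 h2' hw'
  rw [← hgdef] at e1 l1
  rw [← hgdef'] at e2 l2
  have h1 : (reciprocalCauchyTransform μ w - w) - (reciprocalCauchyTransform μ w' - w') =
      ((w * w' * J - 1) - (w * g - 1) - (w' * g' - 1) - (w * g - 1) * (w' * g' - 1)) /
        ((w * g) * (w' * g')) * (w - w') := by
    rw [reciprocalCauchyTransform, reciprocalCauchyTransform, ← hgdef, ← hgdef']
    field_simp
    linear_combination -(w * w') * hd
  rw [h1, norm_mul]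
  refine mul_le_mul_of_nonneg_right ?_ (norm_nonneg _)
  have hpos : 0 < ‖(w * g) * (w' * g')‖ := norm_pos_iff.2
    (mul_ne_zero (mul_ne_zero hw0 hG) (mul_ne_zero hw0' hG'))
  rw [norm_div, div_le_iff₀ hpos, norm_mul (w * g)]
  have h3 : ‖(w * w' * J - 1) - (w * g - 1) - (w' * g' - 1) - (w * g - 1) * (w' * g' - 1)‖ ≤
      33 / 256 + 1 / 16 + 1 / 16 + 1 / 16 * (1 / 16) := by
    refine (norm_sub_le _ _).trans (add_le_add ((norm_sub_le _ _).trans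
      (add_le_add ((norm_sub_le _ _).trans (add_le_add hI e1)) e2)) ?_)
    rw [norm_mul]
    exact mul_le_mul e1 e2 (norm_nonneg _) (by norm_num)
  have h4 := mul_le_mul l1 l2 (by norm_num) (norm_nonneg _)
  linarith

/-- Banach's fixed point theorem for `w ↦ z - (F w - w)`. Since `|F w - w| ≤ 2`, the map preserves
`{Im ≥ 16}` once `Im z > 18`. -/
lemma exists_reciprocalCauchyTransform_eq (h2 : Integrable (fun x : ℝ => x ^ 2) μ)
    (h2' : ∫ x, x ^ 2 ∂μ ≤ 1) {z : ℂ} (hz : 18 < z.im) :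
    ∃ w : ℂ, 16 ≤ w.im ∧ reciprocalCauchyTransform μ w = z := by
  let s : Set ℂ := {w | 16 ≤ w.im}
  let f : ℂ → ℂ := fun w => z - (reciprocalCauchyTransform μ w - w)
  have hs : IsComplete s := (isClosed_le continuous_const Complex.continuous_im).isComplete
  have hmaps : Set.MapsTo f s s := fun w hw => by
    have h1 := (Complex.abs_im_le_norm _).trans
      (norm_reciprocalCauchyTransform_sub_self_le h2 h2' hw)
    have h3 := (abs_le.1 h1).2
    change 16 ≤ (z - (reciprocalCauchyTransform μ w - w)).im
    rw [Complex.sub_im]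
    linarith
  have hcontr : ContractingWith (1 / 2) (hmaps.restrict f s s) := by
    refine ⟨by rw [← NNReal.coe_lt_coe]; norm_num, LipschitzWith.of_dist_le_mul fun w w' => ?_⟩
    rw [Subtype.dist_eq, Subtype.dist_eq, dist_eq_norm, dist_eq_norm]
    simp only [Set.MapsTo.val_restrict_apply, f, sub_sub_sub_cancel_left]
    rw [norm_sub_rev]
    exact_mod_cast norm_reciprocalCauchyTransform_sub_sub_le h2 h2' w.2 w'.2
  obtain ⟨w, hw, hfix, -⟩ := hcontr.exists_fixedPoint' hs hmaps (x := z)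
    (show 16 ≤ z.im by linarith) (edist_ne_top _ _)
  refine ⟨w, hw, ?_⟩
  have h1 : z - (reciprocalCauchyTransform μ w - w) = w := hfix
  linear_combination -h1

/-- The Voiculescu transform of a probability measure with second moment at most one. -/
theorem exists_isVoiculescuTransform (h2 : Integrable (fun x : ℝ => x ^ 2) μ)
    (h2' : ∫ x, x ^ 2 ∂μ ≤ 1) :
    ∃ φ : ℂ → ℂ, IsVoiculescuTransform μ 1 18 φ ∧ ∀ z : ℂ, 18 < z.im → 16 ≤ (z + φ z).im := by
  have hex : ∀ z : ℂ, ∃ w : ℂ, 18 < z.im → 16 ≤ w.im ∧ reciprocalCauchyTransform μ w = z :=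
    fun z => by
      by_cases hz : 18 < z.im
      · obtain ⟨w, hw⟩ := exists_reciprocalCauchyTransform_eq h2 h2' hz
        exact ⟨w, fun _ => hw⟩
      · exact ⟨0, fun h => absurd h hz⟩
  choose W hW using hex
  have hO : IsOpen {z : ℂ | 18 < z.im} := isOpen_lt continuous_const Complex.continuous_im
  have hlip : ∀ z z' : ℂ, 18 < z.im → 18 < z'.im → ‖W z - W z'‖ ≤ 2 * ‖z - z'‖ := by
    intro z z' hz hz'
    have h1 := norm_reciprocalCauchyTransform_sub_sub_le h2 h2' (hW z hz).1 (hW z' hz').1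
    rw [(hW z hz).2, (hW z' hz').2] at h1
    have h3 : W z - W z' = (z - z') - ((z - W z) - (z' - W z')) := by ring
    have h4 := norm_sub_le (z - z') ((z - W z) - (z' - W z'))
    rw [← h3] at h4
    linarith
  have hdiff : ∀ z : ℂ, 18 < z.im → DifferentiableAt ℂ W z := by
    intro z hz
    have hw : 16 ≤ (W z).im := (hW z hz).1
    have hnorm : ‖W z - z‖ ≤ 2 := by
      have := norm_reciprocalCauchyTransform_sub_self_le h2 h2' hw
      rwa [(hW z hz).2, norm_sub_rev] at this
    have hnear : ∀ᶠ z' in 𝓝 z, 18 < z'.im := hO.mem_nhds hz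
    have hcont : ContinuousAt W z := by
      rw [ContinuousAt, tendsto_iff_norm_sub_tendsto_zero]
      refine squeeze_zero' (.of_forall fun _ => norm_nonneg _)
        (hnear.mono fun z' hz' => hlip z' z hz' hz) ?_
      have : Tendsto (fun z' : ℂ => 2 * ‖z' - z‖) (𝓝 z) (𝓝 (2 * ‖z - z‖)) :=
        (by fun_prop : Continuous fun z' : ℂ => 2 * ‖z' - z‖).tendsto z
      simpa using this
    have hG : DifferentiableAt ℂ (cauchyTransform μ) (W z) :=
      (differentiableOn_cauchyTransform μ).differentiableAt
        ((isOpen_lt continuous_const Complex.continuous_im).mem_nhds (by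
          show 0 < (W z).im
          linarith))
    have hF : DifferentiableAt ℂ (reciprocalCauchyTransform μ) (W z) :=
      hG.inv (cauchyTransform_ne_zero_of_sq h2 h2' hw)
    have him : 16 < (W z).im := by
      have h1 := (abs_le.1 ((Complex.abs_im_le_norm _).trans hnorm)).1
      rw [Complex.sub_im] at h1
      linarith
    -- If `F' = 0`, then `F - id` has derivative `-1`, against its Lipschitz constant `1/2`.
    have hF' : deriv (reciprocalCauchyTransform μ) (W z) ≠ 0 := fun h0 => by
      have h1 := hF.hasDerivAt.sub (hasDerivAt_id (W z))
      have h3 : ∀ᶠ w in 𝓝 (W z), 16 < w.im :=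
        (isOpen_lt continuous_const Complex.continuous_im).mem_nhds him
      have h4 := h1.le_of_lip' (C := 1 / 2) (by norm_num) (h3.mono fun w hw' =>
        norm_reciprocalCauchyTransform_sub_sub_le h2 h2' hw'.le hw)
      rw [h0] at h4
      norm_num at h4
    exact (hF.hasDerivAt.of_local_left_inverse hcont hF'
      (hnear.mono fun z' hz' => (hW z' hz').2)).differentiableAt
  have hadd : ∀ z : ℂ, z + (W z - z) = W z := fun z => by ring
  refine ⟨fun z => W z - z, ⟨fun z hz => ?_, fun z hz => ?_, fun z hz => ?_, ?_⟩, fun z hz => ?_⟩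
  · exact ((hdiff z hz.1).sub differentiableAt_id).differentiableWithinAt
  · rw [hadd]
    linarith [(hW z hz.1).1]
  · rw [hadd]
    exact (hW z hz.1).2
  · have h1 : Tendsto (fun z : ℂ => 2 * ‖z‖⁻¹) (Bornology.cobounded ℂ ⊓ 𝓟 (cone 1 18)) (𝓝 0) := by
      have := (tendsto_inv_atTop_zero.comp (tendsto_norm_cobounded_atTop (E := ℂ))).const_mul 2
      rw [mul_zero] at this
      exact this.mono_left inf_le_left
    refine squeeze_zero_norm' ?_ h1
    filter_upwards [mem_inf_of_right (mem_principal_self (cone 1 18))] with z hz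
    have hz : 18 < z.im := hz.1
    have h3 := norm_reciprocalCauchyTransform_sub_self_le h2 h2' (hW z hz).1
    rw [(hW z hz).2, norm_sub_rev] at h3
    rw [norm_div, div_eq_mul_inv]
    gcongr
  · rw [hadd]
    exact (hW z hz).1

end RightInverse

/-! ### Free convolution with the semicircle law and the Pastur equation -/

lemma isOpen_cone (α β : ℝ) : IsOpen (cone α β) :=
  (isOpen_lt continuous_const Complex.continuous_im).inter
    (isOpen_lt (continuous_abs.comp Complex.continuous_re)
      (continuous_const.mul Complex.continuous_im))

lemma ofReal_mul_I_mem_cone {α β y : ℝ} (hα : 0 < α) (hy : 0 < y) (hβ : β < y) :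
    (y * Complex.I : ℂ) ∈ cone α β := by
  refine ⟨by simpa using hβ, ?_⟩
  simp only [Complex.re_ofReal_mul, Complex.I_re, mul_zero, abs_zero, Complex.im_ofReal_mul,
    Complex.I_im, mul_one]
  positivity

theorem isVoiculescuTransform_semicircle :
    IsVoiculescuTransform semicircle 1 18 fun z => z⁻¹ := by
  have hnorm : ∀ z ∈ cone 1 18, 1 < ‖z‖ := fun z hz => by
    have h1 := (le_abs_self _).trans (Complex.abs_im_le_norm z)
    have h2 := hz.1
    linarith
  have him : ∀ z ∈ cone 1 18, 0 < z.im := fun z hz => by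
    have h2 := hz.1
    linarith
  refine ⟨fun z hz => ?_, fun z hz => (im_pos_iff_im_add_inv_pos (hnorm z hz)).1 (him z hz),
    fun z hz => ?_, ?_⟩
  · refine (differentiableAt_inv ?_).differentiableWithinAt
    rintro rfl
    simpa using him 0 hz
  · rw [reciprocalCauchyTransform, cauchyTransform_semicircle (hnorm z hz) (him z hz), inv_inv]
  · have h1 : Tendsto (fun z : ℂ => ‖z‖⁻¹) (Bornology.cobounded ℂ ⊓ 𝓟 (cone 1 18)) (𝓝 0) :=
      (tendsto_inv_atTop_zero.comp (tendsto_norm_cobounded_atTop (E := ℂ))).mono_left inf_le_left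
    refine squeeze_zero_norm' ?_ h1
    filter_upwards [mem_inf_of_right (mem_principal_self (cone 1 18))] with z hz
    have h2 := hnorm z hz
    rw [norm_div, norm_inv, div_eq_mul_inv]
    exact mul_le_of_le_one_right (by positivity) (inv_le_one_of_one_le₀ h2.le)

/-- A solution of the Pastur equation is a free convolution with the semicircle law. -/
theorem isFreeConvolution_semicircle_of_cauchyTransform_eq {ν ρ : Measure ℝ}
    [IsProbabilityMeasure ν] [IsProbabilityMeasure ρ] (h2 : Integrable (fun x : ℝ => x ^ 2) ν)
    (h2' : ∫ x, x ^ 2 ∂ν ≤ 1)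
    (h : ∀ z : ℂ, 1 < z.im → cauchyTransform ρ z = cauchyTransform ν (z - cauchyTransform ρ z)) :
    IsFreeConvolution semicircle ν ρ := by
  obtain ⟨φ, hφ, him⟩ := exists_isVoiculescuTransform h2 h2'
  have hsc := isVoiculescuTransform_semicircle
  have key : ∀ z ∈ cone 1 18, 1 < (z + (z⁻¹ + φ z)).im ∧
      reciprocalCauchyTransform ρ (z + (z⁻¹ + φ z)) = z := fun z hz => by
    have hz18 : 18 < z.im := hz.1
    have hz0 : z ≠ 0 := by
      rintro rfl
      norm_num at hz18
    have h1 := him z hz18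
    have hinv : -1 ≤ (z⁻¹).im := by
      have h3 : ‖z⁻¹‖ ≤ 1 := by
        rw [norm_inv]
        refine inv_le_one_of_one_le₀ ?_
        linarith [(le_abs_self _).trans (Complex.abs_im_le_norm z)]
      exact (abs_le.1 ((Complex.abs_im_le_norm _).trans h3)).1
    have hv : 1 < (z + (z⁻¹ + φ z)).im := by
      simp only [Complex.add_im] at h1 ⊢
      linarith
    refine ⟨hv, ?_⟩
    have hG : z⁻¹ = cauchyTransform ν (z + (z⁻¹ + φ z) - z⁻¹) := by
      rw [show z + (z⁻¹ + φ z) - z⁻¹ = z + φ z by ring]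
      have := hφ.right_inverse z hz
      rw [reciprocalCauchyTransform] at this
      rw [← inv_inv (cauchyTransform ν _), this]
    have hw := im_le_im_sub_cauchyTransform ρ (z := z + (z⁻¹ + φ z)) (by linarith)
    -- With `v = z + z⁻¹ + φ z`, both `G_ρ(v)` and `z⁻¹` solve `u = G_ν (v - u)`.
    have heq := eq_of_eq_cauchyTransform_sub ν (h _ hv) hG (by linarith) (by
      rw [show z + (z⁻¹ + φ z) - z⁻¹ = z + φ z by ring]
      linarith)
    rw [reciprocalCauchyTransform, heq, inv_inv]
  refine ⟨1, 18, by norm_num, by norm_num, fun z => z⁻¹, φ, hsc, hφ,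
    hsc.differentiableOn.add hφ.differentiableOn, fun z hz => by linarith [(key z hz).1],
    fun z hz => (key z hz).2, ?_⟩
  simpa [add_div] using hsc.tendsto.add hφ.tendsto

/-- A free convolution with the semicircle law solves the Pastur equation. -/
theorem eq_of_isFreeConvolution_semicircle {ν ρ ρ' : Measure ℝ} [IsProbabilityMeasure ν]
    [IsProbabilityMeasure ρ] [IsProbabilityMeasure ρ']
    (h : ∀ z : ℂ, 1 < z.im → cauchyTransform ρ z = cauchyTransform ν (z - cauchyTransform ρ z))
    (h' : IsFreeConvolution semicircle ν ρ') : ρ' = ρ := by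
  obtain ⟨α, β, hα, hβ, φ, ψ, hφ, hψ, hs⟩ := h'
  set v : ℂ → ℂ := fun z => z + (φ z + ψ z) with hv
  have hG : ∀ (μ : Measure ℝ) (χ : ℂ → ℂ), IsVoiculescuTransform μ α β χ → ∀ z ∈ cone α β,
      cauchyTransform μ (z + χ z) = z⁻¹ := fun μ χ hχ z hz => by
    have := hχ.right_inverse z hz
    rw [reciprocalCauchyTransform] at this
    rw [← inv_inv (cauchyTransform μ _), this]
  have hfix : ∀ z ∈ cone α β, cauchyTransform ρ' (v z) =
      cauchyTransform ν (v z - cauchyTransform ρ' (v z)) := fun z hz => by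
    -- This forces `φ z = z⁻¹` on the given cone, so `φ` needs no further information.
    have h1 := eq_add_inv_of_cauchyTransform_semicircle (hφ.im_pos z hz) (hG _ _ hφ z hz)
    have h2 : v z - z⁻¹ = z + ψ z := by
      simp only [hv]
      linear_combination h1
    rw [hG ρ' _ hs z hz, h2, hG ν _ hψ z hz]
  have hray : Tendsto (fun y : ℝ => (y * Complex.I : ℂ)) atTop
      (Bornology.cobounded ℂ ⊓ 𝓟 (cone α β)) := by
    refine tendsto_inf.2 ⟨?_, tendsto_principal.2 ?_⟩
    · rw [← tendsto_norm_atTop_iff_cobounded]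
      simpa using tendsto_abs_atTop_atTop
    · filter_upwards [eventually_gt_atTop 0, eventually_gt_atTop β] with y hy hyβ
      exact ofReal_mul_I_mem_cone hα hy hyβ
  -- High on the imaginary axis the perturbation is below half of `y > 2`, so `Im v > 1` there.
  have hsmall := (hs.tendsto.comp hray).norm.eventually (gt_mem_nhds (by norm_num : ‖(0 : ℂ)‖ < 1 / 2))
  obtain ⟨y, hy1, hy2, hyβ⟩ := (hsmall.and ((eventually_gt_atTop 2).and
    (eventually_gt_atTop β))).exists
  set z₀ : ℂ := y * Complex.I with hz₀
  have hz₀mem : z₀ ∈ cone α β := ofReal_mul_I_mem_cone hα (by linarith) hyβ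
  have hv₀ : 1 < (v z₀).im := by
    have hnorm : ‖z₀‖ = y := by simp [hz₀, abs_of_pos (by linarith : 0 < y)]
    simp only [Function.comp_apply] at hy1
    rw [norm_div, hnorm, div_lt_iff₀ (by linarith)] at hy1
    have h1 := (abs_le.1 ((Complex.abs_im_le_norm (φ z₀ + ψ z₀)).trans hy1.le)).1
    have h2 : z₀.im = y := by simp [hz₀]
    simp only [hv, Complex.add_im] at h1 ⊢
    linarith
  have hnear : ∀ᶠ z in 𝓝[≠] z₀, z ∈ cone α β :=
    nhdsWithin_le_nhds ((isOpen_cone α β).mem_nhds hz₀mem)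
  have hcont : ContinuousAt v z₀ := continuousAt_id.add
    (hs.differentiableOn.differentiableAt ((isOpen_cone α β).mem_nhds hz₀mem)).continuousAt
  -- `F_ρ'` is a left inverse of `v`, so `v` is injective on the cone and carries punctured
  -- neighbourhoods to points accumulating at `v z₀`.
  have htend : Tendsto v (𝓝[≠] z₀) (𝓝[≠] (v z₀)) := by
    refine tendsto_nhdsWithin_iff.2 ⟨hcont.tendsto.mono_left nhdsWithin_le_nhds, ?_⟩
    filter_upwards [hnear, self_mem_nhdsWithin] with z hz hne heq
    refine hne ?_
    have h1 := hs.right_inverse z hz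
    have h2 := hs.right_inverse z₀ hz₀mem
    have heq' : z + (φ z + ψ z) = z₀ + (φ z₀ + ψ z₀) := heq
    rw [heq'] at h1
    exact h1.symm.trans h2
  refine eq_of_frequently_cauchyTransform_eq_self_sub h hv₀ (htend.frequently ?_)
  exact (hnear.mono hfix).frequently

/-! ### Asymptotic expansions along the imaginary axis -/

/-- `f` has the asymptotic expansion `a` in powers of `1 / (i y)` up to `O (y ^ (-N))`. -/
def HasExpansion (f : ℝ → ℂ) (a : PowerSeries ℂ) (N : ℕ) : Prop :=
  (fun y : ℝ => f y - (PowerSeries.trunc N a).eval (y * Complex.I)⁻¹) =O[atTop]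
    fun y : ℝ => y⁻¹ ^ N

lemma isBigO_inv_mul_I : (fun y : ℝ => ((y : ℂ) * Complex.I)⁻¹) =O[atTop] fun y : ℝ => y⁻¹ :=
  .of_bound 1 (.of_forall fun y => by simp)

lemma isBigO_inv_one : (fun y : ℝ => y⁻¹) =O[atTop] fun _ => (1 : ℝ) :=
  tendsto_inv_atTop_zero.isBigO_one ℝ

lemma isBigO_eval_one (p : Polynomial ℂ) :
    (fun y : ℝ => p.eval ((y : ℂ) * Complex.I)⁻¹) =O[atTop] fun _ => (1 : ℝ) := by
  have h1 : Tendsto (fun y : ℝ => ((y : ℂ) * Complex.I)⁻¹) atTop (𝓝 0) :=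
    isBigO_inv_mul_I.trans_tendsto tendsto_inv_atTop_zero
  exact ((p.continuous.tendsto 0).comp h1).isBigO_one ℝ

lemma isBigO_eval_of_coeff_eq_zero {p : Polynomial ℂ} {N : ℕ} (hp : ∀ d < N, p.coeff d = 0) :
    (fun y : ℝ => p.eval ((y : ℂ) * Complex.I)⁻¹) =O[atTop] fun y : ℝ => y⁻¹ ^ N := by
  obtain ⟨q, rfl⟩ := Polynomial.X_pow_dvd_iff.2 hp
  simpa using (isBigO_inv_mul_I.pow N).mul (isBigO_eval_one q)

namespace HasExpansion

variable {f g : ℝ → ℂ} {a b : PowerSeries ℂ} {N : ℕ}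

lemma isBigO_one (hf : HasExpansion f a N) : f =O[atTop] fun _ => (1 : ℝ) := by
  have h1 : (fun y : ℝ => y⁻¹ ^ N) =O[atTop] fun _ => (1 : ℝ) := by
    simpa using isBigO_inv_one.pow N
  simpa using (hf.trans h1).add (isBigO_eval_one (PowerSeries.trunc N a))

lemma const (c : ℂ) (N : ℕ) : HasExpansion (fun _ => c) (PowerSeries.C c) N := by
  rcases N with _ | N
  · simpa [HasExpansion] using Asymptotics.isBigO_const_const c (one_ne_zero (α := ℝ)) atTop
  · simpa [HasExpansion] using Asymptotics.isBigO_zero _ _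

lemma add (hf : HasExpansion f a N) (hg : HasExpansion g b N) :
    HasExpansion (fun y => f y + g y) (a + b) N := by
  refine (Asymptotics.IsBigO.add hf hg).congr_left fun y => ?_
  rw [map_add, Polynomial.eval_add]
  ring

lemma mul (hf : HasExpansion f a N) (hg : HasExpansion g b N) :
    HasExpansion (fun y => f y * g y) (a * b) N := by
  have h1 : (fun y => f y * (g y - (PowerSeries.trunc N b).eval (y * Complex.I)⁻¹)) =O[atTop]
      fun y : ℝ => y⁻¹ ^ N := by simpa using hf.isBigO_one.mul hg
  have h2 : (fun y => (f y - (PowerSeries.trunc N a).eval (y * Complex.I)⁻¹) *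
      (PowerSeries.trunc N b).eval (y * Complex.I)⁻¹) =O[atTop]
      fun y : ℝ => y⁻¹ ^ N := by
    simpa using Asymptotics.IsBigO.mul hf (isBigO_eval_one (PowerSeries.trunc N b))
  have h3 := isBigO_eval_of_coeff_eq_zero (N := N)
    (p := PowerSeries.trunc N a * PowerSeries.trunc N b - PowerSeries.trunc N (a * b))
    fun d hd => by
      rw [Polynomial.coeff_sub, PowerSeries.coeff_trunc, if_pos hd, sub_eq_zero,
        PowerSeries.coeff_mul, Polynomial.coeff_mul]
      refine Finset.sum_congr rfl fun p hp => ?_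
      have hp' := Finset.HasAntidiagonal.mem_antidiagonal.1 hp
      rw [PowerSeries.coeff_trunc, PowerSeries.coeff_trunc, if_pos (by omega), if_pos (by omega)]
  refine ((h1.add h2).add h3).congr_left fun y => ?_
  rw [Polynomial.eval_sub, Polynomial.eval_mul]
  ring

/-- The factor `1/(iy)` gains an order; this is what lets a fixed point equation bootstrap an
expansion. -/
lemma inv_mul (hf : HasExpansion f a N) :
    HasExpansion (fun y => (y * Complex.I)⁻¹ * f y) (PowerSeries.X * a) (N + 1) := by
  have h1 : PowerSeries.trunc (N + 1) (PowerSeries.X * a) =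
      Polynomial.X * PowerSeries.trunc N a := by
    ext d
    rcases d with _ | d
    · simp [PowerSeries.coeff_trunc]
    · simp [PowerSeries.coeff_trunc, PowerSeries.coeff_succ_X_mul]
  refine ((isBigO_inv_mul_I.mul hf).congr_left fun y => ?_).congr_right fun y => ?_
  · rw [h1, Polynomial.eval_mul, Polynomial.eval_X]
    ring
  · rw [pow_succ']

lemma congr' (hf : HasExpansion f a N) (h : f =ᶠ[atTop] g) : HasExpansion g a N :=
  Asymptotics.IsBigO.congr' hf (h.mono fun y hy => by simp only [hy]) (.refl _ _)

end HasExpansion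

/-! ### Existence of moments from an asymptotic expansion of the Cauchy transform -/

lemma integrable_pow_mul_inv_sub {μ : Measure ℝ} {n : ℕ} (hn : Integrable (fun x : ℝ => x ^ n) μ)
    {z : ℂ} (hz : 0 < z.im) :
    Integrable (fun x : ℝ => (x : ℂ) ^ n * (z - (x : ℂ))⁻¹) μ := by
  have h1 : Integrable (fun x : ℝ => (x : ℂ) ^ n) μ := by simpa using hn.ofReal (𝕜 := ℂ)
  exact h1.mul_bdd (continuous_inv_sub_ofReal hz).aestronglyMeasurable
    (.of_forall (norm_inv_sub_ofReal_le hz))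

lemma integrable_pow_of_le {μ : Measure ℝ} [IsFiniteMeasure μ] {m n : ℕ} (hmn : m ≤ n)
    (hn : Integrable (fun x : ℝ => x ^ n) μ) : Integrable (fun x : ℝ => x ^ m) μ := by
  refine Integrable.mono' ((integrable_const 1).add hn.norm) (by fun_prop) (.of_forall fun x => ?_)
  simp only [norm_pow, Pi.add_apply]
  rcases le_total ‖x‖ 1 with h | h
  · have := pow_le_one₀ (n := m) (norm_nonneg x) h
    have h0 : 0 ≤ ‖x‖ ^ n := by positivity
    linarith
  · have := pow_le_pow_right₀ h hmn
    linarith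

/-- Iteration of `1/(z - x) = z⁻¹ (1 + x/(z - x))`, with exact remainder. -/
lemma cauchyTransform_eq_sum_add {μ : Measure ℝ} [IsProbabilityMeasure μ] {n : ℕ}
    (hn : Integrable (fun x : ℝ => x ^ n) μ) {z : ℂ} (hz : 0 < z.im) :
    cauchyTransform μ z = ∑ j ∈ Finset.range n, ((∫ x, x ^ j ∂μ : ℝ) : ℂ) * z⁻¹ ^ (j + 1) +
      z⁻¹ ^ n * ∫ x : ℝ, (x : ℂ) ^ n * (z - (x : ℂ))⁻¹ ∂μ := by
  have hz0 : z ≠ 0 := by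
    rintro rfl
    simp at hz
  induction n with
  | zero => simp [cauchyTransform]
  | succ n ih =>
    have hn' := integrable_pow_of_le (Nat.le_succ n) hn
    have h1 : ∫ x : ℝ, (x : ℂ) ^ n * (z - (x : ℂ))⁻¹ ∂μ = z⁻¹ * (((∫ x, x ^ n ∂μ : ℝ) : ℂ) +
        ∫ x : ℝ, (x : ℂ) ^ (n + 1) * (z - (x : ℂ))⁻¹ ∂μ) := by
      have h2 : Integrable (fun x : ℝ => (x : ℂ) ^ n) μ := by simpa using hn'.ofReal (𝕜 := ℂ)
      rw [← integral_complex_ofReal]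
      push_cast
      rw [← integral_add h2 (integrable_pow_mul_inv_sub hn hz), ← integral_const_mul]
      refine integral_congr_ae (.of_forall fun x => ?_)
      have := sub_ofReal_ne_zero hz x
      simp only
      field_simp
      ring
    rw [ih hn', Finset.sum_range_succ, h1]
    ring

lemma tendsto_mul_integral_pow_mul_inv_sub {μ : Measure ℝ} {n : ℕ}
    (hn : Integrable (fun x : ℝ => x ^ n) μ) :
    Tendsto (fun y : ℝ => y * Complex.I * ∫ x : ℝ, (x : ℂ) ^ n * (y * Complex.I - (x : ℂ))⁻¹ ∂μ)
      atTop (𝓝 ((∫ x, x ^ n ∂μ : ℝ) : ℂ)) := by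
  simp only [← integral_const_mul]
  rw [← integral_complex_ofReal]
  refine tendsto_integral_filter_of_dominated_convergence (fun x => ‖x ^ n‖) ?_ ?_ hn.norm
    (.of_forall fun x => ?_)
  · filter_upwards [eventually_gt_atTop 0] with y hy
    exact ((integrable_pow_mul_inv_sub hn (by simpa using hy)).const_mul _).aestronglyMeasurable
  · filter_upwards [eventually_gt_atTop 0] with y hy
    refine .of_forall fun x => ?_
    have h1 := norm_inv_sub_ofReal_le (z := y * Complex.I) (by simpa using hy) x
    rw [norm_mul, norm_mul, norm_mul, norm_pow, Complex.norm_I, mul_one, Complex.norm_real,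
      Complex.norm_real, norm_pow, Real.norm_of_nonneg hy.le]
    simp only [Complex.im_ofReal_mul, Complex.I_im, mul_one] at h1
    calc _ ≤ y * (‖x‖ ^ n * y⁻¹) := by gcongr
      _ = ‖x‖ ^ n := by field_simp
  · have h1 : Tendsto (fun y : ℝ => (1 : ℂ) - x * (y * Complex.I)⁻¹) atTop (𝓝 (1 - x * 0)) :=
      tendsto_const_nhds.sub
        ((isBigO_inv_mul_I.trans_tendsto tendsto_inv_atTop_zero).const_mul (x : ℂ))
    have h2 := (h1.inv₀ (by simp)).const_mul ((x : ℂ) ^ n)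
    simp only [mul_zero, sub_zero, inv_one, mul_one] at h2
    rw [Complex.ofReal_pow]
    refine h2.congr' ?_
    filter_upwards [eventually_gt_atTop 0] with y hy
    have hy0 : (y : ℂ) * Complex.I ≠ 0 := mul_ne_zero (by exact_mod_cast hy.ne') Complex.I_ne_zero
    have h3 := sub_ofReal_ne_zero (z := y * Complex.I) (by simpa using hy) x
    have h4 : 1 - x * (y * Complex.I)⁻¹ = (y * Complex.I)⁻¹ * (y * Complex.I - x) := by
      rw [mul_sub, inv_mul_cancel₀ hy0]
      ring
    rw [h4, mul_inv, inv_inv]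
    ring

/-- The `n` known moments cancel from the expansion. Multiplying the rest by `z ^ (n + 1)` leaves
two terms, and the order `n + 3` becomes the error `y⁻²`. -/
lemma isBigO_mul_integral_sub_of_hasExpansion {ρ : Measure ℝ} [IsProbabilityMeasure ρ] {c : ℕ → ℝ}
    {n : ℕ} (h : HasExpansion (fun y => cauchyTransform ρ (y * Complex.I))
      (PowerSeries.X * PowerSeries.mk fun n => (c n : ℂ)) (n + 3))
    (hn : Integrable (fun x : ℝ => x ^ n) ρ) (hc : ∀ j < n, ∫ x, x ^ j ∂ρ = c j) :
    (fun y : ℝ => y * Complex.I * ∫ x : ℝ, (x : ℂ) ^ n * (y * Complex.I - (x : ℂ))⁻¹ ∂ρ -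
      (c n + c (n + 1) * (y * Complex.I)⁻¹)) =O[atTop] fun y : ℝ => y⁻¹ ^ 2 := by
  have h1 : (fun y : ℝ => (y * Complex.I) ^ (n + 1)) =O[atTop] fun y : ℝ => y ^ (n + 1) :=
    .of_bound 1 (.of_forall fun y => by simp)
  refine ((h1.mul h).congr' ?_ ?_)
  · filter_upwards [eventually_gt_atTop 0] with y hy
    have hz0 : (y : ℂ) * Complex.I ≠ 0 := mul_ne_zero (by exact_mod_cast hy.ne') Complex.I_ne_zero
    have h2 : (PowerSeries.trunc (n + 3)
        (PowerSeries.X * PowerSeries.mk fun n => (c n : ℂ))).eval (y * Complex.I)⁻¹ =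
        ∑ j ∈ Finset.range (n + 2), (c j : ℂ) * (y * Complex.I)⁻¹ ^ (j + 1) := by
      rw [Polynomial.eval, PowerSeries.eval₂_trunc_eq_sum_range, Finset.sum_range_succ']
      simp [PowerSeries.coeff_succ_X_mul]
    rw [h2, cauchyTransform_eq_sum_add hn (by simpa using hy), Finset.sum_range_succ,
      Finset.sum_range_succ, Finset.sum_congr rfl fun j hj => by
        rw [hc j (Finset.mem_range.1 hj)]]
    generalize (y : ℂ) * Complex.I = z at hz0 ⊢
    generalize ∑ j ∈ Finset.range n, (c j : ℂ) * z⁻¹ ^ (j + 1) = S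
    have e0 : ∀ k, z ^ k * z⁻¹ ^ k = 1 := fun k => by
      rw [← mul_pow, mul_inv_cancel₀ hz0, one_pow]
    linear_combination (z * ∫ x : ℝ, (x : ℂ) ^ n * (z - (x : ℂ))⁻¹ ∂ρ) * e0 n -
      (c n + c (n + 1) * z⁻¹) * e0 (n + 1)
  · filter_upwards [eventually_gt_atTop 0] with y hy
    rw [show n + 3 = n + 1 + 2 by rfl, pow_add y⁻¹, ← mul_assoc, ← mul_pow, mul_inv_cancel₀ hy.ne',
      one_pow, one_mul]

lemma integral_pow_eq_of_hasExpansion {ρ : Measure ℝ} [IsProbabilityMeasure ρ] {c : ℕ → ℝ}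
    {n : ℕ} (h : HasExpansion (fun y => cauchyTransform ρ (y * Complex.I))
      (PowerSeries.X * PowerSeries.mk fun n => (c n : ℂ)) (n + 3))
    (hn : Integrable (fun x : ℝ => x ^ n) ρ) (hc : ∀ j < n, ∫ x, x ^ j ∂ρ = c j) :
    ∫ x, x ^ n ∂ρ = c n := by
  have h1 := (isBigO_mul_integral_sub_of_hasExpansion h hn hc).trans_tendsto
    (by simpa using (tendsto_inv_atTop_zero (𝕜 := ℝ)).pow 2)
  have h2 : Tendsto (fun y : ℝ => (c n : ℂ) + c (n + 1) * (y * Complex.I)⁻¹) atTop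
      (𝓝 (c n + c (n + 1) * 0)) := tendsto_const_nhds.add
    ((isBigO_inv_mul_I.trans_tendsto tendsto_inv_atTop_zero).const_mul _)
  have h3 := h1.add h2
  simp only [sub_add_cancel, mul_zero, add_zero, zero_add] at h3
  exact_mod_cast tendsto_nhds_unique (tendsto_mul_integral_pow_mul_inv_sub hn) h3

/-- On the imaginary axis, `c n - Re (z ∫ x^n / (z - x))` equals `∫ x^(n+2) / (x² + y²)`. The
expansion makes it `O(y⁻²)`, so `∫ x^(n+2) y² / (x² + y²)` stays bounded. For even `n` the integrand
is nonnegative, and Fatou's lemma as `y → ∞` gives integrability. -/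
lemma integrable_pow_add_two_of_hasExpansion {ρ : Measure ℝ} [IsProbabilityMeasure ρ] {c : ℕ → ℝ}
    {n : ℕ} (heven : Even n) (h : HasExpansion (fun y => cauchyTransform ρ (y * Complex.I))
      (PowerSeries.X * PowerSeries.mk fun n => (c n : ℂ)) (n + 3))
    (hn : Integrable (fun x : ℝ => x ^ n) ρ) (hc : ∀ j < n, ∫ x, x ^ j ∂ρ = c j) :
    Integrable (fun x : ℝ => x ^ (n + 2)) ρ := by
  have hpos : ∀ y : ℝ, 0 < y → ∀ x : ℝ, 0 < x ^ 2 + y ^ 2 := fun y hy x => by positivity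
  have hint : ∀ y : ℝ, 0 < y → Integrable (fun x : ℝ => x ^ n * (y ^ 2 / (x ^ 2 + y ^ 2))) ρ := by
    intro y hy
    refine hn.mul_bdd (c := 1) (continuous_const.div (by fun_prop)
      fun x => (hpos y hy x).ne').aestronglyMeasurable (.of_forall fun x => ?_)
    rw [Real.norm_of_nonneg (by have := hpos y hy x; positivity), div_le_one (hpos y hy x)]
    linarith [sq_nonneg x]
  have hre : ∀ y : ℝ, 0 < y → c n - (y * Complex.I * ∫ x : ℝ, (x : ℂ) ^ n *
      (y * Complex.I - (x : ℂ))⁻¹ ∂ρ).re = ∫ x, x ^ (n + 2) / (x ^ 2 + y ^ 2) ∂ρ := by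
    intro y hy
    rw [← integral_const_mul]
    have h1 : (∫ x : ℝ, y * Complex.I * ((x : ℂ) ^ n * (y * Complex.I - (x : ℂ))⁻¹) ∂ρ).re =
        ∫ x : ℝ, (y * Complex.I * ((x : ℂ) ^ n * (y * Complex.I - (x : ℂ))⁻¹)).re ∂ρ :=
      (integral_re ((integrable_pow_mul_inv_sub hn (by simpa using hy)).const_mul _)).symm
    have h2 : ∀ x : ℝ, (y * Complex.I * ((x : ℂ) ^ n * (y * Complex.I - (x : ℂ))⁻¹)).re =
        x ^ n * (y ^ 2 / (x ^ 2 + y ^ 2)) := fun x => by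
      rw [← re_mul_I_mul_inv_sub hy x, ← Complex.re_ofReal_mul]
      congr 1
      push_cast
      ring
    rw [h1, ← integral_pow_eq_of_hasExpansion h hn hc]
    simp only [h2]
    rw [← integral_sub hn (hint y hy)]
    refine integral_congr_ae (.of_forall fun x => ?_)
    have := hpos y hy x
    simp only
    field_simp
    ring
  obtain ⟨C, hC⟩ := (isBigO_mul_integral_sub_of_hasExpansion h hn hc).bound
  have hbound : ∀ᶠ k : ℕ in atTop,
      ∫ x, x ^ (n + 2) * ((k : ℝ) ^ 2 / (x ^ 2 + (k : ℝ) ^ 2)) ∂ρ ≤ C := by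
    filter_upwards [tendsto_natCast_atTop_atTop.eventually (hC.and (eventually_gt_atTop 0))] with
      k ⟨hk, hk0⟩
    have h1 := (neg_le_abs _).trans ((Complex.abs_re_le_norm _).trans hk)
    -- The term of order `1/y` is purely imaginary and disappears from the real part.
    have h2 : ((c (n + 1) : ℂ) * ((k : ℝ) * Complex.I)⁻¹).re = 0 := by simp
    rw [Complex.sub_re, Complex.add_re, h2, Complex.ofReal_re, add_zero, neg_sub, hre _ hk0,
      norm_pow, norm_inv, Real.norm_of_nonneg hk0.le, inv_pow, ← div_eq_mul_inv,
      le_div_iff₀ (by positivity), ← integral_mul_const] at h1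
    refine le_of_eq_of_le (integral_congr_ae (.of_forall fun x => ?_)) h1
    simp only
    ring
  refine ⟨by fun_prop, ?_⟩
  have hev : ∀ x : ℝ, 0 ≤ x ^ (n + 2) := (heven.add even_two).pow_nonneg
  rw [hasFiniteIntegral_iff_ofReal (.of_forall hev)]
  have hlim : ∀ x : ℝ, Tendsto (fun k : ℕ => ENNReal.ofReal
      (x ^ (n + 2) * ((k : ℝ) ^ 2 / (x ^ 2 + (k : ℝ) ^ 2)))) atTop
      (𝓝 (ENNReal.ofReal (x ^ (n + 2)))) := fun x => by
    refine ENNReal.tendsto_ofReal ?_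
    have h1 : Tendsto (fun k : ℕ => (x ^ 2 * ((k : ℝ) ^ 2)⁻¹ + 1)⁻¹) atTop (𝓝 (x ^ 2 * 0 + 1)⁻¹) := by
      refine Tendsto.inv₀ (((Tendsto.const_mul _ ?_)).add_const 1) (by simp)
      exact (tendsto_inv_atTop_zero.comp ((tendsto_pow_atTop two_ne_zero).comp
        tendsto_natCast_atTop_atTop))
    have h2 := h1.const_mul (x ^ (n + 2))
    simp only [mul_zero, zero_add, inv_one, mul_one] at h2
    refine h2.congr' ?_
    filter_upwards [eventually_gt_atTop 0] with k hk
    have hk0 : (0 : ℝ) < k := by exact_mod_cast hk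
    have := hpos k hk0 x
    field_simp
  have hfatou := lintegral_liminf_le (μ := ρ) (u := atTop) (f := fun (k : ℕ) (x : ℝ) => ENNReal.ofReal
    (x ^ (n + 2) * ((k : ℝ) ^ 2 / (x ^ 2 + (k : ℝ) ^ 2)))) (fun k => by fun_prop)
  simp only [fun x => (hlim x).liminf_eq] at hfatou
  refine hfatou.trans_lt (lt_of_le_of_lt ?_ (ENNReal.ofReal_lt_top (r := C)))
  refine liminf_le_of_frequently_le' (Eventually.frequently ?_)
  filter_upwards [hbound, eventually_gt_atTop 0] with k hk hk0
  have hk0 : (0 : ℝ) < k := by exact_mod_cast hk0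
  rw [← ofReal_integral_eq_lintegral_ofReal]
  · exact ENNReal.ofReal_le_ofReal hk
  · have h1 : ∀ x : ℝ, x ^ (n + 2) * ((k : ℝ) ^ 2 / (x ^ 2 + (k : ℝ) ^ 2)) =
        (k : ℝ) ^ 2 * (x ^ n - x ^ n * ((k : ℝ) ^ 2 / (x ^ 2 + (k : ℝ) ^ 2))) := fun x => by
      have := hpos k hk0 x
      field_simp
      ring
    simp only [h1]
    exact (hn.sub (hint k hk0)).const_mul _
  · exact .of_forall fun x => mul_nonneg (hev x) (by positivity)

/-- **Hamburger–Nevanlinna**: an asymptotic expansion of the Cauchy transform to all orders along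
the imaginary axis gives the moments. -/
theorem integral_pow_of_forall_hasExpansion {ρ : Measure ℝ} [IsProbabilityMeasure ρ] {c : ℕ → ℝ}
    (h : ∀ N, HasExpansion (fun y => cauchyTransform ρ (y * Complex.I))
      (PowerSeries.X * PowerSeries.mk fun n => (c n : ℂ)) N) (n : ℕ) :
    Integrable (fun x : ℝ => x ^ n) ρ ∧ ∫ x, x ^ n ∂ρ = c n := by
  have key : ∀ k : ℕ, Integrable (fun x : ℝ => x ^ (2 * k)) ρ ∧ ∀ j < 2 * k, ∫ x, x ^ j ∂ρ = c j := by
    intro k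
    induction k with
    | zero => simp
    | succ k ih =>
      obtain ⟨hi, hc⟩ := ih
      have h2 := integrable_pow_add_two_of_hasExpansion (even_two_mul k) (h _) hi hc
      have hc1 : ∀ j < 2 * k + 1, ∫ x, x ^ j ∂ρ = c j := fun j hj => by
        rcases Nat.lt_succ_iff_lt_or_eq.1 hj with hj | rfl
        · exact hc j hj
        · exact integral_pow_eq_of_hasExpansion (h _) hi hc
      refine ⟨h2, fun j hj => ?_⟩
      rcases Nat.lt_succ_iff_lt_or_eq.1 (show j < 2 * k + 1 + 1 by omega) with hj | rfl
      · exact hc1 j hj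
      · exact integral_pow_eq_of_hasExpansion (h _)
          (integrable_pow_of_le (by omega : 2 * k + 1 ≤ 2 * k + 2) h2) hc1
  obtain ⟨hi, hc⟩ := key (n + 1)
  exact ⟨integrable_pow_of_le (by omega) hi, hc n (by omega)⟩

/-! ### The expansion of a solution of the Pastur equation -/

/-- The recursion in generating-function form, matching `D_b = z⁻¹ (d b 0 + D_{b+1} + D_0 D_b)` with
`X` for `z⁻¹`. Each series carries a factor `X`, so the product enters only from index `n + 2` on.
-/
lemma X_mul_mk_eq_of_recursion {d : ℕ → ℕ → ℝ} (h1 : ∀ b, d b 1 = d (b + 1) 0)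
    (h2 : ∀ b n, d b (n + 2) = d (b + 1) (n + 1) + ∑ i ∈ Finset.range (n + 1), d 0 i * d b (n - i))
    (b : ℕ) :
    (PowerSeries.X * PowerSeries.mk fun n => (d b n : ℂ)) = PowerSeries.X *
      (PowerSeries.C (d b 0 : ℂ) + (PowerSeries.X * PowerSeries.mk fun n => (d (b + 1) n : ℂ)) +
      (PowerSeries.X * PowerSeries.mk fun n => (d 0 n : ℂ)) *
        (PowerSeries.X * PowerSeries.mk fun n => (d b n : ℂ))) := by
  congr 1
  ext n
  rw [mul_assoc PowerSeries.X, mul_left_comm _ PowerSeries.X]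
  rcases n with _ | _ | n
  · simp
  · simp [PowerSeries.coeff_succ_X_mul, h1]
  · rw [map_add, map_add, PowerSeries.coeff_succ_X_mul, PowerSeries.coeff_succ_X_mul,
      PowerSeries.coeff_succ_X_mul, PowerSeries.coeff_mul,
      Finset.Nat.sum_antidiagonal_eq_sum_range_succ_mk]
    simp [h2]

/-- The expansion of the Cauchy transform of a solution of the Pastur equation. -/
theorem hasExpansion_of_cauchyTransform_eq {ν ρ : Measure ℝ} [IsProbabilityMeasure ν]
    [IsProbabilityMeasure ρ] (hν : ∀ b : ℕ, Integrable (fun x : ℝ => x ^ b) ν)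
    (h : ∀ z : ℂ, 1 < z.im → cauchyTransform ρ z = cauchyTransform ν (z - cauchyTransform ρ z))
    {d : ℕ → ℕ → ℝ} (h0 : ∀ b, d b 0 = ∫ x, x ^ b ∂ν) (h1 : ∀ b, d b 1 = d (b + 1) 0)
    (h2 : ∀ b n, d b (n + 2) = d (b + 1) (n + 1) + ∑ i ∈ Finset.range (n + 1), d 0 i * d b (n - i))
    (N : ℕ) :
    HasExpansion (fun y => cauchyTransform ρ (y * Complex.I))
      (PowerSeries.X * PowerSeries.mk fun n => (d 0 n : ℂ)) N := by
  let D : ℕ → ℝ → ℂ := fun b y => ∫ x : ℝ, (x : ℂ) ^ b *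
    (y * Complex.I - cauchyTransform ρ (y * Complex.I) - x)⁻¹ ∂ν
  have hw : ∀ y : ℝ, 1 < y → 1 < (y * Complex.I - cauchyTransform ρ (y * Complex.I)).im :=
    fun y hy => by
      have := im_le_im_sub_cauchyTransform ρ (z := y * Complex.I) (by simp; linarith)
      rw [Complex.im_ofReal_mul, Complex.I_im, mul_one] at this
      linarith
  have hD0 : ∀ y : ℝ, 1 < y → D 0 y = cauchyTransform ρ (y * Complex.I) := fun y hy => by
    rw [h _ (by simpa using hy)]
    simp [D, cauchyTransform]
  -- From `w / (w - x) = 1 + x / (w - x)` one gets `w D_b = m_b + D_{b+1}`; then insert `w = z -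
  -- D_0`.
  have hrec : ∀ b, ∀ y : ℝ, 1 < y →
      (y * Complex.I)⁻¹ * ((d b 0 : ℂ) + D (b + 1) y + D 0 y * D b y) = D b y := fun b y hy => by
    have hy0 : (y : ℂ) * Complex.I ≠ 0 :=
      mul_ne_zero (by exact_mod_cast (by linarith : y ≠ 0)) Complex.I_ne_zero
    have hwy := hw y hy
    rw [hD0 y hy]
    set w := y * Complex.I - cauchyTransform ρ (y * Complex.I) with hwdef
    have h3 : w * D b y = d b 0 + D (b + 1) y := by
      have h4 : Integrable (fun x : ℝ => (x : ℂ) ^ b) ν := by simpa using (hν b).ofReal (𝕜 := ℂ)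
      simp only [D]
      rw [h0, ← integral_complex_ofReal, ← integral_const_mul]
      push_cast
      rw [← integral_add h4 (integrable_pow_mul_inv_sub (hν (b + 1)) (by linarith))]
      refine integral_congr_ae (.of_forall fun x => ?_)
      have := sub_ofReal_ne_zero (z := w) (by linarith) x
      rw [← hwdef]
      simp only
      field_simp
      ring
    rw [← h3, inv_mul_eq_iff_eq_mul₀ hy0, hwdef]
    ring
  have hmain : ∀ N b, HasExpansion (D b) (PowerSeries.X * PowerSeries.mk fun n => (d b n : ℂ)) N := by
    -- The induction on the order covers all `b` at once, since order `N + 1` for `b` uses order `N`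
    -- for `b + 1`.
    intro N
    induction N with
    | zero =>
      intro b
      refine .of_bound (∫ x, ‖x ^ b‖ ∂ν) ?_
      filter_upwards [eventually_gt_atTop 1] with y hy
      simp only [PowerSeries.trunc_zero', Polynomial.eval_zero, sub_zero, pow_zero, norm_one,
        mul_one]
      refine norm_integral_le_of_norm_le (hν b).norm (.of_forall fun x => ?_)
      have h3 := (norm_inv_sub_ofReal_le (by linarith [hw y hy]) x).trans
        (inv_le_one_of_one_le₀ (hw y hy).le)
      rw [norm_mul, norm_pow, norm_pow, Complex.norm_real]
      exact mul_le_of_le_one_right (by positivity) h3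
    | succ N ih =>
      intro b
      rw [X_mul_mk_eq_of_recursion h1 h2 b]
      refine (((HasExpansion.const _ N).add (ih (b + 1))).add ((ih 0).mul (ih b))).inv_mul.congr' ?_
      filter_upwards [eventually_gt_atTop 1] with y hy using hrec b y hy
  exact (hmain N 0).congr' ((eventually_gt_atTop 1).mono hD0)

/-! ### Moments of the standard normal law -/

lemma integrable_pow_gaussianReal (n : ℕ) : Integrable (fun x : ℝ => x ^ n) (gaussianReal 0 1) := by
  have h := (memLp_id_gaussianReal (μ := 0) (v := 1) n).integrable_norm_pow'
  exact (integrable_norm_iff (by fun_prop)).1 (by simpa using h)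

/-- Integration by parts against the density, whose derivative is `-x` times itself. -/
lemma integral_pow_add_two_gaussianReal (n : ℕ) :
    ∫ x : ℝ, x ^ (n + 2) ∂gaussianReal 0 1 = (n + 1) * ∫ x : ℝ, x ^ n ∂gaussianReal 0 1 := by
  have hint : ∀ k : ℕ, Integrable (fun x : ℝ => x ^ k * gaussianPDFReal 0 1 x) := fun k => by
    have h := integrable_pow_gaussianReal k
    rw [gaussianReal_of_var_ne_zero 0 one_ne_zero, integrable_withDensity_iff_integrable_smul'
      (measurable_gaussianPDF 0 1) (.of_forall fun _ => gaussianPDF_lt_top)] at h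
    simpa [toReal_gaussianPDF, mul_comm] using h
  have hpdf : ∀ x : ℝ, HasDerivAt (gaussianPDFReal 0 1) (-x * gaussianPDFReal 0 1 x) x := fun x => by
    have h1 : HasDerivAt (fun x : ℝ => -(x - 0) ^ 2 / (2 * ((1 : NNReal) : ℝ))) (-x) x := by
      refine ((((hasDerivAt_id x).sub_const 0).pow 2).neg.div_const _).congr_deriv ?_
      simp
      ring
    refine (h1.exp.const_mul (√(2 * Real.pi * ((1 : NNReal) : ℝ)))⁻¹).congr_deriv ?_
    simp only [gaussianPDFReal]
    ring
  have hparts := integral_mul_deriv_eq_deriv_mul_of_integrable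
    (u := fun x : ℝ => x ^ (n + 1)) (u' := fun x => (n + 1) * x ^ n) (v := gaussianPDFReal 0 1)
    (v' := fun x => -x * gaussianPDFReal 0 1 x)
    (fun x _ => by simpa using hasDerivAt_pow (n + 1) x) (fun x _ => hpdf x)
    (by
      refine (hint (n + 2)).neg.congr (.of_forall fun x => ?_)
      simp only [Pi.neg_apply, Pi.mul_apply]
      ring)
    (by
      refine ((hint n).const_mul (n + 1)).congr (.of_forall fun x => ?_)
      simp only [Pi.mul_apply]
      ring) (hint (n + 1))
  rw [integral_gaussianReal_eq_integral_smul one_ne_zero,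
    integral_gaussianReal_eq_integral_smul one_ne_zero, ← integral_const_mul, ← neg_inj,
    ← integral_neg]
  refine (integral_congr_ae (.of_forall fun x => ?_)).trans
    (hparts.trans (congrArg Neg.neg (integral_congr_ae (.of_forall fun x => ?_))))
  · simp only [smul_eq_mul]
    ring
  · simp only [smul_eq_mul]
    ring

lemma isSymmetric_gaussianReal : IsSymmetric (gaussianReal 0 1) := by
  rw [IsSymmetric, gaussianReal_map_neg, neg_zero]

/-! ### Determinacy -/

lemma integral_pow_eq_zero_of_isSymmetric {ρ : Measure ℝ} (h : IsSymmetric ρ) {n : ℕ} (hn : Odd n) :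
    ∫ x : ℝ, x ^ n ∂ρ = 0 := by
  have h1 : ∫ x : ℝ, x ^ n ∂(ρ.map fun x => -x) = ∫ x : ℝ, (-x) ^ n ∂ρ :=
    integral_map (by fun_prop) (by fun_prop)
  rw [show ρ.map (fun x => -x) = ρ from h] at h1
  simp only [hn.neg_pow, integral_neg] at h1
  linarith

/-- By symmetry the characteristic function is `∫ cos (t x)`, whose series involves even powers
only. Their integrals are the terms in `hs`, which justifies termwise integration. -/
lemma hasSum_charFun_of_isSymmetric {ρ : Measure ℝ} [IsProbabilityMeasure ρ] (h : IsSymmetric ρ)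
    {m : ℕ → ℝ} (hm : ∀ k, Integrable (fun x : ℝ => x ^ (2 * k)) ρ ∧ ∫ x : ℝ, x ^ (2 * k) ∂ρ = m k)
    (hs : ∀ t : ℝ, Summable fun k : ℕ => t ^ (2 * k) / (2 * k).factorial * m k) (t : ℝ) :
    HasSum (fun k : ℕ => (((-1) ^ k * (t ^ (2 * k) / (2 * k).factorial * m k) : ℝ) : ℂ))
      (charFun ρ t) := by
  have hexp : Integrable (fun x : ℝ => Complex.exp (t * x * Complex.I)) ρ := by
    refine Integrable.of_bound (by fun_prop) 1 (.of_forall fun x => ?_)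
    exact_mod_cast (Complex.norm_exp_ofReal_mul_I (t * x)).le
  have hchar : charFun ρ t = ((∫ x : ℝ, Real.cos (t * x) ∂ρ : ℝ) : ℂ) := by
    have h1 : charFun ρ t = ∫ x : ℝ, Complex.exp (-(t * x * Complex.I)) ∂ρ := by
      conv_lhs => rw [← show ρ.map (fun x => -x) = ρ from h, charFun_apply_real]
      rw [integral_map (by fun_prop) (by fun_prop)]
      push_cast
      simp
    have h2 : charFun ρ t = ∫ x : ℝ, Complex.exp (t * x * Complex.I) ∂ρ := charFun_apply_real t
    have hexp' : Integrable (fun x : ℝ => Complex.exp (-(t * x * Complex.I))) ρ := by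
      refine Integrable.of_bound (by fun_prop) 1 (.of_forall fun x => ?_)
      have := (Complex.norm_exp_ofReal_mul_I (-(t * x))).le
      push_cast at this
      rwa [neg_mul] at this
    have h3 : charFun ρ t + charFun ρ t = 2 * ((∫ x : ℝ, Real.cos (t * x) ∂ρ : ℝ) : ℂ) := by
      conv_lhs => lhs; rw [h2]
      rw [h1, ← integral_add hexp hexp', ← integral_complex_ofReal, ← integral_const_mul]
      refine integral_congr_ae (.of_forall fun x => ?_)
      simp only [Complex.ofReal_cos, Complex.cos]
      push_cast
      ring_nf
    linear_combination h3 / 2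
  rw [hchar, Complex.hasSum_ofReal]
  have hterm : ∀ (k : ℕ) (x : ℝ), (-1) ^ k * (t * x) ^ (2 * k) / (2 * k).factorial =
      (-1) ^ k * (t ^ (2 * k) / (2 * k).factorial) * x ^ (2 * k) := fun k x => by
    rw [mul_pow]
    ring
  have key := hasSum_integral_of_summable_integral_norm (μ := ρ)
    (F := fun (k : ℕ) (x : ℝ) => (-1) ^ k * (t * x) ^ (2 * k) / (2 * k).factorial)
    (fun k => by
      simp only [hterm]
      exact (hm k).1.const_mul _) (by
    refine (hs t).congr fun k => ?_
    have hnorm : ∀ x : ℝ, ‖(-1) ^ k * (t * x) ^ (2 * k) / (2 * k).factorial‖ =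
        t ^ (2 * k) / (2 * k).factorial * x ^ (2 * k) := fun x => by
      rw [hterm, norm_mul, norm_mul, norm_pow, norm_neg, norm_one, one_pow, one_mul,
        Real.norm_of_nonneg (div_nonneg ((even_two_mul k).pow_nonneg t) (by positivity)),
        Real.norm_of_nonneg ((even_two_mul k).pow_nonneg x)]
    simp only [hnorm]
    rw [integral_const_mul, (hm k).2])
  simp only [fun x => (Real.hasSum_cos (t * x)).tsum_eq] at key
  have hval : ∀ k : ℕ, ∫ x : ℝ, (-1) ^ k * (t * x) ^ (2 * k) / (2 * k).factorial ∂ρ =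
      (-1) ^ k * (t ^ (2 * k) / (2 * k).factorial * m k) := fun k => by
    simp only [hterm]
    rw [integral_const_mul, (hm k).2, mul_assoc]
  simpa only [hval] using key

/-- Symmetric measures with the same even moments are equal, if the moments do not grow too
fast. -/
theorem eq_of_isSymmetric_of_integral_pow_eq {ρ ρ' : Measure ℝ} [IsProbabilityMeasure ρ]
    [IsProbabilityMeasure ρ'] (h : IsSymmetric ρ) (h' : IsSymmetric ρ') {m : ℕ → ℝ}
    (hm : ∀ k, Integrable (fun x : ℝ => x ^ (2 * k)) ρ ∧ ∫ x : ℝ, x ^ (2 * k) ∂ρ = m k)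
    (hm' : ∀ k, Integrable (fun x : ℝ => x ^ (2 * k)) ρ' ∧ ∫ x : ℝ, x ^ (2 * k) ∂ρ' = m k)
    (hs : ∀ t : ℝ, Summable fun k : ℕ => t ^ (2 * k) / (2 * k).factorial * m k) : ρ = ρ' := by
  refine Measure.ext_of_charFun (funext fun t => ?_)
  exact (hasSum_charFun_of_isSymmetric h hm hs t).unique (hasSum_charFun_of_isSymmetric h' hm' hs t)

end FreeConv

namespace PartitionWord

set_option linter.unusedSectionVars false

/-! ### Pairings, weighted counts and gluing -/

section Pairings

variable {α β : Type*} [LinearOrder α] [Fintype α] [LinearOrder β] [Fintype β]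

/-- The pairings of `α`, as fixed-point-free involutions. -/
def pairings (α : Type*) [LinearOrder α] [Fintype α] : Finset (α → α) :=
  Finset.univ.filter fun σ => (∀ x, σ (σ x) = x) ∧ ∀ x, σ x ≠ x

lemma mem_pairings {σ : α → α} : σ ∈ pairings α ↔ (∀ x, σ (σ x) = x) ∧ ∀ x, σ x ≠ x := by
  simp [pairings]

/-- The chord that starts in `p` is not crossed by any other chord of `σ`. -/
def IsIsolated (σ : α → α) (p : α) : Prop :=
  p < σ p ∧ ∀ q, p < q → q < σ p → p < σ q ∧ σ q < σ p

instance (σ : α → α) : DecidablePred (IsIsolated σ) := fun p => by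
  unfold IsIsolated
  infer_instance

/-- Each pairing is counted with weight `2` for each isolated chord starting in `U`. -/
def weightedCount (U : Finset α) : ℕ :=
  ∑ σ ∈ pairings α, 2 ^ (U.filter (IsIsolated σ)).card

lemma isIsolated_conj (e : α ≃o β) (σ : α → α) (p : α) :
    IsIsolated (fun y => e (σ (e.symm y))) (e p) ↔ IsIsolated σ p := by
  simp only [IsIsolated, OrderIso.symm_apply_apply, e.lt_iff_lt]
  refine and_congr_right fun _ => ⟨fun h q h1 h2 => ?_, fun h q h1 h2 => ?_⟩
  · simpa using h (e q) (by simpa using h1) (by simpa using h2)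
  · rw [← e.apply_symm_apply q, e.lt_iff_lt] at h1 h2
    simpa using h (e.symm q) h1 h2

lemma conj_mem_pairings (e : α ≃o β) {σ : α → α} (hσ : σ ∈ pairings α) :
    (fun y => e (σ (e.symm y))) ∈ pairings β := by
  rw [mem_pairings] at hσ ⊢
  refine ⟨fun x => by simp [hσ.1], fun x h => hσ.2 (e.symm x) ?_⟩
  rw [← e.symm_apply_apply (σ (e.symm x)), h]

lemma weightedCount_map (e : α ≃o β) (U : Finset α) :
    weightedCount (U.map e.toEquiv.toEmbedding) = weightedCount U := by
  symm
  refine Finset.sum_nbij' (fun σ y => e (σ (e.symm y))) (fun τ x => e.symm (τ (e x)))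
    (fun σ hσ => conj_mem_pairings e hσ) (fun τ hτ => conj_mem_pairings e.symm hτ)
    (fun σ _ => by ext; simp) (fun τ _ => by ext; simp) fun σ _ => ?_
  rw [Finset.filter_map, Finset.card_map]
  congr 3
  ext p
  exact (isIsolated_conj e σ p).symm

/-- The weighted count for `b + n` points, the first `b` of which have weight one. -/
def count (b n : ℕ) : ℕ :=
  weightedCount (Finset.univ.filter fun x : Fin (b + n) => b ≤ x.val)

/-- Only the order type matters: an order isomorphism with `Fin (b + n)` carries an upper set of
size `n` to the last `n` points. -/
lemma weightedCount_eq_count {U : Finset α} (hU : ∀ x ∈ U, ∀ y, x ≤ y → y ∈ U) {b n : ℕ}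
    (hcard : Fintype.card α = b + n) (hn : U.card = n) : weightedCount U = count b n := by
  let e : α ≃o Fin (b + n) := (Fintype.orderIsoFinOfCardEq α hcard).symm
  rw [count, ← weightedCount_map e U]
  congr 1
  set V := U.map e.toEquiv.toEmbedding with hV
  have hVcard : V.card = n := by rw [hV, Finset.card_map, hn]
  have hVup : ∀ x ∈ V, ∀ y, x ≤ y → y ∈ V := by
    intro x hx y hxy
    rw [hV, Finset.mem_map_equiv] at hx ⊢
    exact hU _ hx _ (e.symm.monotone hxy)
  ext i
  rw [Finset.mem_filter]
  refine ⟨fun hi => ⟨Finset.mem_univ _, ?_⟩, fun hi => ?_⟩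
  · have h1 : Finset.Ici i ⊆ V := fun y hy => hVup i hi y (Finset.mem_Ici.1 hy)
    have h2 := Finset.card_le_card h1
    rw [Fin.card_Ici, hVcard] at h2
    omega
  · by_contra hni
    have h1 : V ⊆ Finset.Ioi i := fun y hy => by
      rw [Finset.mem_Ioi]
      by_contra h
      exact hni (hVup y hy i (not_lt.1 h))
    have h2 := Finset.card_le_card h1
    rw [Fin.card_Ioi, hVcard] at h2
    have := hi.2
    have := i.2
    omega

/-! ### Gluing pairings -/

/-- The restriction of `σ` to a subset `P` that is stable under `σ`. -/
def restrictTo (P : α → Prop) [DecidablePred P] (σ : α → α) (x : {x // P x}) : {x // P x} :=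
  if h : P (σ x) then ⟨σ x, h⟩ else x

variable (P : α → Prop) [DecidablePred P] (p j : α)

/-- The points that are neither in `P` nor one of `p`, `j`. -/
def Outside (x : α) : Prop := ¬P x ∧ x ≠ p ∧ x ≠ j

instance : DecidablePred (Outside P p j) := fun x => by
  unfold Outside
  infer_instance

/-- The pairing that consists of a pairing of `P`, of the chord `{p, j}` and of a pairing of the
remaining points. -/
def glue (τ : {x // P x} → {x // P x}) (υ : {x // Outside P p j x} → {x // Outside P p j x})
    (x : α) : α :=
  if h : P x then τ ⟨x, h⟩ else if h' : Outside P p j x then υ ⟨x, h'⟩ else if x = p then j else p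

variable {P p j} {τ : {x // P x} → {x // P x}}
  {υ : {x // Outside P p j x} → {x // Outside P p j x}}

lemma glue_of_mem {x : α} (h : P x) : glue P p j τ υ x = τ ⟨x, h⟩ := by
  simp [glue, h]

lemma glue_of_outside {x : α} (h : Outside P p j x) : glue P p j τ υ x = υ ⟨x, h⟩ := by
  rw [glue, dif_neg h.1, dif_pos h]

lemma glue_left (hp : ¬P p) : glue P p j τ υ p = j := by
  rw [glue, dif_neg hp, dif_neg (fun h => h.2.1 rfl), if_pos rfl]

lemma glue_right (hj : ¬P j) (hpj : p ≠ j) : glue P p j τ υ j = p := by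
  rw [glue, dif_neg hj, dif_neg (fun h => h.2.2 rfl), if_neg hpj.symm]

lemma cases_of_glue (P : α → Prop) (p j x : α) : P x ∨ Outside P p j x ∨ x = p ∨ x = j := by
  unfold Outside
  tauto

lemma glue_mem_pairings (hp : ¬P p) (hj : ¬P j) (hpj : p ≠ j) (hτ : τ ∈ pairings {x // P x})
    (hυ : υ ∈ pairings {x // Outside P p j x}) : glue P p j τ υ ∈ pairings α := by
  rw [mem_pairings] at hτ hυ ⊢
  constructor
  · intro x
    rcases cases_of_glue P p j x with h | h | rfl | rfl
    · rw [glue_of_mem h, glue_of_mem (τ ⟨x, h⟩).2]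
      simp [hτ.1]
    · rw [glue_of_outside h, glue_of_outside (υ ⟨x, h⟩).2]
      simp [hυ.1]
    · rw [glue_left hp, glue_right hj hpj]
    · rw [glue_right hj hpj, glue_left hp]
  · intro x
    rcases cases_of_glue P p j x with h | h | rfl | rfl
    · rw [glue_of_mem h]
      exact fun h' => hτ.2 _ (Subtype.ext h')
    · rw [glue_of_outside h]
      exact fun h' => hυ.2 _ (Subtype.ext h')
    · rw [glue_left hp]
      exact hpj.symm
    · rw [glue_right hj hpj]
      exact hpj

lemma restrictTo_mem_pairings {Q : α → Prop} [DecidablePred Q] {σ : α → α} (hσ : σ ∈ pairings α)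
    (hQ : ∀ x, Q x → Q (σ x)) : restrictTo Q σ ∈ pairings {x // Q x} := by
  rw [mem_pairings] at hσ ⊢
  have h : ∀ x : {x // Q x}, ((restrictTo Q σ x : {x // Q x}) : α) = σ x := fun x => by
    simp [restrictTo, hQ x x.2]
  refine ⟨fun x => Subtype.ext ?_, fun x hx => hσ.2 x ?_⟩
  · rw [h, h, hσ.1]
  · rw [← h, hx]

lemma outside_of_stable {σ : α → α} (hσ : σ ∈ pairings α) (hpj : σ p = j)
    (hP : ∀ x, P x → P (σ x)) {x : α} (hx : Outside P p j x) : Outside P p j (σ x) := by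
  rw [mem_pairings] at hσ
  refine ⟨fun h => hx.1 (hσ.1 x ▸ hP _ h), fun h => hx.2.2 ?_, fun h => hx.2.1 ?_⟩
  · rw [← hσ.1 x, h, hpj]
  · rw [← hσ.1 x, h, ← hpj, hσ.1]

/-- Pairings with the chord `{p, j}` that leave `P` stable are glued from a pairing of `P` and one
of the points outside. -/
lemma sum_pairings_eq_mul (hp : ¬P p) (hj : ¬P j) (hpj : p ≠ j) (f : (α → α) → ℕ)
    (f₁ : ({x // P x} → {x // P x}) → ℕ)
    (f₂ : ({x // Outside P p j x} → {x // Outside P p j x}) → ℕ)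
    (hf : ∀ τ ∈ pairings {x // P x}, ∀ υ ∈ pairings {x // Outside P p j x},
      f (glue P p j τ υ) = f₁ τ * f₂ υ) :
    ∑ σ ∈ (pairings α).filter (fun σ => σ p = j ∧ ∀ x, P x → P (σ x)), f σ =
      (∑ τ ∈ pairings {x // P x}, f₁ τ) * ∑ υ ∈ pairings {x // Outside P p j x}, f₂ υ := by
  have hres : ∀ {Q : α → Prop} [DecidablePred Q] {σ : α → α}, (∀ x, Q x → Q (σ x)) →
      ∀ x : {x // Q x}, ((restrictTo Q σ x : {x // Q x}) : α) = σ x := fun hQ x => by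
    simp [restrictTo, hQ x x.2]
  rw [Finset.sum_mul_sum, ← Finset.sum_product']
  symm
  refine Finset.sum_nbij' (fun q => glue P p j q.1 q.2)
    (fun σ => (restrictTo P σ, restrictTo (Outside P p j) σ)) ?_ ?_ ?_ ?_ ?_
  · rintro ⟨τ, υ⟩ h
    rw [Finset.mem_product] at h
    refine Finset.mem_filter.2 ⟨glue_mem_pairings hp hj hpj h.1 h.2, glue_left hp, fun x hx => ?_⟩
    simp only [glue_of_mem hx]
    exact (τ ⟨x, hx⟩).2
  · intro σ hσ
    rw [Finset.mem_filter] at hσ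
    exact Finset.mem_product.2 ⟨restrictTo_mem_pairings hσ.1 hσ.2.2,
      restrictTo_mem_pairings hσ.1 fun x hx => outside_of_stable hσ.1 hσ.2.1 hσ.2.2 hx⟩
  · rintro ⟨τ, υ⟩ h
    refine Prod.ext (funext fun x => Subtype.ext ?_) (funext fun x => Subtype.ext ?_)
    · simp only
      rw [hres fun x hx => by rw [glue_of_mem hx]; exact (τ ⟨x, hx⟩).2, glue_of_mem x.2]
    · simp only
      rw [hres fun x hx => by rw [glue_of_outside hx]; exact (υ ⟨x, hx⟩).2, glue_of_outside x.2]
  · intro σ hσ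
    rw [Finset.mem_filter] at hσ
    funext x
    simp only
    rcases cases_of_glue P p j x with h | h | rfl | rfl
    · rw [glue_of_mem h, hres hσ.2.2]
    · rw [glue_of_outside h, hres fun x hx => outside_of_stable hσ.1 hσ.2.1 hσ.2.2 hx]
    · rw [glue_left hp, hσ.2.1]
    · rw [glue_right hj hpj, ← hσ.2.1, (mem_pairings.1 hσ.1).1]
  · rintro ⟨τ, υ⟩ h
    rw [Finset.mem_product] at h
    exact (hf τ h.1 υ h.2).symm

end Pairings

/-! ### Splitting a pairing along an isolated chord -/

section Interval

variable {α : Type*} [LinearOrder α] [Fintype α] {p j : α}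

/-- The points strictly between `p` and `j`. -/
def Between (p j x : α) : Prop := p < x ∧ x < j

instance (p j : α) : DecidablePred (Between p j) := fun x => by
  unfold Between
  infer_instance

variable {τ : {x // Between p j x} → {x // Between p j x}}
  {υ : {x // Outside (Between p j) p j x} → {x // Outside (Between p j) p j x}}

lemma outside_between_iff (hpj : p < j) (x : α) : Outside (Between p j) p j x ↔ x < p ∨ j < x := by
  unfold Outside Between
  constructor
  · rintro ⟨h1, h2, h3⟩
    rcases lt_or_gt_of_ne h2 with h | h
    · exact Or.inl h
    · exact Or.inr (lt_of_le_of_ne (not_lt.1 fun h' => h1 ⟨h, h'⟩) h3.symm)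
  · rintro (h | h)
    · exact ⟨fun h' => h.not_gt h'.1, h.ne, (h.trans hpj).ne⟩
    · exact ⟨fun h' => h.not_gt h'.2, (hpj.trans h).ne', h.ne'⟩

lemma isIsolated_glue_of_between (x : {x // Between p j x}) :
    IsIsolated (glue (Between p j) p j τ υ) x ↔ IsIsolated τ x := by
  rw [IsIsolated, IsIsolated, glue_of_mem x.2]
  refine and_congr_right fun _ => ⟨fun h q h1 h2 => ?_, fun h q h1 h2 => ?_⟩
  · have := h q h1 h2
    rwa [glue_of_mem q.2] at this
  · have hq : Between p j q := ⟨x.2.1.trans h1, h2.trans (τ x).2.2⟩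
    rw [glue_of_mem hq]
    exact h ⟨q, hq⟩ h1 h2

/-- The points that `υ` does not see form the block from `p` to `j`, which the glued pairing maps to
itself. A chord of `υ` enclosing one of them starts before `p` and ends after `j`, hence encloses
the whole block. -/
lemma isIsolated_glue_of_outside (hpj : p < j) (x : {x // Outside (Between p j) p j x}) :
    IsIsolated (glue (Between p j) p j τ υ) x ↔ IsIsolated υ x := by
  rw [IsIsolated, IsIsolated, glue_of_outside x.2]
  refine and_congr_right fun _ => ⟨fun h q h1 h2 => ?_, fun h q h1 h2 => ?_⟩
  · have := h q h1 h2
    rwa [glue_of_outside q.2] at this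
  · by_cases hq : Outside (Between p j) p j q
    · rw [glue_of_outside hq]
      exact h ⟨q, hq⟩ h1 h2
    · have hq' := hq
      rw [outside_between_iff hpj, not_or, not_lt, not_lt] at hq'
      have hx : (x : α) < p := ((outside_between_iff hpj _).1 x.2).resolve_right
        fun h' => (h'.trans h1).not_ge hq'.2
      have hy : j < (υ x : α) := ((outside_between_iff hpj _).1 (υ x).2).resolve_left
        fun h' => (h2.trans h').not_ge hq'.1
      have hmem : p ≤ glue (Between p j) p j τ υ q ∧ glue (Between p j) p j τ υ q ≤ j := by
        rcases cases_of_glue (Between p j) p j q with h' | h' | rfl | rfl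
        · rw [glue_of_mem h']
          exact ⟨(τ ⟨q, h'⟩).2.1.le, (τ ⟨q, h'⟩).2.2.le⟩
        · exact absurd h' hq
        · rw [glue_left fun h => lt_irrefl _ h.1]
          exact ⟨hpj.le, le_rfl⟩
        · rw [glue_right (fun h => lt_irrefl _ h.2) hpj.ne]
          exact ⟨le_rfl, hpj.le⟩
      exact ⟨hx.trans_le hmem.1, hmem.2.trans_lt hy⟩

/-- Inner points all lie beyond `p`, so each is weighted; `p` itself is excluded and `j` ends its
chord, so neither contributes. -/
lemma card_filter_isIsolated_glue (hpj : p < j) :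
    ((Finset.univ.filter (p < ·)).filter (IsIsolated (glue (Between p j) p j τ υ))).card =
      (Finset.univ.filter (IsIsolated τ)).card +
        ((Finset.univ.filter fun x : {x // Outside (Between p j) p j x} => p < x.1).filter
          (IsIsolated υ)).card := by
  classical
  rw [← Finset.card_map (Function.Embedding.subtype (Between p j)),
    ← Finset.card_map (Function.Embedding.subtype (Outside (Between p j) p j)),
    ← Finset.card_union_of_disjoint]
  · congr 1
    ext x
    simp only [Finset.mem_filter, Finset.mem_univ, true_and, Finset.mem_union, Finset.mem_map,
      Function.Embedding.subtype_apply]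
    constructor
    · rintro ⟨h1, h2⟩
      rcases cases_of_glue (Between p j) p j x with h | h | rfl | rfl
      · exact Or.inl ⟨⟨x, h⟩, (isIsolated_glue_of_between ⟨x, h⟩).1 h2, rfl⟩
      · exact Or.inr ⟨⟨x, h⟩, ⟨h1, (isIsolated_glue_of_outside hpj ⟨x, h⟩).1 h2⟩, rfl⟩
      · exact absurd h1 (lt_irrefl _)
      · have h3 := h2.1
        rw [glue_right (fun h => lt_irrefl _ h.2) hpj.ne] at h3
        exact absurd h3 hpj.not_gt
    · rintro (⟨y, hy, rfl⟩ | ⟨y, hy, rfl⟩)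
      · exact ⟨y.2.1, (isIsolated_glue_of_between y).2 hy⟩
      · exact ⟨hy.1, (isIsolated_glue_of_outside hpj y).2 hy.2⟩
  · rw [Finset.disjoint_left]
    intro x hx hx'
    obtain ⟨y, -, rfl⟩ := Finset.mem_map.1 hx
    obtain ⟨z, -, hz⟩ := Finset.mem_map.1 hx'
    have hz : (z : α) = y := hz
    exact z.2.1 (by rw [hz]; exact y.2)

/-- Sort by the partner `j` of `p`: the chord is isolated exactly when the points between `p` and
`j` are stable, and then the weight factors over inside and outside. -/
lemma sum_pairings_isIsolated (p : α) :
    ∑ σ ∈ (pairings α).filter (fun σ => IsIsolated σ p),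
        2 ^ ((Finset.univ.filter (p < ·)).filter (IsIsolated σ)).card =
      ∑ j ∈ Finset.univ.filter (p < ·),
        weightedCount (Finset.univ : Finset {x // Between p j x}) *
        weightedCount (Finset.univ.filter fun x : {x // Outside (Between p j) p j x} => p < x.1) := by
  rw [← Finset.sum_fiberwise_of_maps_to (g := fun σ : α → α => σ p)
    (t := Finset.univ.filter (p < ·))]
  · refine Finset.sum_congr rfl fun j hj => ?_
    have hpj : p < j := (Finset.mem_filter.1 hj).2
    rw [weightedCount, weightedCount, ← sum_pairings_eq_mul (P := Between p j) (p := p) (j := j)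
      (fun h => lt_irrefl _ h.1) (fun h => lt_irrefl _ h.2) hpj.ne
      (fun σ => 2 ^ ((Finset.univ.filter (p < ·)).filter (IsIsolated σ)).card)]
    · refine Finset.sum_congr ?_ fun _ _ => rfl
      ext σ
      simp only [Finset.mem_filter, and_assoc]
      refine and_congr_right fun _ => ⟨?_, ?_⟩
      · rintro ⟨h1, rfl⟩
        exact ⟨rfl, fun x hx => h1.2 x hx.1 hx.2⟩
      · rintro ⟨rfl, h⟩
        exact ⟨⟨hpj, fun q h1 h2 => h q ⟨h1, h2⟩⟩, rfl⟩
    · intro τ _ υ _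
      rw [card_filter_isIsolated_glue hpj, pow_add]
  · intro σ hσ
    exact Finset.mem_filter.2 ⟨Finset.mem_univ _, (Finset.mem_filter.1 hσ).2.1⟩

end Interval

/-! ### The recursion for the counts and their initial values -/

/-- The factor of `p` is `1`, plus a further `1` if its chord is isolated. -/
lemma weightedCount_filter_le {α : Type*} [LinearOrder α] [Fintype α] (p : α) :
    weightedCount (Finset.univ.filter (p ≤ ·)) = weightedCount (Finset.univ.filter (p < ·)) +
      ∑ σ ∈ (pairings α).filter (fun σ => IsIsolated σ p),
        2 ^ ((Finset.univ.filter (p < ·)).filter (IsIsolated σ)).card := by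
  rw [weightedCount, weightedCount, Finset.sum_filter, ← Finset.sum_add_distrib]
  refine Finset.sum_congr rfl fun σ _ => ?_
  have h1 : Finset.univ.filter (p ≤ ·) = insert p (Finset.univ.filter (p < ·)) := by
    ext x
    simp [le_iff_eq_or_lt, eq_comm]
  rw [h1, Finset.filter_insert]
  split_ifs with h
  · rw [Finset.card_insert_of_notMem (by simp), pow_succ, mul_two]
  · rw [add_zero]

/-- The recursion for `count`. -/
lemma count_succ (b n : ℕ) :
    count b (n + 1) = count (b + 1) n + ∑ i ∈ Finset.range n, count 0 i * count b (n - 1 - i) := by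
  -- The first weighted point; exactly `b` points precede it.
  let p : Fin (b + (n + 1)) := ⟨b, by omega⟩
  have h1 : count b (n + 1) =
      weightedCount (Finset.univ.filter fun x : Fin (b + (n + 1)) => p ≤ x) := rfl
  rw [h1, weightedCount_filter_le]
  congr 1
  · refine weightedCount_eq_count (fun x hx y hxy => ?_) ?_ ?_
    · simp only [Finset.mem_filter, Finset.mem_univ, true_and] at hx ⊢
      exact hx.trans_le hxy
    · rw [Fintype.card_fin]
      omega
    · have : Finset.univ.filter (p < ·) = Finset.Ioi p := by
        ext x
        simp
      rw [this, Fin.card_Ioi]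
      simp only [p]
      omega
  · rw [sum_pairings_isIsolated]
    -- The index is the number `i` of points under the chord. Outside remain the `b` unweighted
    -- points and the `n - 1 - i` points after `j`.
    refine Finset.sum_nbij (fun j => j.val - b - 1) ?_ ?_ ?_ ?_
    · intro j hj
      have h2 : b < j.val := (Finset.mem_filter.1 hj).2
      have := j.2
      simp only [Finset.mem_range]
      omega
    · intro j hj j' hj' h
      have h2 : b < j.val := (Finset.mem_filter.1 hj).2
      have h3 : b < j'.val := (Finset.mem_filter.1 hj').2
      simp only at h
      exact Fin.ext (by omega)
    · intro i hi
      have hi := Finset.mem_range.1 hi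
      refine ⟨⟨b + 1 + i, by omega⟩, ?_, by simp only; omega⟩
      simp only [Finset.coe_filter, Finset.mem_univ, true_and, Set.mem_ofPred_eq, p, Fin.lt_def]
      omega
    · intro j hj
      have hpj : p < j := (Finset.mem_filter.1 hj).2
      have h2 : b < j.val := hpj
      have hjN := j.2
      congr 1
      · refine weightedCount_eq_count (fun _ _ _ _ => Finset.mem_univ _) ?_ ?_
        · rw [Fintype.card_subtype]
          have : Finset.univ.filter (Between p j) = Finset.Ioo p j := by
            ext x
            simp [Between]
          rw [this, Fin.card_Ioo]
          simp only [p]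
          omega
        · rw [Finset.card_univ, Fintype.card_subtype]
          have : Finset.univ.filter (Between p j) = Finset.Ioo p j := by
            ext x
            simp [Between]
          rw [this, Fin.card_Ioo]
      · refine weightedCount_eq_count (fun x hx y hxy => ?_) ?_ ?_
        · simp only [Finset.mem_filter, Finset.mem_univ, true_and] at hx ⊢
          exact lt_of_lt_of_le hx hxy
        · rw [Fintype.card_subtype]
          have : Finset.univ.filter (Outside (Between p j) p j) = (Finset.Icc p j)ᶜ := by
            ext x
            simp only [Finset.mem_filter, Finset.mem_univ, true_and, outside_between_iff hpj,
              Finset.mem_compl, Finset.mem_Icc, not_and_or, not_le]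
          rw [this, Finset.card_compl, Fin.card_Icc, Fintype.card_fin]
          simp only [p]
          omega
        · rw [← Finset.card_map (Function.Embedding.subtype (Outside (Between p j) p j))]
          have : (Finset.univ.filter fun x : {x // Outside (Between p j) p j x} => p < x.1).map
              (Function.Embedding.subtype (Outside (Between p j) p j)) = Finset.Ioi j := by
            ext x
            rw [Finset.mem_map, Finset.mem_Ioi]
            constructor
            · rintro ⟨y, hy, rfl⟩
              exact ((outside_between_iff hpj _).1 y.2).resolve_left
                (Finset.mem_filter.1 hy).2.not_gt
            · intro hx
              exact ⟨⟨x, (outside_between_iff hpj x).2 (Or.inr hx)⟩,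
                Finset.mem_filter.2 ⟨Finset.mem_univ _, hpj.trans hx⟩, rfl⟩
          rw [this, Fin.card_Ioi]
          omega

lemma weightedCount_empty (α : Type*) [LinearOrder α] [Fintype α] :
    weightedCount (∅ : Finset α) = (pairings α).card := by
  simp [weightedCount]

lemma card_pairings (α : Type*) [LinearOrder α] [Fintype α] :
    (pairings α).card = count (Fintype.card α) 0 := by
  rw [← weightedCount_empty, weightedCount_eq_count (b := Fintype.card α) (n := 0) (by simp) (by simp) (by simp)]

lemma count_zero_zero : count 0 0 = 1 := by
  rw [show count 0 0 = (pairings (Fin 0)).card by rw [card_pairings, Fintype.card_fin]]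
  decide

lemma count_one_zero : count 1 0 = 0 := by
  rw [show count 1 0 = (pairings (Fin 1)).card by rw [card_pairings, Fintype.card_fin]]
  decide

/-- The point `0` has `n + 1` possible partners, and the other `n` points are paired freely. -/
lemma count_add_two_zero (n : ℕ) : count (n + 2) 0 = (n + 1) * count n 0 := by
  have h0 : count (n + 2) 0 = (pairings (Fin (n + 2))).card := by
    rw [card_pairings, Fintype.card_fin]
  rw [h0, Finset.card_eq_sum_card_fiberwise (f := fun σ : Fin (n + 2) → Fin (n + 2) => σ 0)
    (t := Finset.univ.erase 0)]
  · have h1 : ∀ j ∈ (Finset.univ.erase 0 : Finset (Fin (n + 2))),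
        ((pairings (Fin (n + 2))).filter fun σ => σ 0 = j).card = count n 0 := by
      intro j hj
      have hj0 : j ≠ 0 := (Finset.mem_erase.1 hj).1
      -- Gluing with an empty inner block simply removes the chord `{0, j}`.
      have h2 := sum_pairings_eq_mul (α := Fin (n + 2)) (P := fun _ => False) (p := 0) (j := j)
        not_false not_false hj0.symm (fun _ => 1) (fun _ => 1) (fun _ => 1) (fun _ _ _ _ => rfl)
      simp only [Finset.sum_const, smul_eq_mul, mul_one, card_pairings] at h2
      have h3 : Fintype.card {x // Outside (fun _ : Fin (n + 2) => False) 0 j x} = n := by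
        rw [Fintype.card_subtype]
        have : Finset.univ.filter (Outside (fun _ : Fin (n + 2) => False) 0 j) = {0, j}ᶜ := by
          ext x
          simp [Outside]
        rw [this, Finset.card_compl, Finset.card_pair hj0.symm, Fintype.card_fin]
        omega
      rw [h3, Fintype.card_eq_zero (α := {x : Fin (n + 2) // False}), count_zero_zero, one_mul] at h2
      rw [← h2]
      congr 1
      ext σ
      simp
    rw [Finset.sum_congr rfl h1, Finset.sum_const, Finset.card_erase_of_mem (Finset.mem_univ _),
      Finset.card_univ, Fintype.card_fin, smul_eq_mul]
    rfl
  · intro σ hσ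
    exact Finset.mem_coe.2 (Finset.mem_erase.2
      ⟨(mem_pairings.1 (Finset.mem_coe.1 hσ)).2 0, Finset.mem_univ _⟩)

/-! ### From partition words to pairings -/

section Partner

variable {n k : ℕ} {w : Fin n → Fin k}

open Classical in
/-- The other position with the same letter. -/
noncomputable def partner (w : Fin n → Fin k) (x : Fin n) : Fin n :=
  if h : ∃ y, y ≠ x ∧ w y = w x then h.choose else x

lemma partner_eq (hw : ∀ l, (Finset.univ.filter fun m => w m = w l).card = 2) {x y : Fin n}
    (hy : y ≠ x) (hxy : w y = w x) : partner w x = y := by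
  have h : ∃ y, y ≠ x ∧ w y = w x := ⟨y, hy, hxy⟩
  rw [partner, dif_pos h]
  by_contra hne
  have h1 : ({h.choose, y, x} : Finset (Fin n)) ⊆ Finset.univ.filter fun m => w m = w x := by
    intro z hz
    simp only [Finset.mem_insert, Finset.mem_singleton] at hz
    rw [Finset.mem_filter]
    rcases hz with rfl | rfl | rfl
    · exact ⟨Finset.mem_univ _, h.choose_spec.2⟩
    · exact ⟨Finset.mem_univ _, hxy⟩
    · exact ⟨Finset.mem_univ _, rfl⟩
  have h2 := Finset.card_le_card h1
  rw [hw, Finset.card_eq_three.2 ⟨_, _, _, hne, h.choose_spec.1, hy, rfl⟩] at h2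
  omega

lemma partner_spec (hw : ∀ l, (Finset.univ.filter fun m => w m = w l).card = 2) (x : Fin n) :
    partner w x ≠ x ∧ w (partner w x) = w x := by
  have h1 : 1 < (Finset.univ.filter fun m => w m = w x).card := by rw [hw]; omega
  obtain ⟨y, hy, hyx⟩ := Finset.exists_mem_ne h1 x
  have hy' : w y = w x := (Finset.mem_filter.1 hy).2
  rw [partner_eq hw hyx hy']
  exact ⟨hyx, hy'⟩

lemma eq_iff_eq_partner (hw : ∀ l, (Finset.univ.filter fun m => w m = w l).card = 2)
    {x y : Fin n} : w y = w x ↔ y = x ∨ y = partner w x := by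
  constructor
  · intro h
    by_cases hy : y = x
    · exact Or.inl hy
    · exact Or.inr (partner_eq hw hy h).symm
  · rintro (rfl | rfl)
    · rfl
    · exact (partner_spec hw x).2

lemma partner_mem_pairings (hw : ∀ l, (Finset.univ.filter fun m => w m = w l).card = 2) :
    partner w ∈ pairings (Fin n) :=
  mem_pairings.2 ⟨fun x => partner_eq hw (partner_spec hw x).1.symm (partner_spec hw x).2.symm,
    fun x => (partner_spec hw x).1⟩

/-- Only stability under `partner` matters. Once both occurrences of each letter lie in the
interval, the alphabetic condition is inherited from the whole word, since the earlier occurrence it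
supplies lies there too. -/
lemma isPartitionOn_Ioo_iff (hw : IsPartitionOn w Finset.univ) {p q : Fin n} :
    IsPartitionOn w (Finset.Ioo p q) ↔
      ∀ r, p < r → r < q → p < partner w r ∧ partner w r < q := by
  have hw2 : ∀ l, (Finset.univ.filter fun m => w m = w l).card = 2 :=
    fun l => hw.1 l (Finset.mem_univ l)
  constructor
  · intro h r h1 h2
    have h3 := h.1 r (Finset.mem_Ioo.2 ⟨h1, h2⟩)
    have h4 : (Finset.Ioo p q).filter (fun m => w m = w r) =
        Finset.univ.filter fun m => w m = w r :=
      Finset.eq_of_subset_of_card_le (Finset.filter_subset_filter _ (Finset.subset_univ _))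
        (by rw [h3, hw2])
    have h5 : partner w r ∈ (Finset.Ioo p q).filter (fun m => w m = w r) := by
      rw [h4, Finset.mem_filter]
      exact ⟨Finset.mem_univ _, (partner_spec hw2 r).2⟩
    exact Finset.mem_Ioo.1 (Finset.mem_filter.1 h5).1
  · intro h
    have hmem : ∀ l ∈ Finset.Ioo p q, ∀ m, w m = w l → m ∈ Finset.Ioo p q := by
      intro l hl m hm
      rcases (eq_iff_eq_partner hw2).1 hm with rfl | rfl
      · exact hl
      · exact Finset.mem_Ioo.2 (h l (Finset.mem_Ioo.1 hl).1 (Finset.mem_Ioo.1 hl).2)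
    refine ⟨fun l hl => ?_, fun l hl m _ hlm => ?_⟩
    · rw [← hw2 l]
      congr 1
      ext m
      simp only [Finset.mem_filter, Finset.mem_univ, true_and, and_iff_right_iff_imp]
      exact hmem l hl m
    · obtain ⟨l', -, h1, h2⟩ := hw.2 l (Finset.mem_univ l) m (Finset.mem_univ m) hlm
      exact ⟨l', hmem l hl l' h2, h1, h2⟩

lemma height_eq_card_isIsolated (hw : IsPartitionOn w Finset.univ) :
    height w = (Finset.univ.filter (IsIsolated (partner w))).card := by
  have hw2 : ∀ l, (Finset.univ.filter fun m => w m = w l).card = 2 :=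
    fun l => hw.1 l (Finset.mem_univ l)
  have key : ∀ p : Fin n × Fin n, p.1 < p.2 → w p.1 = w p.2 → p.2 = partner w p.1 :=
    fun p h1 h2 => (partner_eq hw2 h1.ne' h2.symm).symm
  refine Finset.card_nbij' (fun p => p.1) (fun x => (x, partner w x)) ?_ ?_ ?_ ?_
  · intro p hp
    obtain ⟨-, h1, h2, h3⟩ := Finset.mem_filter.1 hp
    have h4 := key p h1 h2
    refine Finset.mem_filter.2 ⟨Finset.mem_univ _, ?_⟩
    rw [IsIsolated, ← h4]
    exact ⟨h1, (isPartitionOn_Ioo_iff hw).1 h3⟩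
  · intro x hx
    obtain ⟨-, h1, h2⟩ := Finset.mem_filter.1 hx
    exact Finset.mem_filter.2 ⟨Finset.mem_univ _, h1, (partner_spec hw2 x).2.symm,
      (isPartitionOn_Ioo_iff hw).2 h2⟩
  · intro p hp
    obtain ⟨-, h1, h2, -⟩ := Finset.mem_filter.1 hp
    exact Prod.ext rfl (key p h1 h2).symm
  · intro x _
    rfl

end Partner

/-! ### Left ends of chords -/

section Openers

variable {n : ℕ} {σ : Fin n → Fin n}

/-- The number of chords of `σ` that start before `m`. -/
def openersBelow (σ : Fin n → Fin n) (m : Fin n) : ℕ :=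
  (Finset.univ.filter fun y => y < σ y ∧ y < m).card

lemma openersBelow_mono {m m' : Fin n} (h : m ≤ m') :
    openersBelow σ m ≤ openersBelow σ m' :=
  Finset.card_le_card fun y hy => by
    simp only [Finset.mem_filter, Finset.mem_univ, true_and] at hy ⊢
    exact ⟨hy.1, hy.2.trans_le h⟩

lemma openersBelow_lt {m m' : Fin n} (hm : m < σ m) (h : m < m') :
    openersBelow σ m < openersBelow σ m' := by
  refine Finset.card_lt_card (Finset.ssubset_iff_of_subset (fun y hy => ?_) |>.2 ⟨m, ?_, ?_⟩)
  · simp only [Finset.mem_filter, Finset.mem_univ, true_and] at hy ⊢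
    exact ⟨hy.1, hy.2.trans h⟩
  · simp [hm, h]
  · simp

/-- The pairing exchanges the left ends of chords with the right ends. -/
lemma two_mul_card_openers (hσ : σ ∈ pairings (Fin n)) :
    2 * (Finset.univ.filter fun y => y < σ y).card = n := by
  obtain ⟨h1, h2⟩ := mem_pairings.1 hσ
  have h3 : (Finset.univ.filter fun y => ¬y < σ y).card =
      (Finset.univ.filter fun y => y < σ y).card := by
    refine Finset.card_nbij' σ σ ?_ ?_ (fun y _ => h1 y) fun y _ => h1 y
    · intro y hy
      simp only [Finset.coe_filter, Finset.mem_univ, true_and, Set.mem_ofPred_eq, not_lt,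
        h1] at hy ⊢
      exact lt_of_le_of_ne hy (h2 y)
    · intro y hy
      simp only [Finset.coe_filter, Finset.mem_univ, true_and, Set.mem_ofPred_eq, not_lt,
        h1] at hy ⊢
      exact hy.le
  have h4 := Finset.card_filter_add_card_filter_not (s := (Finset.univ : Finset (Fin n)))
    (fun y => y < σ y)
  rw [h3, Finset.card_univ, Fintype.card_fin] at h4
  omega

lemma min_lt_apply_min (hσ : σ ∈ pairings (Fin n)) (x : Fin n) :
    min x (σ x) < σ (min x (σ x)) := by
  obtain ⟨h1, h2⟩ := mem_pairings.1 hσ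
  rcases lt_or_gt_of_ne (h2 x) with h | h
  · rw [min_eq_right h.le, h1]
    exact h
  · rw [min_eq_left h.le]
    exact h

lemma min_eq_min_iff (hσ : σ ∈ pairings (Fin n)) {x y : Fin n} :
    min y (σ y) = min x (σ x) ↔ y = x ∨ y = σ x := by
  obtain ⟨h1, h2⟩ := mem_pairings.1 hσ
  constructor
  · intro h
    rcases min_choice y (σ y) with hy | hy <;> rcases min_choice x (σ x) with hx | hx <;>
      rw [hx, hy] at h
    · exact Or.inl h
    · exact Or.inr h
    · exact Or.inr (by rw [← h, h1])
    · exact Or.inl (by rw [← h1 y, h, h1])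
  · rintro (rfl | rfl)
    · rfl
    · rw [h1, min_comm]

end Openers

/-! ### The bijection between partition words and pairings -/

section Words

variable {k : ℕ} {w : Fin (2 * k) → Fin k}

/-- Each letter used takes two of the `2 * k` positions, so `k` letters are used. -/
lemma surjective_of_card_eq_two
    (hw : ∀ l, (Finset.univ.filter fun m => w m = w l).card = 2) : Function.Surjective w := by
  have h1 := Finset.card_eq_sum_card_image w Finset.univ
  rw [Finset.sum_congr rfl (g := fun _ => 2), Finset.sum_const, Finset.card_univ,
    Fintype.card_fin, smul_eq_mul] at h1
  · have h2 : Finset.univ.image w = Finset.univ :=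
      Finset.eq_univ_of_card _ (by rw [Fintype.card_fin]; omega)
    intro a
    have h3 : a ∈ Finset.univ.image w := h2 ▸ Finset.mem_univ a
    obtain ⟨x, -, hx⟩ := Finset.mem_image.1 h3
    exact ⟨x, hx⟩
  · intro a ha
    obtain ⟨x, -, rfl⟩ := Finset.mem_image.1 ha
    exact hw x

/-- A partition word is determined by the pairing of its positions. -/
lemma val_eq_openersBelow (hw : IsPartitionOn w Finset.univ) (x : Fin (2 * k)) :
    (w x).val = openersBelow (partner w) (min x (partner w x)) := by
  have hw2 : ∀ l, (Finset.univ.filter fun m => w m = w l).card = 2 :=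
    fun l => hw.1 l (Finset.mem_univ l)
  have hσ := partner_mem_pairings hw2
  have hmin : ∀ y, w (min y (partner w y)) = w y := fun y => by
    rcases min_choice y (partner w y) with h | h <;> rw [h]
    exact (partner_spec hw2 y).2
  rw [openersBelow, ← Fin.card_Iio]
  symm
  -- The word itself maps the first occurrences before that of `w x` bijectively onto the letters
  -- below `w x`: alphabetic order gives the range and surjectivity.
  refine Finset.card_nbij w ?_ ?_ ?_
  · intro y hy
    obtain ⟨-, -, h2⟩ := Finset.mem_filter.1 hy
    rw [Finset.coe_Iio, Set.mem_Iio]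
    by_contra h
    rcases (not_lt.1 h).eq_or_lt with h | h
    · rcases (eq_iff_eq_partner hw2).1 h.symm with rfl | rfl
      · exact (h2.trans_le (min_le_left _ _)).false
      · exact (h2.trans_le (min_le_right _ _)).false
    · obtain ⟨l, -, h3, h4⟩ := hw.2 x (Finset.mem_univ _) y (Finset.mem_univ _) h
      rcases (eq_iff_eq_partner hw2).1 h4 with rfl | rfl
      · exact ((h3.trans h2).trans_le (min_le_left _ _)).false
      · exact ((h3.trans h2).trans_le (min_le_right _ _)).false
  · intro y hy z hz h
    have hy1 := (Finset.mem_filter.1 hy).2.1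
    have hz1 := (Finset.mem_filter.1 hz).2.1
    rcases (eq_iff_eq_partner hw2).1 h with h | h
    · exact h
    · rw [h, (mem_pairings.1 hσ).1] at hy1
      exact absurd hz1 hy1.not_gt
  · intro a ha
    obtain ⟨l, rfl⟩ := surjective_of_card_eq_two hw2 a
    have ha : w l < w (min x (partner w x)) := by
      rw [hmin]
      exact Finset.mem_Iio.1 (Finset.mem_coe.1 ha)
    obtain ⟨l', -, h1, h2⟩ := hw.2 l (Finset.mem_univ _) _ (Finset.mem_univ _) ha
    refine ⟨min l' (partner w l'), ?_, (hmin l').trans h2⟩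
    exact Finset.mem_coe.2 (Finset.mem_filter.2 ⟨Finset.mem_univ _, min_lt_apply_min hσ l',
      (min_le_left _ _).trans_lt h1⟩)

/-- Number the chords by their left ends from left to right, starting from `0`, and write at each
position the number of its chord. -/
lemma exists_word_partner_eq {σ : Fin (2 * k) → Fin (2 * k)} (hσ : σ ∈ pairings (Fin (2 * k))) :
    ∃ w : Fin (2 * k) → Fin k, IsPartitionOn w Finset.univ ∧ partner w = σ := by
  have hlt : ∀ x, openersBelow σ (min x (σ x)) < k := by
    intro x
    have h1 := two_mul_card_openers hσ
    have h2 : openersBelow σ (min x (σ x)) < (Finset.univ.filter fun y => y < σ y).card := by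
      refine Finset.card_lt_card (Finset.ssubset_iff_of_subset (fun y hy => ?_) |>.2
        ⟨min x (σ x), ?_, ?_⟩)
      · exact Finset.mem_filter.2 ⟨Finset.mem_univ _, (Finset.mem_filter.1 hy).2.1⟩
      · exact Finset.mem_filter.2 ⟨Finset.mem_univ _, min_lt_apply_min hσ x⟩
      · exact fun h => lt_irrefl _ (Finset.mem_filter.1 h).2.2
    omega
  let w : Fin (2 * k) → Fin k := fun x => ⟨openersBelow σ (min x (σ x)), hlt x⟩
  have hw : ∀ x y, w y = w x ↔ y = x ∨ y = σ x := by
    intro x y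
    rw [← min_eq_min_iff hσ, Fin.ext_iff]
    refine ⟨fun h => ?_, fun h => ?_⟩
    · by_contra hne
      rcases lt_or_gt_of_ne hne with h' | h'
      · exact (openersBelow_lt (min_lt_apply_min hσ y) h').ne h
      · exact (openersBelow_lt (min_lt_apply_min hσ x) h').ne' h
    · exact congrArg (openersBelow σ) h
  have hne := (mem_pairings.1 hσ).2
  have hw2 : ∀ l, (Finset.univ.filter fun m => w m = w l).card = 2 := by
    intro l
    have : (Finset.univ.filter fun m => w m = w l) = {l, σ l} := by
      ext m
      simp [hw]
    rw [this, Finset.card_pair (hne l).symm]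
  refine ⟨w, ⟨fun l _ => hw2 l, fun l _ m _ hlm => ?_⟩, ?_⟩
  · refine ⟨min l (σ l), Finset.mem_univ _, ?_, ?_⟩
    · by_contra h
      refine (not_le.2 hlm) (openersBelow_mono ?_)
      exact (min_le_left _ _).trans (not_lt.1 h)
    · rw [hw]
      exact min_choice _ _
  · funext x
    exact partner_eq hw2 (hne x) ((hw x (σ x)).2 (Or.inr rfl))

/-- The sum over partition words as a count of pairings. -/
theorem sum_words_two_pow_height (k : ℕ) :
    ∑ w ∈ words k, 2 ^ height w = count 0 (2 * k) := by
  have h : weightedCount (Finset.univ : Finset (Fin (2 * k))) = count 0 (2 * k) :=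
    weightedCount_eq_count (fun _ _ _ _ => Finset.mem_univ _) (by simp) (by simp)
  have hmem : ∀ {w : Fin (2 * k) → Fin k}, w ∈ words k ↔ IsPartitionOn w Finset.univ := by
    simp [words]
  rw [← h]
  refine Finset.sum_nbij partner ?_ ?_ ?_ ?_
  · intro w hw
    exact partner_mem_pairings fun l => (hmem.1 hw).1 l (Finset.mem_univ l)
  · intro w hw w' hw' h
    funext x
    rw [Fin.ext_iff, val_eq_openersBelow (hmem.1 hw), val_eq_openersBelow (hmem.1 hw'), h]
  · intro σ hσ
    obtain ⟨w, hw, rfl⟩ := exists_word_partner_eq hσ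
    exact ⟨w, hmem.2 hw, rfl⟩
  · intro w hw
    rw [height_eq_card_isIsolated (hmem.1 hw)]

end Words

/-! ### Counts as moments -/

lemma count_zero_le (n : ℕ) : count 0 n ≤ 2 ^ n * count n 0 := by
  have h : weightedCount (Finset.univ : Finset (Fin n)) = count 0 n :=
    weightedCount_eq_count (fun _ _ _ _ => Finset.mem_univ _) (by simp) (by simp)
  have h' : (pairings (Fin n)).card = count n 0 := by
    rw [card_pairings, Fintype.card_fin]
  rw [← h, ← h', mul_comm, ← smul_eq_mul]
  refine Finset.sum_le_card_nsmul _ _ _ fun σ _ => Nat.pow_le_pow_right two_pos ?_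
  exact (Finset.card_filter_le _ _).trans (by simp)

open FreeConv

lemma count_zero_eq_integral_pow (b : ℕ) :
    (count b 0 : ℝ) = ∫ x : ℝ, x ^ b ∂gaussianReal 0 1 := by
  induction b using Nat.twoStepInduction with
  | zero => simp [count_zero_zero]
  | one =>
    rw [count_one_zero, integral_pow_eq_zero_of_isSymmetric isSymmetric_gaussianReal odd_one,
      Nat.cast_zero]
  | more b ih _ =>
    rw [count_add_two_zero, integral_pow_add_two_gaussianReal, ← ih]
    push_cast
    rfl

lemma count_two_mul_zero (k : ℕ) : count (2 * k) 0 * (2 ^ k * k.factorial) = (2 * k).factorial := by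
  induction k with
  | zero => simp [count_zero_zero]
  | succ k ih =>
    rw [show 2 * (k + 1) = 2 * k + 2 by ring, count_add_two_zero, Nat.factorial_succ (2 * k + 1),
      Nat.factorial_succ (2 * k), Nat.factorial_succ k, ← ih]
    ring

/-- There are `(2k)! / (2^k k!)` pairings of `2k` points, each of weight at most `4^k`, so the terms
are at most `(2 t²)^k / k!`. -/
lemma summable_pow_div_factorial_mul_count (t : ℝ) :
    Summable fun k : ℕ => t ^ (2 * k) / (2 * k).factorial * (count 0 (2 * k) : ℝ) := by
  refine (Real.summable_pow_div_factorial (2 * t ^ 2)).of_nonneg_of_le (fun k => ?_) fun k => ?_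
  · rw [pow_mul]
    positivity
  · have h1 : (count 0 (2 * k) : ℝ) ≤ 2 ^ (2 * k) * count (2 * k) 0 := by
      exact_mod_cast count_zero_le (2 * k)
    have h2 : (count (2 * k) 0 : ℝ) * (2 ^ k * k.factorial) = (2 * k).factorial := by
      exact_mod_cast count_two_mul_zero k
    have h3 : 0 ≤ t ^ (2 * k) / ((2 * k).factorial : ℝ) := by
      rw [pow_mul]
      positivity
    refine (mul_le_mul_of_nonneg_left h1 h3).trans_eq ?_
    have h4 : ((2 * k).factorial : ℝ) ≠ 0 := by positivity
    have h5 : (k.factorial : ℝ) ≠ 0 := by positivity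
    rw [div_mul_eq_mul_div, div_eq_div_iff h4 h5, ← h2, pow_mul 2, pow_mul t, mul_pow]
    rw [show ((2 : ℝ) ^ 2) ^ k = 2 ^ k * 2 ^ k by rw [← mul_pow]; norm_num]
    ring

/-- The moments of the free convolution of the semicircle and the standard normal law. -/
theorem integral_pow_eq_count {ρ : Measure ℝ} [IsProbabilityMeasure ρ]
    (h : ∀ z : ℂ, 1 < z.im →
      cauchyTransform ρ z = cauchyTransform (gaussianReal 0 1) (z - cauchyTransform ρ z)) (n : ℕ) :
    Integrable (fun x : ℝ => x ^ n) ρ ∧ ∫ x : ℝ, x ^ n ∂ρ = count 0 n := by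
  refine integral_pow_of_forall_hasExpansion (c := fun n => (count 0 n : ℝ)) (fun N => ?_) n
  refine hasExpansion_of_cauchyTransform_eq (d := fun b n => (count b n : ℝ))
    integrable_pow_gaussianReal h count_zero_eq_integral_pow (fun b => ?_) (fun b n => ?_) N
  · simp [count_succ b 0]
  · simp only [count_succ b (n + 1)]
    push_cast
    congr 1

end PartitionWord

theorem propositionA5 :
    ∃ γ : ProbabilityMeasure ℝ,
      (∀ ρ : ProbabilityMeasure ℝ,
        FreeConv.IsFreeConvolution FreeConv.semicircle (gaussianReal 0 1) (ρ : Measure ℝ) ↔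
          ρ = γ) ∧
      (∀ ρ : ProbabilityMeasure ℝ,
        (FreeConv.IsSymmetric (ρ : Measure ℝ) ∧ FreeConv.HasHeightMoments (ρ : Measure ℝ)) ↔
          ρ = γ) := by
  -- The solution of the Pastur equation serves as `γ` in both characterisations.
  obtain ⟨γ, hγ, h⟩ := FreeConv.exists_cauchyTransform_eq_self_sub (gaussianReal 0 1)
  have hsum : ∀ k, ∑ w ∈ PartitionWord.words k, (2 : ℝ) ^ PartitionWord.height w =
      PartitionWord.count 0 (2 * k) := fun k => by
    exact_mod_cast PartitionWord.sum_words_two_pow_height k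
  have hmom : FreeConv.HasHeightMoments γ := fun k => by
    rw [hsum]
    exact PartitionWord.integral_pow_eq_count h (2 * k)
  have hsymm : FreeConv.IsSymmetric γ :=
    FreeConv.isSymmetric_of_cauchyTransform_eq_self_sub FreeConv.isSymmetric_gaussianReal h
  refine ⟨⟨γ, hγ⟩, fun ρ => ⟨fun hρ => ?_, ?_⟩, fun ρ => ⟨fun hρ => ?_, ?_⟩⟩
  · have := ρ.2
    exact Subtype.ext (FreeConv.eq_of_isFreeConvolution_semicircle (ρ' := ρ.1) h hρ)
  · rintro rfl
    change FreeConv.IsFreeConvolution _ _ γ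
    refine FreeConv.isFreeConvolution_semicircle_of_cauchyTransform_eq
      (FreeConv.integrable_pow_gaussianReal 2) ?_ h
    -- The recursion at `n = 0` shows that the second moment is exactly `1`, as the construction of
    -- the right inverse allows.
    have h2 := FreeConv.integral_pow_add_two_gaussianReal 0
    simp only [zero_add, pow_zero, integral_const, probReal_univ] at h2
    simp [h2]
  · have := ρ.2
    refine Subtype.ext (FreeConv.eq_of_isSymmetric_of_integral_pow_eq (ρ := ρ.1) hρ.1 hsymm hρ.2 hmom ?_)
    simp only [hsum]
    exact PartitionWord.summable_pow_div_factorial_mul_count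
  · rintro rfl
    exact ⟨hsymm, hmom⟩
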